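/- Let $\mathbb{S}^2\subset\mathbb{R}^3$ be the unit sphere with its round metric $g_0$ of curvature one. A finite Borel (i.e. Radon) measure $\mu$ on $\mathbb{S}^2$ is called admissible if the identity map on $C^\infty(\mathbb{S}^2)$ extends to a compact operator $W^{1,2}(\mathbb{S}^2,g_0)\to L^2(\mathbb{S}^2,\mu)$. For $k\ge 0$ put $$\lambda_k(\mathbb{S}^2,\mu)=\inf_{E_{k+1}}\ \sup_{0\ne f\in E_{k+1}}\frac{\int_{\mathbb{S}^2}|\nabla f|_{g_0}^2\,dv_{g_0}}{\int_{\mathbb{S}^2}f^2\,d\mu},\qquad \bar\lambda_k(\mathbb{S}^2,\mu)=\lambda_k(\mathbb{S}^2,\mu)\,\mu(\mathbb{S}^2),$$ where $E_{k+1}$ runs over the $(k+1)$-dimensional subspaces of $C^\infty(\mathbb{S}^2)$ that are also $(k+1)$-dimensional in $L^2(\mathbb{S}^2,\mu)$ (the infimum of the empty set being $+\infty$). For a signed measure $\nu$ let $\|\nu\|_{(C^1(\mathbb{S}^2))^*}$ be the supremum of $\left|\int\varphi\,d\nu\right|$ over all $\varphi\in C^1(\mathbb{S}^2)$ with $\|\varphi\|_{C^1}=\sup|\varphi|+\sup|\nabla\varphi|_{g_0}\le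 1$. **Theorem.** There is a constant $c>0$ such that for every admissible measure $\mu$ on $\mathbb{S}^2$ with $\lambda_2(\mathbb{S}^2,\mu)=2$ there exist a conformal automorphism $\Phi:\mathbb{S}^2\to\mathbb{S}^2$ (a diffeomorphism with $\Phi^*g_0=\rho g_0$ for some positive function $\rho$) and a point $p\in\mathbb{S}^2$ such that $$16\pi-\bar\lambda_2(\mathbb{S}^2,\mu)\ \ge\ c\,\bigl\|dv_{g_0}+4\pi\delta_p-\Phi_*\mu\bigr\|_{(C^1(\mathbb{S}^2))^*}^2 ,$$ where $\delta_p$ is the unit Dirac measure at $p$. -/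

import Mathlib

open MeasureTheory Manifold
open scoped ContDiff ENNReal InnerProductSpace

noncomputable section

namespace SphereStability

/-- Euclidean three-space. -/
abbrev E3 : Type := EuclideanSpace ℝ (Fin 3)

/-- The unit sphere of `ℝ³`, with Mathlib's manifold structure. -/
abbrev S2 : Type := Metric.sphere (0 : E3) 1

/-! ### The round metric, its volume density and its conformal automorphisms -/

/-- The round metric of curvature one: the metric induced on the unit sphere by the inclusion into
`ℝ³`. -/
def roundMetric (x : S2) (v w : TangentSpace (𝓡 2) x) : ℝ :=
  ⟪mvfderiv (𝓡 2) ((↑) : S2 → E3) x v, mvfderiv (𝓡 2) ((↑) : S2 → E3) x w⟫_ℝ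

/-- The Riemannian measure of the round metric: the surface measure on the unit sphere, of total
mass `4π`. -/
def roundVolume : Measure S2 := (volume : Measure E3).toSphere

instance : IsFiniteMeasure roundVolume :=
  inferInstanceAs (IsFiniteMeasure ((volume : Measure E3).toSphere))

/-- A conformal automorphism of the sphere: a diffeomorphism that pulls the round metric back to
a positive multiple of itself at every point. -/
def IsConformalAutomorphism (Φ : S2 ≃ₘ^∞⟮𝓡 2, 𝓡 2⟯ S2) : Prop :=
  ∀ x : S2, ∃ ρ : ℝ, 0 < ρ ∧ ∀ v w : TangentSpace (𝓡 2) x,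
    roundMetric (Φ x) (mfderiv (𝓡 2) (𝓡 2) Φ x v) (mfderiv (𝓡 2) (𝓡 2) Φ x w)
      = ρ * roundMetric x v w

/-! ### The gradient -/

/-- The extension of a function on the sphere to `ℝ³ \ {0}` that is constant along rays (with value
`0` at the origin). -/
def radialExt (f : S2 → ℝ) (y : E3) : ℝ :=
  if h : y = 0 then 0 else f ⟨‖y‖⁻¹ • y, by simp [norm_smul, h]⟩

/-- The gradient of `f` with respect to the round metric, as a vector of `ℝ³` tangent to the
sphere; see `inner_sphGrad_mvfderiv` and `inner_sphGrad_self`. -/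
def sphGrad (f : S2 → ℝ) (x : S2) : E3 := gradient (radialExt f) (x : E3)

lemma coe_ne_zero (x : S2) : (x : E3) ≠ 0 := by
  have h1 : ‖(x : E3)‖ = 1 := by simp
  intro h; rw [h] at h1; simp at h1

lemma radialExt_coe (f : S2 → ℝ) (x : S2) : radialExt f (x : E3) = f x := by
  unfold radialExt
  rw [dif_neg (coe_ne_zero x)]
  congr 1
  ext1
  simp

lemma contDiffAt_radialExt {n : ℕ∞ω} {f : S2 → ℝ} (hf : ContMDiff (𝓡 2) 𝓘(ℝ, ℝ) n f)
    {y : E3} (hy : y ≠ 0) : ContDiffAt ℝ n (radialExt f) y := by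
  have : Fact (Module.finrank ℝ E3 = 2 + 1) := ⟨by simp⟩
  let U : TopologicalSpace.Opens E3 := ⟨{0}ᶜ, isOpen_compl_singleton⟩
  have hU : ∀ z : U, (z : E3) ≠ 0 := fun z => z.2
  have h1 : ContMDiff 𝓘(ℝ, E3) 𝓘(ℝ, E3) n (fun z : U => ‖(z : E3)‖⁻¹ • (z : E3)) := by
    intro z
    have : ContDiffAt ℝ n (fun z : E3 => ‖z‖⁻¹ • z) (z : E3) :=
      ((contDiffAt_norm ℝ (hU z)).inv (norm_ne_zero_iff.2 (hU z))).smul contDiffAt_id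
    exact contMDiffAt_subtype_iff.2 this.contMDiffAt
  have h2 := hf.comp (h1.codRestrict_sphere (n := 2)
    (fun z => by simp [norm_smul, hU z]))
  have h3 : ContMDiff 𝓘(ℝ, E3) 𝓘(ℝ, ℝ) n (fun z : U => radialExt f (z : E3)) := by
    convert h2 using 1
    funext z
    unfold radialExt
    rw [dif_neg (hU z)]
    rfl
  have h4 := contMDiffAt_subtype_iff.1 (h3 ⟨y, hy⟩)
  exact h4.contDiffAt

lemma differentiableAt_radialExt {f : S2 → ℝ} (hf : ContMDiff (𝓡 2) 𝓘(ℝ, ℝ) 1 f) (x : S2) :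
    DifferentiableAt ℝ (radialExt f) (x : E3) :=
  (contDiffAt_radialExt hf (coe_ne_zero x)).differentiableAt (by simp)

/-- The defining property of the gradient: `g₀(∇f, v) = df(v)` for every tangent vector `v`. -/
theorem inner_sphGrad_mvfderiv {f : S2 → ℝ} (hf : ContMDiff (𝓡 2) 𝓘(ℝ, ℝ) 1 f) (x : S2)
    (v : TangentSpace (𝓡 2) x) :
    ⟪sphGrad f x, mvfderiv (𝓡 2) ((↑) : S2 → E3) x v⟫_ℝ = mvfderiv (𝓡 2) f x v := by
  have : Fact (Module.finrank ℝ E3 = 2 + 1) := ⟨by simp⟩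
  have hc : HasMFDerivAt (𝓡 2) 𝓘(ℝ, E3) ((↑) : S2 → E3) x
      (mfderiv (𝓡 2) 𝓘(ℝ, E3) ((↑) : S2 → E3) x) :=
    ((contMDiff_coe_sphere (m := 1) x).mdifferentiableAt one_ne_zero).hasMFDerivAt
  have hF : HasMFDerivAt 𝓘(ℝ, E3) 𝓘(ℝ, ℝ) (radialExt f) (x : E3) (fderiv ℝ (radialExt f) (x : E3)) :=
    (differentiableAt_radialExt hf x).hasFDerivAt.hasMFDerivAt
  have h := (hF.comp x hc).mfderiv
  have h2 : radialExt f ∘ ((↑) : S2 → E3) = f := funext (radialExt_coe f)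
  rw [h2] at h
  rw [sphGrad, inner_gradient_left]
  exact (congrArg (fun L => L v) h).symm

/-- The gradient is tangent to the sphere. -/
theorem inner_sphGrad_self {f : S2 → ℝ} (hf : ContMDiff (𝓡 2) 𝓘(ℝ, ℝ) 1 f) (x : S2) :
    ⟪sphGrad f x, (x : E3)⟫_ℝ = 0 := by
  rw [sphGrad, inner_gradient_left]
  have h1 : HasDerivAt (fun t : ℝ => t • (x : E3)) (x : E3) 1 := by
    simpa using (hasDerivAt_id (1 : ℝ)).smul_const (x : E3)
  have h2 : HasFDerivAt (radialExt f) (fderiv ℝ (radialExt f) (x : E3)) ((1 : ℝ) • (x : E3)) := by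
    rw [one_smul]; exact (differentiableAt_radialExt hf x).hasFDerivAt
  have h3 := h2.comp_hasDerivAt (1 : ℝ) h1
  refine h3.unique ((hasDerivAt_const (1 : ℝ) (f x)).congr_of_eventuallyEq ?_)
  filter_upwards [lt_mem_nhds (zero_lt_one' ℝ)] with t ht
  have hx : ‖(x : E3)‖ = 1 := by simp
  simp only [Function.comp_apply, radialExt]
  rw [dif_neg (smul_ne_zero ht.ne' (coe_ne_zero x))]
  congr 1
  ext1
  simp [norm_smul, abs_of_pos ht, smul_smul, ht.ne']

lemma continuous_sphGrad {f : S2 → ℝ} (hf : ContMDiff (𝓡 2) 𝓘(ℝ, ℝ) 1 f) :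
    Continuous (sphGrad f) := by
  rw [continuous_iff_continuousAt]
  intro x
  have h := ((contDiffAt_radialExt hf (coe_ne_zero x)).fderiv_right (m := 0) (by simp)).continuousAt
  have h' : ContinuousAt (gradient (radialExt f)) (x : E3) :=
    (InnerProductSpace.toDual ℝ E3).symm.continuous.continuousAt.comp h
  exact h'.comp continuous_subtype_val.continuousAt

lemma sphGrad_add {f g : S2 → ℝ} (hf : ContMDiff (𝓡 2) 𝓘(ℝ, ℝ) 1 f)
    (hg : ContMDiff (𝓡 2) 𝓘(ℝ, ℝ) 1 g) : sphGrad (f + g) = sphGrad f + sphGrad g := by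
  funext x
  have h : radialExt (f + g) = radialExt f + radialExt g := by
    funext y; by_cases hy : y = 0 <;> simp [radialExt, hy]
  simp only [sphGrad, gradient, h, Pi.add_apply]
  rw [fderiv_add (differentiableAt_radialExt hf x) (differentiableAt_radialExt hg x), map_add]

lemma sphGrad_smul (c : ℝ) {f : S2 → ℝ} (hf : ContMDiff (𝓡 2) 𝓘(ℝ, ℝ) 1 f) :
    sphGrad (c • f) = c • sphGrad f := by
  funext x
  have h : radialExt (c • f) = c • radialExt f := by
    funext y; by_cases hy : y = 0 <;> simp [radialExt, hy]
  simp only [sphGrad, gradient, h, Pi.smul_apply]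
  rw [fderiv_const_smul (differentiableAt_radialExt hf x), map_smulₛₗ]
  simp

/-! ### Smooth functions, `L²(μ)` and `W^{1,2}` -/

/-- Smooth real-valued functions on the sphere. -/
abbrev SmoothFun : Type := C^∞⟮𝓡 2, S2; 𝓘(ℝ, ℝ), ℝ⟯

lemma SmoothFun.contMDiff_one (f : SmoothFun) : ContMDiff (𝓡 2) 𝓘(ℝ, ℝ) 1 f :=
  f.contMDiff.of_le (by simp)

lemma memLp_of_continuous {F : Type*} [NormedAddCommGroup F] [SecondCountableTopology F]
    (μ : Measure S2) [IsFiniteMeasure μ] {f : S2 → F} (hf : Continuous f) : MemLp f 2 μ := by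
  obtain ⟨C, hC⟩ := isCompact_univ.exists_bound_of_continuousOn hf.continuousOn
  exact MemLp.of_bound hf.aestronglyMeasurable C (Filter.Eventually.of_forall fun x => hC x trivial)

lemma memLp_smoothFun (μ : Measure S2) [IsFiniteMeasure μ] (f : SmoothFun) : MemLp f 2 μ :=
  memLp_of_continuous μ f.contMDiff.continuous

lemma memLp_sphGrad (μ : Measure S2) [IsFiniteMeasure μ] (f : SmoothFun) :
    MemLp (sphGrad f) 2 μ :=
  memLp_of_continuous μ (continuous_sphGrad f.contMDiff_one)

/-- The identity map `C^∞(S²) → L²(S², μ)`. -/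
def toL2 (μ : Measure S2) [IsFiniteMeasure μ] : SmoothFun →ₗ[ℝ] Lp ℝ 2 μ where
  toFun f := (memLp_smoothFun μ f).toLp f
  map_add' f g := (memLp_smoothFun μ f).toLp_add (memLp_smoothFun μ g)
  map_smul' c f := (memLp_smoothFun μ f).toLp_const_smul c

/-- The gradient `C^∞(S²) → L²(S², dv; ℝ³)`. -/
def gradL2 : SmoothFun →ₗ[ℝ] Lp E3 2 roundVolume where
  toFun f := (memLp_sphGrad roundVolume f).toLp (sphGrad f)
  map_add' f g := by
    rw [← MemLp.toLp_add]
    simp only [ContMDiffMap.coe_add, sphGrad_add f.contMDiff_one g.contMDiff_one]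
  map_smul' c f := by
    rw [RingHom.id_apply, ← MemLp.toLp_const_smul]
    simp only [ContMDiffMap.coe_smul, sphGrad_smul c f.contMDiff_one]

/-- The map `f ↦ (f, ∇f)` from `C^∞(S²)` to `L²(S², dv) ⊕ L²(S², dv; ℝ³)`; the norm of the image
is the `W^{1,2}`-norm `(∫ f² + |∇f|² dv)^{1/2}` of `f`. -/
def sobolevGraph : SmoothFun →ₗ[ℝ] WithLp 2 (Lp ℝ 2 roundVolume × Lp E3 2 roundVolume) :=
  (WithLp.linearEquiv 2 ℝ (Lp ℝ 2 roundVolume × Lp E3 2 roundVolume)).symm.toLinearMap ∘ₗ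
    (toL2 roundVolume).prod gradL2

/-- The Sobolev space `W^{1,2}(S², g₀)`: the completion of `C^∞(S²)` for the `W^{1,2}`-norm,
realized as the closure of the pairs `(f, ∇f)` in `L² ⊕ L²`. -/
def W12 : Submodule ℝ (WithLp 2 (Lp ℝ 2 roundVolume × Lp E3 2 roundVolume)) :=
  (LinearMap.range sobolevGraph).topologicalClosure

/-- A smooth function as an element of `W^{1,2}(S², g₀)`. -/
def toW12 (f : SmoothFun) : W12 :=
  ⟨sobolevGraph f, Submodule.le_topologicalClosure _ (LinearMap.mem_range_self _ f)⟩

/-! ### Admissible measures and their eigenvalues -/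

/-- A finite Borel measure on the sphere is admissible if the identity map on `C^∞(S²)` extends to
a compact operator `W^{1,2}(S², g₀) → L²(S², μ)`. -/
def Admissible (μ : Measure S2) [IsFiniteMeasure μ] : Prop :=
  ∃ T : W12 →L[ℝ] Lp ℝ 2 μ, IsCompactOperator T ∧ ∀ f : SmoothFun, T (toW12 f) = toL2 μ f

/-- The Rayleigh quotient `∫ |∇f|² dv / ∫ f² dμ`. -/
def rayleigh (μ : Measure S2) (f : SmoothFun) : ℝ≥0∞ :=
  (∫⁻ x, ‖sphGrad f x‖ₑ ^ 2 ∂roundVolume) / ∫⁻ x, ‖f x‖ₑ ^ 2 ∂μ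

/-- The `k`-th eigenvalue `λ_k(S², μ)`: the infimum, over all `(k+1)`-dimensional subspaces `E` of
`C^∞(S²)` that are also `(k+1)`-dimensional in `L²(S², μ)`, of the supremum of the Rayleigh quotient
over the nonzero elements of `E`. -/
def eigenvalue (k : ℕ) (μ : Measure S2) [IsFiniteMeasure μ] : ℝ≥0∞ :=
  ⨅ (E : Submodule ℝ SmoothFun) (_ : Module.finrank ℝ E = k + 1)
    (_ : Module.finrank ℝ (E.map (toL2 μ)) = k + 1), ⨆ (f ∈ E) (_ : f ≠ 0), rayleigh μ f

/-- The normalized eigenvalue `λ_k(S², μ) μ(S²)`. -/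
def normalizedEigenvalue (k : ℕ) (μ : Measure S2) [IsFiniteMeasure μ] : ℝ≥0∞ :=
  eigenvalue k μ * μ Set.univ

/-! ### The dual norm of `C¹` -/

/-- The norm `sup |φ| + sup |∇φ|` of `C¹(S²)`. -/
def c1Norm (φ : S2 → ℝ) : ℝ≥0∞ := (⨆ x, ‖φ x‖ₑ) + ⨆ x, ‖sphGrad φ x‖ₑ

/-- The norm of `ν₁ - ν₂` in `(C¹(S²))*`: the supremum of `|∫ φ dν₁ - ∫ φ dν₂|` over all
`C¹` functions `φ` with `C¹`-norm at most one. -/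
def c1DualENorm (ν₁ ν₂ : Measure S2) : ℝ≥0∞ :=
  ⨆ (φ : S2 → ℝ) (_ : ContMDiff (𝓡 2) 𝓘(ℝ, ℝ) 1 φ) (_ : c1Norm φ ≤ 1),
    ‖(∫ x, φ x ∂ν₁) - ∫ x, φ x ∂ν₂‖ₑ

lemma enorm_integral_le_of_c1Norm (ν : Measure S2) {φ : S2 → ℝ} (h : c1Norm φ ≤ 1) :
    ‖∫ x, φ x ∂ν‖ₑ ≤ ν Set.univ := by
  refine (enorm_integral_le_lintegral_enorm _).trans ?_
  calc ∫⁻ x, ‖φ x‖ₑ ∂ν ≤ ∫⁻ _, 1 ∂ν :=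
        lintegral_mono fun x => (le_iSup (fun x => ‖φ x‖ₑ) x).trans (le_self_add.trans h)
    _ = ν Set.univ := by simp

/-- The dual norm of a difference of finite measures is finite. -/
theorem c1DualENorm_ne_top (ν₁ ν₂ : Measure S2) [IsFiniteMeasure ν₁] [IsFiniteMeasure ν₂] :
    c1DualENorm ν₁ ν₂ ≠ ⊤ := by
  refine ne_top_of_le_ne_top (b := ν₁ Set.univ + ν₂ Set.univ) (by finiteness) ?_
  refine iSup_le fun φ => iSup_le fun _ => iSup_le fun h => ?_
  exact enorm_sub_le.trans (add_le_add (enorm_integral_le_of_c1Norm ν₁ h)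
    (enorm_integral_le_of_c1Norm ν₂ h))

/-- The dual norm `‖ν₁ - ν₂‖` in `(C¹(S²))*` of two finite measures, as a real number. -/
def c1DualNorm (ν₁ ν₂ : Measure S2) [IsFiniteMeasure ν₁] [IsFiniteMeasure ν₂] : ℝ :=
  (c1DualENorm ν₁ ν₂).toReal

/-- The limiting configuration `dv + 4π δ_p`: the round sphere with one bubble at `p`. -/
def bubbleMeasure (p : S2) : Measure S2 :=
  roundVolume + ENNReal.ofReal (4 * Real.pi) • Measure.dirac p

instance (p : S2) : IsFiniteMeasure (bubbleMeasure p) := by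
  have := Measure.smul_finite (Measure.dirac p) (c := ENNReal.ofReal (4 * Real.pi)) ENNReal.ofReal_ne_top
  unfold bubbleMeasure
  infer_instance

end SphereStability

end

open SphereStability

/-! Write Q(f, g) = ∫⟨∇f, ∇g⟩ dv − 2 ∫ f g dμ and D = 16π − 2μ(S²), the deficit to be bounded below.
If μ(S²) ≤ 4π the deficit is at least 8π and the claim is trivial, so let μ(S²) > 4π.

Since λ₂ = 2, Q has no three mutually orthogonal negative directions. The constant 1 is a negative
direction. If there is a second one, it is represented by a smooth ψ that nearly minimizes the
Rayleigh quotient on the complement of the constants; no eigenfunction is needed. Adding suitable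
multiples of Q(·, 1)² and Q(·, ψ)² turns Q into a nonnegative form B, bounded above by 3∫|∇f|² dv +
8∫f² dμ (`exists_augmented_nonneg`).

The trial functions are the coordinates u_i of a Möbius transformation composed with a fold of the
sphere along a circle. The parameters are chosen so that Q(u_i, 1) = Q(u_i, ψ) = 0. The first
condition is Hersch's balancing, which determines the Möbius transformation uniquely and hence
continuously in the fold (`exists_bary_eq_zero`, `bary_zero_unique`); this needs μ to have no atoms,
which admissibility gives (`Admissible.measure_singleton`). The second says that a vector field on
S² × [0,1] has a zero. When the circle shrinks to a point the fold is the identity and the field is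
constant; when it is a great circle, exchanging the two sides reflects the field. A nowhere zero
field with these end conditions would, through a lift to the quaternions, give a nonvanishing map S²
→ ℂ that is odd up to positive factors, against Borsuk–Ulam (`exists_eq_zero_of_homotopy`,
`exists_balanced_fold`).

Let A be the area of the cap onto which the folded side is finally mapped. The energy of the trial
map is 16π − 4A, so 0 ≤ ΣB(u_i, u_i) = D − 4A: the deficit is nonnegative and A ≤ D/4.
Cauchy–Schwarz for B, applied to u_i and θu_i and summed over i, bounds the difference of ∫θ
d(energy) and 2∫θ dμ by a multiple of √D (`augmented_limit`). After transport by the Möbius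
transformation, the energy measure is 2 dv outside the cap plus a mass close to 8π inside it. The
cap has diameter O(√A) (`cap_area_ge`), so the energy measure is within O(√D) of 2 dv + 8πδ in the
dual norm (`abs_integral_sub_le`). Dividing by two gives the theorem for smooth test functions, and
mollification gives it for all C¹ ones.

Folds are not smooth, so the argument is run with smoothed folds and passed to the limit. -/

noncomputable section

namespace SphereStability

/-! ### A Borsuk–Ulam type obstruction -/

/-- A continuous extension to the whole plane of the parametrization of the closed upper hemisphere
by the closed unit disc. -/
def hemisphereParam (z : ℂ) : S2 :=
  ⟨!₂[z.re / max 1 ‖z‖, z.im / max 1 ‖z‖, √(1 - (‖z‖ / max 1 ‖z‖) ^ 2)], by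
    have h0 : 0 < max 1 ‖z‖ := lt_of_lt_of_le one_pos (le_max_left _ _)
    have h1 : ‖z‖ / max 1 ‖z‖ ≤ 1 := (div_le_one h0).2 (le_max_right _ _)
    have h2 : 0 ≤ ‖z‖ / max 1 ‖z‖ := by positivity
    rw [mem_sphere_zero_iff_norm, EuclideanSpace.norm_eq, Real.sqrt_eq_one]
    simp only [Fin.sum_univ_three, Real.norm_eq_abs, sq_abs]
    simp only [Matrix.cons_val]
    rw [Real.sq_sqrt (by nlinarith), div_pow, div_pow, div_pow, Complex.sq_norm,
      Complex.normSq_apply]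
    field_simp
    ring⟩

lemma continuous_hemisphereParam : Continuous hemisphereParam := by
  have h0 : ∀ z : ℂ, max 1 ‖z‖ ≠ 0 := fun z =>
    (lt_of_lt_of_le one_pos (le_max_left _ _)).ne'
  refine Continuous.subtype_mk ((PiLp.continuous_toLp 2 _).comp (continuous_pi fun i => ?_)) _
  fin_cases i
  · exact Complex.continuous_re.div (by fun_prop) h0
  · exact Complex.continuous_im.div (by fun_prop) h0
  · exact ((continuous_const.sub ((continuous_norm.div (by fun_prop) h0).pow 2))).sqrt

lemma hemisphereParam_neg {z : ℂ} (hz : ‖z‖ = 1) : hemisphereParam (-z) = -hemisphereParam z := by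
  ext i
  fin_cases i <;> simp [hemisphereParam, hz]

/-- **Borsuk–Ulam** for maps of the two-sphere to the punctured plane. -/
theorem not_odd_of_continuous_ne_zero {g : S2 → ℂ} (hg : Continuous g) (hne : ∀ x, g x ≠ 0)
    (hodd : ∀ x, ∃ c : ℝ, 0 < c ∧ g (-x) = -(c : ℂ) * g x) : False := by
  -- The plane is simply connected, so `g` along the hemisphere has a continuous logarithm `l`.
  obtain ⟨l, ⟨-, hl⟩, -⟩ := Complex.isCoveringMapOn_exp.existsUnique_continuousMap_lifts
    (f := ⟨fun z => g (hemisphereParam z), hg.comp continuous_hemisphereParam⟩) (a₀ := (0 : ℂ))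
    (e₀ := Complex.log (g (hemisphereParam 0)))
    (Complex.exp_log (hne _)) (fun z => hne _)
  have hl' : ∀ z, Complex.exp (l z) = g (hemisphereParam z) := fun z => congrFun hl z
  -- On the boundary circle oddness forces the imaginary part of l(−z) − l(z) to be an odd multiple
  -- of π. This quantity changes sign under z ↦ −z, so by continuity it vanishes somewhere.
  let θ : ℝ → ℝ := fun t => (l (-Complex.exp (t * Complex.I)) - l (Complex.exp (t * Complex.I))).im
  have hθ : Continuous θ := by fun_prop
  have hneg : θ Real.pi = -θ 0 := by
    simp [θ, Complex.exp_pi_mul_I]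
  obtain ⟨t, ht⟩ : ∃ t, θ t = 0 := by
    rcases le_total (θ 0) 0 with h | h
    · exact mem_range_of_exists_le_of_exists_ge hθ ⟨0, h⟩ ⟨Real.pi, by linarith⟩
    · exact mem_range_of_exists_le_of_exists_ge hθ ⟨Real.pi, by linarith⟩ ⟨0, h⟩
  set z := Complex.exp (t * Complex.I) with hz
  have hz1 : ‖z‖ = 1 := Complex.norm_exp_ofReal_mul_I t
  obtain ⟨c, hc, h⟩ := hodd (hemisphereParam z)
  rw [← hemisphereParam_neg hz1, ← hl', ← hl', ← div_eq_iff (Complex.exp_ne_zero _), ← Complex.exp_sub] at h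
  have h1 := congrArg Complex.re h
  have h2 : l (-z) - l z = (((l (-z) - l z).re : ℝ) : ℂ) := by
    apply Complex.ext
    · simp
    · simpa [θ] using ht
  rw [h2, ← Complex.ofReal_exp] at h1
  simp only [Complex.ofReal_re, Complex.neg_re] at h1
  linarith [Real.exp_pos (l (-z) - l z).re]

/-- The purely imaginary quaternion with the given coordinates. -/
def imQuat (v : E3) : Quaternion ℝ := ⟨0, v 0, v 1, v 2⟩

@[simp] lemma re_imQuat (v : E3) : (imQuat v).re = 0 := rfl
@[simp] lemma imI_imQuat (v : E3) : (imQuat v).imI = v 0 := rfl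
@[simp] lemma imJ_imQuat (v : E3) : (imQuat v).imJ = v 1 := rfl
@[simp] lemma imK_imQuat (v : E3) : (imQuat v).imK = v 2 := rfl

lemma continuous_imQuat : Continuous imQuat := by
  have h : imQuat = fun v : E3 => Quaternion.linearIsometryEquivTuple.symm
      (WithLp.toLp 2 ![0, v 0, v 1, v 2]) := by
    rfl
  rw [h]
  refine (LinearIsometryEquiv.continuous _).comp
    ((PiLp.continuous_toLp 2 _).comp (continuous_pi fun i => ?_))
  fin_cases i
  · exact continuous_const
  all_goals exact PiLp.continuous_apply 2 _ _

/-- The reflection in the plane orthogonal to `p`. -/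
abbrev refl (p : E3) : E3 ≃ₗᵢ[ℝ] E3 := (ℝ ∙ p)ᗮ.reflection

lemma refl_apply {p : E3} (hp : ‖p‖ = 1) (v : E3) : refl p v = v - (2 * ⟪p, v⟫_ℝ) • p := by
  rw [refl, Submodule.reflection_orthogonal_apply, Submodule.reflection_singleton_apply]
  simp [hp, two_smul, two_mul, add_smul]

lemma inner_eq_sum (v w : E3) : ⟪v, w⟫_ℝ = v 0 * w 0 + v 1 * w 1 + v 2 * w 2 := by
  simp [PiLp.inner_apply, Fin.sum_univ_three, mul_comm]

lemma imQuat_mul_self (v : E3) : imQuat v * imQuat v = -((‖v‖ ^ 2 : ℝ) : Quaternion ℝ) := by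
  rw [← real_inner_self_eq_norm_sq, inner_eq_sum]
  ext <;> simp only [Quaternion.re_mul, Quaternion.imI_mul, Quaternion.imJ_mul,
    Quaternion.imK_mul, re_imQuat, imI_imQuat, imJ_imQuat, imK_imQuat, Quaternion.re_neg,
    Quaternion.imI_neg, Quaternion.imJ_neg, Quaternion.imK_neg, Quaternion.re_coe,
    Quaternion.imI_coe, Quaternion.imJ_coe, Quaternion.imK_coe] <;> ring

/-- As p² = −1, the map v ↦ pvp sends p to −p; a vector orthogonal to p anticommutes with p and is
therefore fixed. -/
lemma imQuat_refl {p : E3} (hp : ‖p‖ = 1) (v : E3) :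
    imQuat (refl p v) = imQuat p * imQuat v * imQuat p := by
  have h : p 0 * p 0 + p 1 * p 1 + p 2 * p 2 = 1 := by
    rw [← inner_eq_sum, real_inner_self_eq_norm_sq, hp, one_pow]
  have h' : ∀ i, refl p v i = v i - (2 * (p 0 * v 0 + p 1 * v 1 + p 2 * v 2)) * p i := fun i => by
    rw [refl_apply hp]
    simp [inner_eq_sum]
  ext <;> simp only [Quaternion.re_mul, Quaternion.imI_mul, Quaternion.imJ_mul,
    Quaternion.imK_mul, re_imQuat, imI_imQuat, imJ_imQuat, imK_imQuat, h']
  · ring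
  · linear_combination (-v 0) * h
  · linear_combination (-v 1) * h
  · linear_combination (-v 2) * h

/-- A map to the unit imaginary quaternions that is constant at the end of a homotopy is conjugate
to a constant at its beginning. -/
lemma exists_conj_of_homotopic_const {f : S2 × unitInterval → Quaternion ℝ} (hf : Continuous f)
    (hsq : ∀ x, f x * f x = -1) {k c : Quaternion ℝ} (hc : c ≠ 0) (h1 : ∀ p, f (p, 1) * c = c * k) :
    ∃ q : S2 → Quaternion ℝ, Continuous q ∧ (∀ p, q p ≠ 0) ∧ ∀ p, f (p, 0) * q p = q p * k := by
  have hnorm : ∀ x, ‖f x‖ = 1 := fun x => by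
    have h := congrArg norm (hsq x)
    rw [norm_mul, norm_neg, norm_one] at h
    nlinarith [norm_nonneg (f x)]
  obtain ⟨δ, hδ, hu⟩ := Metric.uniformContinuous_iff.1
    (CompactSpace.uniformContinuous_of_continuous hf) 1 one_pos
  obtain ⟨N, hN⟩ := exists_nat_one_div_lt hδ
  have hN0 : (0 : ℝ) < (N : ℝ) + 1 := by positivity
  -- The homotopy is followed backwards from time 1 in steps along which `f` moves by less than 1.
  let s : ℕ → unitInterval := fun n => Set.projIcc 0 1 zero_le_one (1 - n / (N + 1 : ℝ))
  have hs : ∀ n, dist (s (n + 1)) (s n) < δ := fun n => by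
    refine lt_of_le_of_lt ?_ hN
    refine (Set.abs_projIcc_sub_projIcc zero_le_one).trans (le_of_eq ?_)
    rw [Nat.cast_succ, show 1 - ((n : ℝ) + 1) / (N + 1) - (1 - n / (N + 1)) = -(1 / (N + 1)) by ring,
      abs_neg, abs_of_pos (by positivity)]
  have key : ∀ n, ∃ q : S2 → Quaternion ℝ, Continuous q ∧ (∀ p, q p ≠ 0) ∧
      ∀ p, f (p, s n) * q p = q p * k := by
    intro n
    induction n with
    | zero => exact ⟨fun _ => c, continuous_const, fun _ => hc, fun p => by simpa [s] using h1 p⟩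
    | succ n ih =>
      obtain ⟨q, hq, hq0, hqk⟩ := ih
      -- For imaginary units a and b the element 1 − ab satisfies a(1 − ab) = a + b = (1 − ab)b, so
      -- it conjugates b to a. It vanishes only for a = −b, which is excluded when a and b are
      -- closer than 1.
      refine ⟨fun p => (1 - f (p, s (n + 1)) * f (p, s n)) * q p, by fun_prop, fun p => ?_,
        fun p => ?_⟩
      · refine mul_ne_zero (fun h => ?_) (hq0 p)
        have h2 : f (p, s n) = -f (p, s (n + 1)) := by
          have h3 := congrArg (fun z => z * f (p, s n)) (sub_eq_zero.1 h)
          simpa [mul_assoc, hsq] using h3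
        have h4 : dist (f (p, s (n + 1))) (f (p, s n)) < 1 := by
          apply hu
          simpa [Prod.dist_eq, hδ] using hs n
        rw [h2, dist_eq_norm, sub_neg_eq_add, ← two_mul, norm_mul, hnorm] at h4
        have h5 : ‖(2 : Quaternion ℝ)‖ = 2 := by
          rw [show (2 : Quaternion ℝ) = ((2 : ℝ) : Quaternion ℝ) by norm_cast, Quaternion.norm_coe]
          norm_num
        norm_num [h5] at h4
      · have h2 : f (p, s (n + 1)) * (1 - f (p, s (n + 1)) * f (p, s n))
            = (1 - f (p, s (n + 1)) * f (p, s n)) * f (p, s n) := by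
          rw [mul_sub, sub_mul, ← mul_assoc, mul_assoc _ (f (p, s n)), hsq, hsq]
          simp [add_comm]
        rw [← mul_assoc, h2, mul_assoc, hqk, mul_assoc]
  obtain ⟨q, hq, hq0, hqk⟩ := key (N + 1)
  refine ⟨q, hq, hq0, fun p => ?_⟩
  have : s (N + 1) = 0 := by
    simp [s, div_self hN0.ne']
  rw [← this]; exact hqk p

/-- A homotopy of vector fields along the sphere that begins with a field intertwining `p ↦ -p` with
the reflections in `p` and ends with a constant one has a zero. -/
theorem exists_eq_zero_of_homotopy {V : S2 × unitInterval → E3} (hV : Continuous V)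
    (h1 : ∀ p q, V (p, 1) = V (q, 1)) (h0 : ∀ p : S2, V (-p, 0) = refl p (V (p, 0))) :
    ∃ x, V x = 0 := by
  by_contra! hne
  let f : S2 × unitInterval → Quaternion ℝ := fun x => imQuat (‖V x‖⁻¹ • V x)
  have hf : Continuous f := continuous_imQuat.comp
    ((hV.norm.inv₀ fun x => norm_ne_zero_iff.2 (hne x)).smul hV)
  have hsq : ∀ x, f x * f x = -1 := fun x => by
    simp [f, imQuat_mul_self, norm_smul, hne x]
  have hp : ∀ p : S2, imQuat p * imQuat p = -1 := fun p => by simp [imQuat_mul_self]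
  have hfneg : ∀ p : S2, f (-p, 0) = imQuat p * f (p, 0) * imQuat p := fun p => by
    simp only [f]
    rw [h0, LinearIsometryEquiv.norm_map, ← map_smul, imQuat_refl (by simp)]
  let k : Quaternion ℝ := imQuat !₂[0, 0, 1]
  have hk : k * k = -1 := by
    simp [k, imQuat_mul_self, EuclideanSpace.norm_eq, Fin.sum_univ_three]
  obtain ⟨c, hc, hck⟩ : ∃ c : Quaternion ℝ, c ≠ 0 ∧ ∀ p, f (p, 1) * c = c * k := by
    have hconst : ∀ p q, f (p, 1) = f (q, 1) := fun p q => by simp only [f]; rw [h1 p q]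
    let p0 := hemisphereParam 0
    -- The same intertwiner 1 − fk serves here, unless f = −k; then i works, because it anticommutes
    -- with k.
    by_cases h : 1 - f (p0, 1) * k = 0
    · let i : Quaternion ℝ := imQuat !₂[1, 0, 0]
      have h3 : k = -f (p0, 1) := by
        have h3 := congrArg (fun z => f (p0, 1) * z) (sub_eq_zero.1 h)
        simp only [mul_one] at h3
        rw [← mul_assoc, hsq] at h3
        rw [h3]; simp
      refine ⟨i, fun hi => one_ne_zero (α := ℝ) (congrArg QuaternionAlgebra.imI hi), fun p => ?_⟩
      rw [hconst p p0, ← neg_neg (f (p0, 1)), ← h3]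
      ext <;> simp [k, i, Quaternion.re_mul, Quaternion.imI_mul, Quaternion.imJ_mul,
        Quaternion.imK_mul]
    · refine ⟨_, h, fun p => ?_⟩
      rw [hconst p p0, mul_sub, sub_mul, ← mul_assoc, mul_assoc _ k, hsq, hk]
      simp [add_comm]
  obtain ⟨q, hq, hq0, hqk⟩ := exists_conj_of_homotopic_const hf hsq hc hck
  -- Since f(p, 0) = q(p) k q(p)⁻¹, the rule f(−p) = p f(p) p says that p q(p) conjugates k to
  -- −f(−p). Comparing with q(−p) makes h anticommute with k, so h takes values in the plane spanned
  -- by i and j.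
  let h : S2 → Quaternion ℝ := fun p => (q (-p))⁻¹ * imQuat p * q p
  have hh : Continuous h := by
    have h2 : Continuous fun p : S2 => (q (-p))⁻¹ :=
      (hq.comp continuous_neg).inv₀ fun p => hq0 _
    exact (h2.mul (continuous_imQuat.comp continuous_subtype_val)).mul hq
  have hneg : ∀ p, h p * h (-p) = 1 := fun p => by
    have h2 : imQuat ((-p : S2) : E3) = -imQuat p := by
      ext <;> simp
    simp only [h, h2, neg_neg]
    rw [mul_assoc, ← mul_assoc (q p), ← mul_assoc (q p), mul_inv_cancel₀ (hq0 p), one_mul,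
      mul_assoc, ← mul_assoc (imQuat p), mul_neg, hp]
    simp [inv_mul_cancel₀ (hq0 (-p))]
  have hanti : ∀ p, h p * k = -(k * h p) := fun p => by
    have h2 : (q (-p))⁻¹ * f (-p, 0) = k * (q (-p))⁻¹ := by
      rw [inv_mul_eq_iff_eq_mul₀ (hq0 _), ← mul_assoc, ← hqk, mul_assoc,
        mul_inv_cancel₀ (hq0 _), mul_one]
    have h3 : imQuat p * f (p, 0) = -(f (-p, 0) * imQuat p) := by
      rw [hfneg, mul_assoc _ (imQuat p), hp]; simp
    simp only [h]
    rw [mul_assoc _ (q p), ← hqk, ← mul_assoc, mul_assoc _ (imQuat p), h3, mul_neg, neg_mul,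
      ← mul_assoc, h2]
    simp only [mul_assoc]
  have hre : ∀ p, (h p).re = 0 ∧ (h p).imK = 0 := fun p => by
    have h2 := congrArg QuaternionAlgebra.imK (hanti p)
    have h3 := congrArg QuaternionAlgebra.re (hanti p)
    simp [k, Quaternion.re_mul, Quaternion.imK_mul] at h2 h3
    constructor <;> linarith
  -- In the plane of i and j the inverse of h is −h/|h|², so h(p)h(−p) = 1 expresses oddness up to a
  -- positive factor.
  have hrel : ∀ p, (h p).imI * (h p).imI + (h p).imJ * (h p).imJ ≠ 0 ∧
      ∃ c : ℝ, 0 < c ∧ (h (-p)).imI = -c * (h p).imI ∧ (h (-p)).imJ = -c * (h p).imJ := fun p => by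
    have e0 := congrArg QuaternionAlgebra.re (hneg p)
    have e3 := congrArg QuaternionAlgebra.imK (hneg p)
    simp only [Quaternion.re_mul, Quaternion.imK_mul, hre, Quaternion.re_one, Quaternion.imK_one]
      at e0 e3
    set a := (h p).imI
    set b := (h p).imJ
    set a' := (h (-p)).imI
    set b' := (h (-p)).imJ
    have hn : 0 < a * a + b * b := by
      rcases eq_or_ne a 0 with ha | ha
      · rcases eq_or_ne b 0 with hb | hb
        · simp [ha, hb] at e0
        · nlinarith [mul_self_pos.2 hb, mul_self_nonneg a]
      · nlinarith [mul_self_pos.2 ha, mul_self_nonneg b]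
    refine ⟨hn.ne', (a * a + b * b)⁻¹, by positivity, ?_, ?_⟩
    · rw [neg_mul, inv_mul_eq_div, eq_neg_iff_add_eq_zero, add_div' _ _ _ hn.ne', div_eq_zero_iff]
      left
      linear_combination (-a) * e0 + b * e3 * (-1)
    · rw [neg_mul, inv_mul_eq_div, eq_neg_iff_add_eq_zero, add_div' _ _ _ hn.ne', div_eq_zero_iff]
      left
      linear_combination (-b) * e0 + a * e3
  refine not_odd_of_continuous_ne_zero (g := fun p => ⟨(h p).imI, (h p).imJ⟩) ?_ ?_ ?_
  · exact Complex.equivRealProdCLM.symm.continuous.comp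
      ((Quaternion.continuous_imI.comp hh).prodMk (Quaternion.continuous_imJ.comp hh))
  · intro p h2
    obtain ⟨h3, h4⟩ := Complex.ext_iff.1 h2
    simp only [Complex.zero_re, Complex.zero_im] at h3 h4
    exact (hrel p).1 (by rw [h3, h4]; ring)
  · intro p
    obtain ⟨c, hc, h2, h3⟩ := (hrel p).2
    exact ⟨c, hc, by apply Complex.ext <;> simp [h2, h3]⟩

/-! ### Möbius transformations of the sphere -/

/-- The Möbius transformation of the unit sphere with parameter `w` in the open unit ball. -/
def mob (w x : E3) : E3 := w + ((1 - ‖w‖ ^ 2) / ‖x + w‖ ^ 2) • (x + w)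

/-- The square root of the inverse Jacobian of `mob w`. -/
def lor (w x : E3) : ℝ := ‖x + w‖ ^ 2 / (1 - ‖w‖ ^ 2)

section Algebra

variable {w x z : E3}

lemma add_ne_zero_of_norm (hw : ‖w‖ < 1) (hx : ‖x‖ = 1) : x + w ≠ 0 := fun h => by
  rw [add_eq_zero_iff_eq_neg] at h
  rw [h, norm_neg] at hx
  exact hw.ne hx

lemma one_sub_norm_sq_pos (hw : ‖w‖ < 1) : 0 < 1 - ‖w‖ ^ 2 := by
  nlinarith [norm_nonneg w]

lemma norm_add_sq_of_norm (hx : ‖x‖ = 1) : ‖x + w‖ ^ 2 = 1 + 2 * ⟪x, w⟫_ℝ + ‖w‖ ^ 2 := by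
  rw [norm_add_sq_real, hx]; ring

lemma norm_add_sq_pos (hw : ‖w‖ < 1) (hx : ‖x‖ = 1) : 0 < ‖x + w‖ ^ 2 :=
  pow_pos (norm_pos_iff.2 (add_ne_zero_of_norm hw hx)) 2

lemma lor_pos (hw : ‖w‖ < 1) (hx : ‖x‖ = 1) : 0 < lor w x :=
  div_pos (norm_add_sq_pos hw hx) (one_sub_norm_sq_pos hw)

lemma norm_mob (hw : ‖w‖ < 1) (hx : ‖x‖ = 1) : ‖mob w x‖ = 1 := by
  have h1 := norm_add_sq_pos hw hx
  have h2 : ‖mob w x‖ ^ 2 = 1 := by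
    rw [mob, norm_add_sq_real, inner_smul_right, norm_smul, mul_pow, inner_add_right,
      real_inner_self_eq_norm_sq, real_inner_comm, Real.norm_eq_abs, sq_abs]
    rw [norm_add_sq_of_norm hx] at h1 ⊢
    field_simp
    ring
  exact (pow_eq_one_iff_of_nonneg (norm_nonneg _) two_ne_zero).1 h2

lemma mob_zero (hx : ‖x‖ = 1) : mob 0 x = x := by simp [mob, hx]

lemma mob_of_norm_eq_one (hw : ‖w‖ = 1) (x : E3) : mob w x = w := by simp [mob, hw]

lemma mob_neg_mob (hw : ‖w‖ < 1) (hx : ‖x‖ = 1) : mob (-w) (mob w x) = x := by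
  have h1 : ‖x + w‖ ≠ 0 := norm_ne_zero_iff.2 (add_ne_zero_of_norm hw hx)
  have h2 := (one_sub_norm_sq_pos hw).ne'
  have h3 : mob w x + -w = ((1 - ‖w‖ ^ 2) / ‖x + w‖ ^ 2) • (x + w) := by rw [mob]; abel
  rw [mob, h3, norm_neg, norm_smul, smul_smul, mul_pow, Real.norm_eq_abs, sq_abs]
  have h4 : (1 - ‖w‖ ^ 2) / (((1 - ‖w‖ ^ 2) / ‖x + w‖ ^ 2) ^ 2 * ‖x + w‖ ^ 2) *
    ((1 - ‖w‖ ^ 2) / ‖x + w‖ ^ 2) = 1 := by field_simp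
  rw [h4, one_smul]; abel

lemma mob_mob_neg (hw : ‖w‖ < 1) (hx : ‖x‖ = 1) : mob w (mob (-w) x) = x := by
  have := mob_neg_mob (w := -w) (x := x) (by rwa [norm_neg]) hx
  rwa [neg_neg] at this

lemma map_mob (R : E3 ≃ₗᵢ[ℝ] E3) (w x : E3) : R (mob w x) = mob (R w) (R x) := by
  rw [mob, mob, ← map_add, LinearIsometryEquiv.norm_map, LinearIsometryEquiv.norm_map, map_add,
    map_smul]

lemma continuousAt_mob (h : x + w ≠ 0) : ContinuousAt (fun q : E3 × E3 => mob q.1 q.2) (w, x) := by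
  unfold mob
  have : ‖(w, x).2 + (w, x).1‖ ^ 2 ≠ 0 := pow_ne_zero 2 (norm_ne_zero_iff.2 h)
  have h2 : ContinuousAt (fun q : E3 × E3 => (1 - ‖q.1‖ ^ 2) / ‖q.2 + q.1‖ ^ 2) (w, x) :=
    ContinuousAt.div (by fun_prop) (by fun_prop) this
  exact continuousAt_fst.add (h2.smul (by fun_prop))

/-- The constant term of the affine expression of `lor z / lor w` in terms of `mob w`. -/
def ratioConst (w z : E3) : ℝ := 1 + 2 * ‖z - w‖ ^ 2 / ((1 - ‖z‖ ^ 2) * (1 - ‖w‖ ^ 2))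

/-- The linear part of the affine expression of `lor z / lor w` in terms of `mob w`. -/
def ratioVec (w z : E3) : E3 :=
  (2 / (1 - ‖z‖ ^ 2)) • ((z - w) - (‖z - w‖ ^ 2 / (1 - ‖w‖ ^ 2)) • w)

/-- `lor w x` is the pairing of the null vector (1, x) with a unit timelike vector, and `mob w` is
the action on null directions of the Lorentz transformation taking that vector to (1, 0). In the new
frame `lor z` is again such a pairing, hence affine in `mob w x`. -/
lemma lor_div_lor (hw : ‖w‖ < 1) (hz : ‖z‖ < 1) (hx : ‖x‖ = 1) :
    lor z x / lor w x = ratioConst w z + ⟪ratioVec w z, mob w x⟫_ℝ := by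
  have h1 := norm_add_sq_pos hw hx
  have h2 := (one_sub_norm_sq_pos hw).ne'
  have h3 := (one_sub_norm_sq_pos hz).ne'
  have h4 : ‖z - w‖ ^ 2 = ‖z‖ ^ 2 - 2 * ⟪z, w⟫_ℝ + ‖w‖ ^ 2 := norm_sub_sq_real z w
  simp only [lor, ratioConst, ratioVec, mob, inner_smul_left, inner_smul_right, inner_sub_left,
    inner_add_right, real_inner_self_eq_norm_sq, h4, RCLike.conj_to_real]
  rw [norm_add_sq_of_norm hx] at h1 ⊢
  rw [norm_add_sq_of_norm hx, real_inner_comm x w, real_inner_comm x z]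
  have h1' := h1.ne'
  field_simp
  ring

/-- The pair of constant and linear part is a unit timelike vector. -/
lemma norm_ratioVec_sq (hw : ‖w‖ < 1) (hz : ‖z‖ < 1) :
    ‖ratioVec w z‖ ^ 2 = ratioConst w z ^ 2 - 1 := by
  have h2 := (one_sub_norm_sq_pos hw).ne'
  have h3 := (one_sub_norm_sq_pos hz).ne'
  have h4 : ‖z - w‖ ^ 2 = ‖z‖ ^ 2 - 2 * ⟪z, w⟫_ℝ + ‖w‖ ^ 2 := norm_sub_sq_real z w
  rw [ratioVec, norm_smul, mul_pow, norm_sub_sq_real (z - w), norm_smul, mul_pow, inner_smul_right,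
    inner_sub_left, real_inner_self_eq_norm_sq, Real.norm_eq_abs, sq_abs, Real.norm_eq_abs, sq_abs,
    ratioConst, h4]
  field_simp
  ring

lemma ratioConst_comm (w z : E3) : ratioConst w z = ratioConst z w := by
  rw [ratioConst, ratioConst, norm_sub_rev, mul_comm (1 - ‖z‖ ^ 2)]

lemma one_lt_ratioConst (hw : ‖w‖ < 1) (hz : ‖z‖ < 1) (h : z ≠ w) : 1 < ratioConst w z := by
  have h2 := one_sub_norm_sq_pos hw
  have h3 := one_sub_norm_sq_pos hz
  have : 0 < ‖z - w‖ := norm_pos_iff.2 (sub_ne_zero.2 h)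
  rw [ratioConst]
  have : 0 < 2 * ‖z - w‖ ^ 2 / ((1 - ‖z‖ ^ 2) * (1 - ‖w‖ ^ 2)) := by positivity
  linarith

end Algebra

/-! ### The conformal center of mass -/

section Balance

open Filter Topology

lemma integrable_of_continuous {F : Type*} [NormedAddCommGroup F] [SecondCountableTopology F]
    (μ : Measure S2) [IsFiniteMeasure μ] {f : S2 → F} (hf : Continuous f) : Integrable f μ :=
  (memLp_of_continuous μ hf).integrable (by norm_num)

lemma measurable_mob (w : E3) : Measurable (mob w) := by
  unfold mob; fun_prop

lemma continuous_mob_coe {w : E3} (hw : ‖w‖ < 1) : Continuous fun x : S2 => mob w x := by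
  rw [continuous_iff_continuousAt]
  intro x
  exact (continuousAt_mob (add_ne_zero_of_norm hw (by simp))).comp (f := fun x : S2 => (w, (x : E3)))
    (by fun_prop)

lemma continuous_lor {w : E3} : Continuous fun x : S2 => lor w x := by
  unfold lor; fun_prop

lemma lor_coe_pos {w : E3} (hw : ‖w‖ < 1) (x : S2) : 0 < lor w x := lor_pos hw (by simp)

lemma norm_mob_coe_le {w : E3} (hw : ‖w‖ ≤ 1) (x : S2) : ‖mob w x‖ ≤ 1 := by
  rcases hw.lt_or_eq with h | h
  · exact (norm_mob h (by simp)).le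
  · rw [mob_of_norm_eq_one h, h]

/-- The center of mass of the image of a measure under a Möbius transformation. -/
def bary (m : Measure S2) (w : E3) : E3 := ∫ x, mob w x ∂m

lemma integral_lor_div_lor {m : Measure S2} [IsFiniteMeasure m] {w z : E3} (hw : ‖w‖ < 1)
    (hz : ‖z‖ < 1) :
    ∫ x, lor z x / lor w x ∂m = ratioConst w z * m.real Set.univ + ⟪ratioVec w z, bary m w⟫_ℝ := by
  have hi : Integrable (fun x : S2 => mob w x) m := integrable_of_continuous m (continuous_mob_coe hw)
  calc ∫ x, lor z x / lor w x ∂m = ∫ x : S2, (ratioConst w z + ⟪ratioVec w z, mob w x⟫_ℝ) ∂m :=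
        integral_congr_ae (Eventually.of_forall fun x => lor_div_lor hw hz (by simp))
    _ = _ := by
      rw [integral_add (integrable_const _) (hi.const_inner _), integral_const, smul_eq_mul, mul_comm,
        integral_inner hi, bary]

lemma subsingleton_mob_eq {w : E3} (hw : ‖w‖ < 1) (a : E3) :
    {x : S2 | mob w x = a}.Subsingleton := fun x hx y hy => by
  ext1
  rw [← mob_neg_mob hw (x := x) (by simp), ← mob_neg_mob hw (x := y) (by simp), hx, hy]

/-- Let ρ = lor z / lor w. If both parameters balance m, then ρ and 1/ρ both have mean C =
`ratioConst w z`, so 2C − ρ − 1/ρ integrates to 0. Multiplied by ρ this function is |A|² − ⟨A, mob w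
x⟩² ≥ 0, so it vanishes almost everywhere and `mob w x` is ±A/|A|. That leaves two points, which
carry no mass. -/
theorem bary_zero_unique {m : Measure S2} [IsFiniteMeasure m] [NullSingletonClass m] (hm : m ≠ 0) {w z : E3}
    (hw : ‖w‖ < 1) (hz : ‖z‖ < 1) (h1 : bary m w = 0) (h2 : bary m z = 0) : z = w := by
  by_contra hne
  have hC := one_lt_ratioConst hw hz hne
  set C := ratioConst w z with hCdef
  set A := ratioVec w z with hAdef
  have hA : ‖A‖ ^ 2 = C ^ 2 - 1 := norm_ratioVec_sq hw hz
  have hA0 : 0 < ‖A‖ := by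
    by_contra h
    have : ‖A‖ = 0 := le_antisymm (not_lt.1 h) (norm_nonneg _)
    rw [this] at hA
    nlinarith
  have e1 := integral_lor_div_lor (m := m) hw hz
  have e2 := integral_lor_div_lor (m := m) hz hw
  rw [h1, inner_zero_right, add_zero, ← hCdef] at e1
  rw [h2, inner_zero_right, add_zero, ratioConst_comm, ← hCdef] at e2
  have hc : ∀ {w z : E3}, ‖w‖ < 1 → Continuous fun x : S2 => lor z x / lor w x := fun hw =>
    continuous_lor.div continuous_lor fun x => (lor_coe_pos hw x).ne'
  let g : S2 → ℝ := fun x => 2 * C - (lor z x / lor w x + lor w x / lor z x)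
  have hg : Continuous g := continuous_const.sub ((hc hw).add (hc hz))
  have hgi : ∫ x, g x ∂m = 0 := by
    have i1 := integrable_of_continuous m (hc (z := z) hw)
    have i2 := integrable_of_continuous m (hc (z := w) hz)
    simp only [g]
    rw [integral_sub (integrable_const _) (i1.fun_add i2), integral_add i1 i2, e1, e2, integral_const,
      smul_eq_mul]
    ring
  have hform : ∀ x : S2, g x * (lor z x / lor w x) = ‖A‖ ^ 2 - ⟪A, mob w x⟫_ℝ ^ 2 := fun x => by
    have h3 := lor_div_lor hw hz (x := x) (by simp)
    have p1 := (lor_coe_pos hw x).ne'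
    have p2 := (lor_coe_pos hz x).ne'
    have h4 : ⟪A, mob w x⟫_ℝ = lor z x / lor w x - C := by rw [h3]; ring
    rw [h4, hA]
    simp only [g]
    field_simp
    ring
  have hpos : ∀ x : S2, 0 < lor z x / lor w x := fun x => div_pos (lor_coe_pos hz x) (lor_coe_pos hw x)
  have hg0 : ∀ x, 0 ≤ g x := fun x => by
    have h3 : |⟪A, mob w x⟫_ℝ| ≤ ‖A‖ := by
      simpa [norm_mob hw (x := x) (by simp)] using abs_real_inner_le_norm A (mob w x)
    have h4 : 0 ≤ g x * (lor z x / lor w x) := by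
      rw [hform]
      have := sq_le_sq' (abs_le.1 h3).1 (abs_le.1 h3).2
      linarith
    exact nonneg_of_mul_nonneg_left h4 (hpos x)
  have hae := (integral_eq_zero_iff_of_nonneg hg0 (integrable_of_continuous m hg)).1 hgi
  have hsub : ∀ᵐ x : S2 ∂m, False := by
    have n1 := (subsingleton_mob_eq hw (‖A‖⁻¹ • A)).measure_zero m
    have n2 := (subsingleton_mob_eq hw (-(‖A‖⁻¹ • A))).measure_zero m
    filter_upwards [hae, measure_eq_zero_iff_ae_notMem.1 n1, measure_eq_zero_iff_ae_notMem.1 n2]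
      with x hx hx1 hx2
    have h3 := hform x
    rw [hx, Pi.zero_apply, zero_mul, eq_comm, sub_eq_zero, sq_eq_sq_iff_eq_or_eq_neg] at h3
    have hy : ‖mob w x‖ = 1 := norm_mob hw (by simp)
    have hn : ‖‖A‖⁻¹ • A‖ = 1 := by rw [norm_smul, norm_inv, norm_norm, inv_mul_cancel₀ hA0.ne']
    rcases h3 with h3 | h3
    · refine hx1 (sub_eq_zero.1 (norm_eq_zero.1 (sq_eq_zero_iff.1 ?_)))
      rw [norm_sub_sq_real, hy, hn, inner_smul_right, real_inner_comm, ← h3, inv_mul_cancel₀ hA0.ne']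
      norm_num
    · refine hx2 (add_eq_zero_iff_eq_neg.1 (norm_eq_zero.1 (sq_eq_zero_iff.1 ?_)))
      rw [norm_add_sq_real, hy, hn, inner_smul_right, real_inner_comm,
        show ⟪A, mob w x⟫_ℝ = -‖A‖ by linarith, mul_neg, inv_mul_cancel₀ hA0.ne']
      norm_num
  exact hm (ae_eq_bot.1 (eventually_false_iff_eq_bot.1 hsub))

/-- The limit parameter may lie on the unit sphere, where `mob w₀` degenerates to the constant w₀;
continuity then fails only at −w₀, whence the almost everywhere condition. -/
lemma tendsto_integral_mob {μ : Measure S2} [IsFiniteMeasure μ] {w : ℕ → E3} {w₀ : E3}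
    {G : ℕ → S2 → S2} {G₀ : S2 → S2} (hG : ∀ n, Measurable (G n)) (hw : ∀ n, ‖w n‖ < 1)
    (hlim : Tendsto w atTop (𝓝 w₀))
    (hGlim : ∀ᵐ x ∂μ, Tendsto (fun n => G n x) atTop (𝓝 (G₀ x)) ∧ (G₀ x : E3) + w₀ ≠ 0) :
    Tendsto (fun n => ∫ x, mob (w n) (G n x) ∂μ) atTop (𝓝 (∫ x, mob w₀ (G₀ x) ∂μ)) := by
  refine tendsto_integral_of_dominated_convergence (fun _ => 1) (fun n => ?_) (integrable_const _)
    (fun n => Eventually.of_forall fun x => norm_mob_coe_le (hw n).le _) ?_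
  · exact ((measurable_mob _).comp (measurable_subtype_coe.comp (hG n))).aestronglyMeasurable
  · filter_upwards [hGlim] with x hx
    exact (continuousAt_mob hx.2).tendsto.comp
      (hlim.prodMk_nhds ((continuous_subtype_val.tendsto _).comp hx.1))

lemma ae_coe_add_ne_zero (m : Measure S2) [NullSingletonClass m] (w : E3) : ∀ᵐ x : S2 ∂m, (x : E3) + w ≠ 0 := by
  have h : {x : S2 | (x : E3) + w = 0}.Subsingleton := fun x hx y hy => by
    ext1
    rw [add_eq_zero_iff_eq_neg.1 hx, add_eq_zero_iff_eq_neg.1 hy]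
  exact measure_eq_zero_iff_ae_notMem.1 (h.measure_zero m)

/-- First-order condition for a minimum of `∫ log (lor w) dm` on a closed ball. -/
lemma exists_variational {m : Measure S2} [IsFiniteMeasure m] {r : ℝ} (hr0 : 0 ≤ r) (hr : r < 1) :
    ∃ w : E3, ‖w‖ ≤ r ∧ ∀ v : E3, ‖v‖ ≤ r → 0 ≤ ⟪v - w, bary m w⟫_ℝ := by
  let Ψ : E3 → ℝ := fun w => ∫ x : S2, Real.log (lor w x) ∂m
  have hlogc : ∀ {w : E3}, ‖w‖ < 1 → Continuous fun x : S2 => Real.log (lor w x) := fun hw =>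
    continuous_lor.log fun x => (lor_coe_pos hw x).ne'
  have hcont : ContinuousOn Ψ (Metric.closedBall 0 r) := by
    have hjoint : ContinuousOn (fun q : E3 × S2 => Real.log (lor q.1 q.2))
        (Metric.closedBall 0 r ×ˢ Set.univ) := by
      intro q hq
      have hq1 : ‖q.1‖ < 1 := lt_of_le_of_lt (by simpa using hq.1) hr
      refine ContinuousAt.continuousWithinAt (ContinuousAt.log ?_ (lor_coe_pos hq1 q.2).ne')
      unfold lor
      exact ContinuousAt.div (by fun_prop) (by fun_prop) (one_sub_norm_sq_pos hq1).ne'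
    obtain ⟨K, hK⟩ := ((isCompact_closedBall (0 : E3) r).prod isCompact_univ).exists_bound_of_continuousOn
      hjoint
    refine continuousOn_of_dominated (bound := fun _ => K) (fun w hw => ?_) (fun w hw => ?_)
      (integrable_const _) (Eventually.of_forall fun x => ?_)
    · have : ‖w‖ < 1 := lt_of_le_of_lt (by simpa using hw) hr
      exact (hlogc this).aestronglyMeasurable
    · exact Eventually.of_forall fun x => hK (w, x) ⟨hw, trivial⟩
    · exact hjoint.comp (f := fun w => (w, x)) (by fun_prop) fun w hw => ⟨hw, trivial⟩
  obtain ⟨w, hw, hmin⟩ := (isCompact_closedBall (0 : E3) r).exists_isMinOn ⟨0, by simp [hr0]⟩ hcont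
  rw [mem_closedBall_zero_iff] at hw
  have hw1 := lt_of_le_of_lt hw hr
  refine ⟨w, hw, fun v hv => ?_⟩
  set d := v - w with hd
  set Y := bary m w
  set β := 1 - ‖w‖ ^ 2 with hβ
  have hβ0 : 0 < β := one_sub_norm_sq_pos hw1
  -- The minimum is compared with the competitor w + τd, and log t ≤ t − 1 bounds the difference by
  -- the integral of a ratio that is affine in `mob w`. No differentiation under the integral is
  -- needed.
  have key : ∀ τ ∈ Set.Ioo (0 : ℝ) 1, 0 ≤ ⟪d, Y⟫_ℝ + τ * (‖d‖ ^ 2 * (m.real Set.univ - ⟪w, Y⟫_ℝ) / β) := by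
    intro τ hτ
    have hz : ‖w + τ • d‖ ≤ r := by
      have := (convex_closedBall (0 : E3) r).add_smul_sub_mem (x := w) (y := v)
        (by simpa using hw) (by simpa using hv) ⟨hτ.1.le, hτ.2.le⟩
      simpa using this
    set z := w + τ • d with hzdef
    have hz1 := lt_of_le_of_lt hz hr
    have hα : 0 < 1 - ‖z‖ ^ 2 := one_sub_norm_sq_pos hz1
    have h1 : Ψ w ≤ Ψ z := hmin (by simpa using hz)
    have hc : Continuous fun x : S2 => lor z x / lor w x :=
      continuous_lor.div continuous_lor fun x => (lor_coe_pos hw1 x).ne'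
    have h2 : Ψ z - Ψ w ≤ ∫ x : S2, (lor z x / lor w x - 1) ∂m := by
      rw [← integral_sub (integrable_of_continuous m (hlogc hz1))
        (integrable_of_continuous m (hlogc hw1))]
      refine integral_mono ((integrable_of_continuous m (hlogc hz1)).sub
        (integrable_of_continuous m (hlogc hw1)))
        ((integrable_of_continuous m hc).sub (integrable_const _)) fun x => ?_
      simp only
      rw [← Real.log_div (lor_coe_pos hz1 x).ne' (lor_coe_pos hw1 x).ne']
      exact Real.log_le_sub_one_of_pos (div_pos (lor_coe_pos hz1 x) (lor_coe_pos hw1 x))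
    rw [integral_sub (integrable_of_continuous m hc) (integrable_const _),
      integral_lor_div_lor hw1 hz1, integral_const, smul_eq_mul, mul_one] at h2
    have h3 : 0 ≤ (ratioConst w z - 1) * m.real Set.univ + ⟪ratioVec w z, Y⟫_ℝ := by linarith
    have hzw : z - w = τ • d := by simp [hzdef]
    rw [ratioConst, ratioVec, hzw, inner_smul_left, inner_sub_left, inner_smul_left, inner_smul_left,
      norm_smul, mul_pow, Real.norm_eq_abs, sq_abs] at h3
    simp only [RCLike.conj_to_real, ← hβ] at h3
    have h4 : 2 * τ / (1 - ‖z‖ ^ 2) * (⟪d, Y⟫_ℝ + τ * (‖d‖ ^ 2 * (m.real Set.univ - ⟪w, Y⟫_ℝ) / β)) =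
      (1 + 2 * (τ ^ 2 * ‖d‖ ^ 2) / ((1 - ‖z‖ ^ 2) * β) - 1) * m.real Set.univ +
      2 / (1 - ‖z‖ ^ 2) * (τ * ⟪d, Y⟫_ℝ - τ ^ 2 * ‖d‖ ^ 2 / β * ⟪w, Y⟫_ℝ) := by
      field_simp
      ring
    rw [← h4] at h3
    exact nonneg_of_mul_nonneg_right h3 (div_pos (by linarith [hτ.1]) hα)
  have hlim : Tendsto (fun τ : ℝ => ⟪d, Y⟫_ℝ + τ * (‖d‖ ^ 2 * (m.real Set.univ - ⟪w, Y⟫_ℝ) / β))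
      (𝓝[>] 0) (𝓝 (⟪d, Y⟫_ℝ)) := by
    have : ContinuousAt (fun τ : ℝ => ⟪d, Y⟫_ℝ + τ * (‖d‖ ^ 2 * (m.real Set.univ - ⟪w, Y⟫_ℝ) / β)) 0 := by
      fun_prop
    simpa using this.tendsto.mono_left nhdsWithin_le_nhds
  exact ge_of_tendsto hlim (by
    filter_upwards [Ioo_mem_nhdsGT (zero_lt_one' ℝ)] with τ hτ using key τ hτ)

/-- **Hersch's lemma**: a measure without atoms can be balanced by a Möbius transformation. -/
theorem exists_bary_eq_zero {m : Measure S2} [IsFiniteMeasure m] [NullSingletonClass m] (hm : m ≠ 0) :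
    ∃ w : E3, ‖w‖ < 1 ∧ bary m w = 0 := by
  have hr : ∀ n : ℕ, 0 ≤ 1 - 1 / ((n : ℝ) + 2) ∧ 1 - 1 / ((n : ℝ) + 2) < 1 := fun n => by
    have h1 : 1 / ((n : ℝ) + 2) ≤ 1 := by
      rw [div_le_one (by positivity)]; linarith [Nat.cast_nonneg (α := ℝ) n]
    have h2 : 0 < 1 / ((n : ℝ) + 2) := by positivity
    constructor <;> linarith
  choose w hw hvar using fun n => exists_variational (m := m) (hr n).1 (hr n).2
  have hw1 : ∀ n, ‖w n‖ < 1 := fun n => (hw n).trans_lt (hr n).2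
  by_contra! hne
  -- A minimizer in the interior could move against `bary`, which would force `bary` to vanish; so
  -- all minimizers lie on the boundary of their balls.
  have hbd : ∀ n, ‖w n‖ = 1 - 1 / ((n : ℝ) + 2) := by
    intro n
    refine le_antisymm (hw n) (not_lt.1 fun hlt => ?_)
    set Y := bary m (w n) with hY
    have hY0 : 0 < ‖Y‖ := norm_pos_iff.2 (hne _ (hw1 n))
    set ε := 1 - 1 / ((n : ℝ) + 2) - ‖w n‖
    have hε : 0 < ε := by simp only [ε]; linarith
    have h1 := hvar n (w n - (ε / ‖Y‖) • Y) (by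
      refine (norm_sub_le _ _).trans ?_
      rw [norm_smul, Real.norm_eq_abs, abs_of_pos (by positivity), div_mul_cancel₀ _ hY0.ne']
      simp only [ε]; linarith)
    rw [sub_sub_cancel_left, inner_neg_left, inner_smul_left, ← hY, real_inner_self_eq_norm_sq] at h1
    have : 0 < (ε / ‖Y‖) * ‖Y‖ ^ 2 := by positivity
    simp only [RCLike.conj_to_real] at h1
    linarith
  obtain ⟨w₀, -, φ, hφ, hlim⟩ := (isCompact_closedBall (0 : E3) 1).tendsto_subseq
    (x := w) (fun n => by simpa using (hw1 n).le)
  have hw₀ : ‖w₀‖ = 1 := by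
    refine tendsto_nhds_unique hlim.norm ?_
    have h1 : Tendsto (fun n : ℕ => 1 - 1 / ((n : ℝ) + 2)) atTop (𝓝 (1 - 0)) := by
      refine tendsto_const_nhds.sub (tendsto_const_nhds.div_atTop ?_)
      exact tendsto_atTop_add_const_right _ _ tendsto_natCast_atTop_atTop
    rw [sub_zero] at h1
    refine (h1.comp hφ.tendsto_atTop).congr fun n => ?_
    simp [hbd]
  -- Towards the unit sphere the centers of mass tend to m(S²)w₀, while the variational inequality
  -- with v = 0 keeps ⟨w, bary⟩ ≤ 0; hence m(S²) ≤ 0.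
  have hY := tendsto_integral_mob (μ := m) (w := w ∘ φ) (G := fun _ => id) (G₀ := id)
    (fun _ => measurable_id) (fun n => hw1 _) hlim
    (by filter_upwards [ae_coe_add_ne_zero m w₀] with x hx using ⟨tendsto_const_nhds, hx⟩)
  have h2 := hlim.inner (𝕜 := ℝ) hY
  have h3 : ∀ n, ⟪(w ∘ φ) n, ∫ x : S2, mob ((w ∘ φ) n) (id x : S2) ∂m⟫_ℝ ≤ 0 := fun n => by
    have := hvar (φ n) 0 (by simpa using (hr _).1)
    rw [zero_sub, inner_neg_left] at this
    exact neg_nonneg.1 this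
  have h4 := le_of_tendsto' h2 h3
  simp only [mob_of_norm_eq_one hw₀, integral_const, inner_smul_right, real_inner_self_eq_norm_sq, hw₀,
    one_pow, mul_one] at h4
  exact hm (Measure.measure_univ_eq_zero.1
    ((measureReal_eq_zero_iff).1 (le_antisymm h4 measureReal_nonneg)))

end Balance

/-! ### Calculus on the sphere in ambient coordinates -/

lemma hasFDerivAt_normalize {x : E3} (hx : ‖x‖ = 1) :
    HasFDerivAt (fun y : E3 => ‖y‖⁻¹ • y)
      (ContinuousLinearMap.id ℝ E3 - (innerSL ℝ x).smulRight x) x := by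
  have h1 : HasFDerivAt (fun y : E3 => ‖y‖) (innerSL ℝ x) x := by
    have h2 := ((hasStrictFDerivAt_norm_sq x).hasFDerivAt).sqrt (by simp [hx])
    simp only [Real.sqrt_sq (norm_nonneg _), hx] at h2
    refine h2.congr_fderiv ?_
    ext v; simp
  have h3 := ((hasDerivAt_inv (x := ‖x‖) (by simp [hx])).comp_hasFDerivAt x h1).smul (hasFDerivAt_id x)
  refine h3.congr_fderiv ?_
  ext v
  simp [hx, sub_eq_add_neg]

lemma radialExt_eq {f : S2 → ℝ} {F : E3 → ℝ} (h : ∀ x : S2, f x = F x) {y : E3} (hy : y ≠ 0) :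
    radialExt f y = F (‖y‖⁻¹ • y) := by
  rw [radialExt, dif_neg hy, h]

/-- The gradient of the restriction of a function on `ℝ³` is the tangential part of its gradient. -/
lemma inner_sphGrad_of_hasFDerivAt {f : S2 → ℝ} {F : E3 → ℝ} (h : ∀ x : S2, f x = F x) {x : S2}
    {D : E3 →L[ℝ] ℝ} (hF : HasFDerivAt F D x) (v : E3) :
    ⟪sphGrad f x, v⟫_ℝ = D (v - ⟪(x : E3), v⟫_ℝ • (x : E3)) := by
  have hx : ‖(x : E3)‖ = 1 := by simp
  have h1 : HasFDerivAt (fun y => F (‖y‖⁻¹ • y))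
      (D ∘L (ContinuousLinearMap.id ℝ E3 - (innerSL ℝ (x : E3)).smulRight (x : E3))) (x : E3) := by
    refine HasFDerivAt.comp (x : E3) ?_ (hasFDerivAt_normalize hx)
    simpa [hx] using hF
  have h2 : HasFDerivAt (radialExt f) _ (x : E3) := h1.congr_of_eventuallyEq (by
    filter_upwards [isOpen_ne.mem_nhds (coe_ne_zero x)] with y hy using radialExt_eq h hy)
  rw [sphGrad, inner_gradient_left, h2.fderiv]
  simp

lemma inner_sphGrad_comp {f : S2 → ℝ} (hf : ContMDiff (𝓡 2) 𝓘(ℝ, ℝ) 1 f) {U : S2 → S2}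
    {F : E3 → E3} (h : ∀ x : S2, (U x : E3) = F x) {x : S2} {D : E3 →L[ℝ] E3}
    (hF : HasFDerivAt F D x) (v : E3) :
    ⟪sphGrad (f ∘ U) x, v⟫_ℝ = ⟪sphGrad f (U x), D (v - ⟪(x : E3), v⟫_ℝ • (x : E3))⟫_ℝ := by
  have h1 : ∀ y : S2, (f ∘ U) y = (radialExt f ∘ F) y := fun y => by
    rw [Function.comp_apply, Function.comp_apply, ← h, radialExt_coe]
  have h2 := (differentiableAt_radialExt hf (U x)).hasFDerivAt
  rw [h x] at h2
  rw [inner_sphGrad_of_hasFDerivAt h1 (h2.comp (x : E3) hF), sphGrad, inner_gradient_left, h x]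
  rfl

lemma contMDiff_restrict {F' : Type*} [NormedAddCommGroup F'] [NormedSpace ℝ F'] {n : ℕ∞ω}
    {F : E3 → F'} (hF : ∀ x : S2, ContDiffAt ℝ n F x) :
    ContMDiff (𝓡 2) 𝓘(ℝ, F') n (fun x : S2 => F x) := by
  have : Fact (Module.finrank ℝ E3 = 2 + 1) := ⟨by simp⟩
  intro x
  exact (hF x).contMDiffAt.comp x (contMDiff_coe_sphere x)

lemma contMDiff_sphere {U : S2 → S2} {F : E3 → E3} {n : ℕ∞ω} (h : ∀ x : S2, (U x : E3) = F x)
    (hF : ∀ x : S2, ContDiffAt ℝ n F x) : ContMDiff (𝓡 2) (𝓡 2) n U := by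
  have : Fact (Module.finrank ℝ E3 = 2 + 1) := ⟨by simp⟩
  have h1 := (contMDiff_restrict hF).codRestrict_sphere (n := 2) (fun z => by
    rw [← h]; simp)
  have h2 : U = Set.codRestrict (fun x : S2 => F x) (Metric.sphere (0 : E3) 1) (fun z => by
      rw [← h]; simp) := funext fun x => Subtype.ext (h x)
  rw [h2]
  exact h1

/-- The restriction to the sphere of a function on `ℝ³` that is smooth near the sphere. -/
def SmoothFun.ofRestrict (F : E3 → ℝ) (hF : ∀ x : S2, ContDiffAt ℝ ∞ F x) : SmoothFun :=
  ⟨fun x => F x, contMDiff_restrict hF⟩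

/-- The composition of a smooth function with a smooth map of the sphere. -/
def SmoothFun.compMap (f : SmoothFun) (U : S2 → S2) (hU : ContMDiff (𝓡 2) (𝓡 2) ∞ U) : SmoothFun :=
  ⟨f ∘ U, f.contMDiff.comp hU⟩

/-- The coordinate functions. -/
def coordFun (i : Fin 3) : SmoothFun :=
  SmoothFun.ofRestrict (fun y => y i) fun x => by fun_prop

@[simp] lemma coordFun_apply (i : Fin 3) (x : S2) : coordFun i x = (x : E3) i := rfl

lemma sum_coord_sq (x : S2) : ∑ i, (x : E3) i ^ 2 = 1 := by
  have h : ‖(x : E3)‖ ^ 2 = 1 := by simp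
  rw [EuclideanSpace.norm_sq_eq] at h
  simpa using h

lemma sphGrad_coordFun (i : Fin 3) (x : S2) :
    sphGrad (coordFun i) x = EuclideanSpace.single i 1 - (x : E3) i • (x : E3) := by
  refine ext_inner_right ℝ fun v => ?_
  rw [inner_sphGrad_of_hasFDerivAt (f := coordFun i) (F := EuclideanSpace.proj i) (fun _ => rfl)
    (EuclideanSpace.proj i : E3 →L[ℝ] ℝ).hasFDerivAt v]
  simp [inner_sub_left, inner_smul_left, EuclideanSpace.inner_single_left, mul_comm]

lemma sum_norm_sphGrad_coordFun (x : S2) : ∑ i, ‖sphGrad (coordFun i) x‖ ^ 2 = 2 := by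
  have h : ∀ i, ‖sphGrad (coordFun i) x‖ ^ 2 = 1 - (x : E3) i ^ 2 := fun i => by
    rw [sphGrad_coordFun, norm_sub_sq_real, norm_smul, mul_pow, inner_smul_right,
      EuclideanSpace.inner_single_left]
    simp
    ring
  simp only [h, Finset.sum_sub_distrib, sum_coord_sq]
  norm_num

lemma sphGrad_mul {f g : S2 → ℝ} (hf : ContMDiff (𝓡 2) 𝓘(ℝ, ℝ) 1 f)
    (hg : ContMDiff (𝓡 2) 𝓘(ℝ, ℝ) 1 g) (x : S2) :
    sphGrad (f * g) x = f x • sphGrad g x + g x • sphGrad f x := by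
  have h : radialExt (f * g) = radialExt f * radialExt g := by
    funext y; by_cases hy : y = 0 <;> simp [radialExt, hy]
  simp only [sphGrad, gradient, h]
  rw [fderiv_mul (differentiableAt_radialExt hf x) (differentiableAt_radialExt hg x), map_add,
    map_smulₛₗ, map_smulₛₗ, radialExt_coe, radialExt_coe]
  simp

lemma sphGrad_const (c : ℝ) (x : S2) : sphGrad (fun _ => c) x = 0 := by
  refine ext_inner_right ℝ fun v => ?_
  rw [inner_sphGrad_of_hasFDerivAt (F := fun _ => c) (fun _ => rfl) (hasFDerivAt_const c _) v]
  simp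

/-! ### Möbius transformations as conformal diffeomorphisms -/

section Mob

variable {w : E3}

/-- This reduces the derivative of `mob` to that of an inversion, a scaled reflection. -/
lemma mob_eq_inversion (hw : ‖w‖ < 1) (y : E3) :
    mob w y = EuclideanGeometry.inversion (-w) (√(1 - ‖w‖ ^ 2)) y + (2 : ℝ) • w := by
  rw [EuclideanGeometry.inversion, dist_eq_norm, sub_neg_eq_add, div_pow,
    Real.sq_sqrt (one_sub_norm_sq_pos hw).le, mob]
  simp only [vsub_eq_sub, vadd_eq_add, sub_neg_eq_add, two_smul]
  abel

lemma hasFDerivAt_mob (hw : ‖w‖ < 1) {x : E3} (hx : ‖x‖ = 1) :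
    HasFDerivAt (mob w) ((lor w x)⁻¹ • (refl (x + w) : E3 →L[ℝ] E3)) x := by
  have h1 : x ≠ -w := fun h => add_ne_zero_of_norm hw hx (by rw [h]; abel)
  have h2 := (EuclideanGeometry.hasFDerivAt_inversion (R := √(1 - ‖w‖ ^ 2)) h1).add_const
    ((2 : ℝ) • w)
  rw [dist_eq_norm, sub_neg_eq_add, div_pow, Real.sq_sqrt (one_sub_norm_sq_pos hw).le] at h2
  rw [lor, inv_div]
  exact h2.congr_of_eventuallyEq (Filter.Eventually.of_forall fun y => mob_eq_inversion hw y)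

lemma contDiffAt_mob (hw : ‖w‖ < 1) {x : E3} (hx : ‖x‖ = 1) : ContDiffAt ℝ ∞ (mob w) x := by
  have h1 := (norm_add_sq_pos hw hx).ne'
  unfold mob
  have h2 : ContDiffAt ℝ ∞ (fun y : E3 => ‖y + w‖ ^ 2) x :=
    (contDiff_norm_sq ℝ).contDiffAt.comp x (contDiffAt_id.add contDiffAt_const)
  exact contDiffAt_const.add ((contDiffAt_const.div h2 h1).smul (contDiffAt_id.add contDiffAt_const))

/-- The reflection in the derivative of `mob w` takes the normal at x to minus the normal at the
image point, hence tangent plane to tangent plane. -/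
lemma refl_add_apply (hw : ‖w‖ < 1) {x : E3} (hx : ‖x‖ = 1) : refl (x + w) x = -mob w x := by
  have h1 := (norm_add_sq_pos hw hx).ne'
  rw [refl, Submodule.reflection_orthogonal_apply, Submodule.reflection_singleton_apply, mob,
    neg_inj, sub_eq_iff_eq_add]
  have h2 : 2 * (⟪x + w, x⟫_ℝ / ‖x + w‖ ^ 2) = 1 + (1 - ‖w‖ ^ 2) / ‖x + w‖ ^ 2 := by
    rw [inner_add_left, real_inner_self_eq_norm_sq, hx, real_inner_comm]
    rw [norm_add_sq_of_norm hx] at h1 ⊢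
    field_simp
    ring
  have h3 : (2 : ℕ) • (⟪x + w, x⟫_ℝ / ‖x + w‖ ^ 2) • (x + w)
      = (2 * (⟪x + w, x⟫_ℝ / ‖x + w‖ ^ 2)) • (x + w) := by
    rw [two_smul, two_mul, add_smul]
  refine (h3.trans ?_)
  rw [h2, add_smul, one_smul]
  abel

/-- The Möbius transformation with parameter `w` as a diffeomorphism of the sphere. -/
def mobS (w : E3) (hw : ‖w‖ < 1) : S2 ≃ₘ^∞⟮𝓡 2, 𝓡 2⟯ S2 where
  toFun x := ⟨mob w x, by simp [norm_mob hw]⟩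
  invFun x := ⟨mob (-w) x, by simp [norm_mob (w := -w) (by rwa [norm_neg])]⟩
  left_inv x := Subtype.ext (mob_neg_mob hw (by simp))
  right_inv x := Subtype.ext (mob_mob_neg hw (by simp))
  contMDiff_toFun := contMDiff_sphere (F := mob w) (fun _ => rfl) fun x => contDiffAt_mob hw (by simp)
  contMDiff_invFun := contMDiff_sphere (F := mob (-w)) (fun _ => rfl) fun x =>
    contDiffAt_mob (by rwa [norm_neg]) (by simp)

@[simp] lemma coe_mobS (hw : ‖w‖ < 1) (x : S2) : (mobS w hw x : E3) = mob w x := rfl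

lemma contMDiff_mobS (hw : ‖w‖ < 1) : ContMDiff (𝓡 2) (𝓡 2) ∞ (mobS w hw) :=
  (mobS w hw).contMDiff

lemma sphGrad_comp_mobS (hw : ‖w‖ < 1) {f : S2 → ℝ} (hf : ContMDiff (𝓡 2) 𝓘(ℝ, ℝ) 1 f) (x : S2) :
    sphGrad (f ∘ mobS w hw) x
      = (lor w x)⁻¹ • refl ((x : E3) + w) (sphGrad f (mobS w hw x)) := by
  have hx : ‖(x : E3)‖ = 1 := by simp
  refine ext_inner_right ℝ fun v => ?_
  rw [inner_sphGrad_comp hf (coe_mobS hw) (hasFDerivAt_mob hw hx) v]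
  have h1 : ⟪sphGrad f (mobS w hw x), refl ((x : E3) + w) x⟫_ℝ = 0 := by
    rw [refl_add_apply hw hx, inner_neg_right, ← coe_mobS hw, inner_sphGrad_self hf, neg_zero]
  have h2 : ∀ a b : E3, ⟪a, refl ((x : E3) + w) b⟫_ℝ = ⟪refl ((x : E3) + w) a, b⟫_ℝ := fun a b => by
    rw [← (refl ((x : E3) + w)).inner_map_map a, Submodule.reflection_reflection]
  simp only [smul_apply, inner_smul_right, inner_smul_left, RCLike.conj_to_real]
  congr 1
  change ⟪sphGrad f (mobS w hw x), refl ((x : E3) + w) _⟫_ℝ = _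
  rw [map_sub, map_smul, inner_sub_right, inner_smul_right, h1, mul_zero, sub_zero, h2]

lemma inner_sphGrad_comp_mobS (hw : ‖w‖ < 1) {f g : S2 → ℝ} (hf : ContMDiff (𝓡 2) 𝓘(ℝ, ℝ) 1 f)
    (hg : ContMDiff (𝓡 2) 𝓘(ℝ, ℝ) 1 g) (x : S2) :
    ⟪sphGrad (f ∘ mobS w hw) x, sphGrad (g ∘ mobS w hw) x⟫_ℝ
      = ((lor w x)⁻¹) ^ 2 * ⟪sphGrad f (mobS w hw x), sphGrad g (mobS w hw x)⟫_ℝ := by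
  rw [sphGrad_comp_mobS hw hf, sphGrad_comp_mobS hw hg, inner_smul_left, inner_smul_right,
    LinearIsometryEquiv.inner_map_map, RCLike.conj_to_real]
  ring

theorem isConformalAutomorphism_mobS (hw : ‖w‖ < 1) : IsConformalAutomorphism (mobS w hw) := by
  have : Fact (Module.finrank ℝ E3 = 2 + 1) := ⟨by simp⟩
  intro x
  have hx : ‖(x : E3)‖ = 1 := by simp
  have hc : ∀ y : S2, HasMFDerivAt (𝓡 2) 𝓘(ℝ, E3) ((↑) : S2 → E3) y
      (mfderiv (𝓡 2) 𝓘(ℝ, E3) ((↑) : S2 → E3) y) := fun y =>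
    ((contMDiff_coe_sphere (m := 1) y).mdifferentiableAt one_ne_zero).hasMFDerivAt
  have h1 := (hasFDerivAt_mob hw hx).hasMFDerivAt.comp x (hc x)
  have h2 := (hc (mobS w hw x)).comp x
    (((contMDiff_mobS hw) x).mdifferentiableAt (by simp)).hasMFDerivAt
  have h3 : ∀ v : TangentSpace (𝓡 2) x,
      mvfderiv (𝓡 2) ((↑) : S2 → E3) (mobS w hw x) (mfderiv (𝓡 2) (𝓡 2) (mobS w hw) x v)
        = (lor w x)⁻¹ • refl ((x : E3) + w) (mvfderiv (𝓡 2) ((↑) : S2 → E3) x v) := fun v =>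
    congrArg (fun L => L v) (h2.mfderiv.symm.trans h1.mfderiv)
  refine ⟨((lor w x)⁻¹) ^ 2, pow_pos (inv_pos.2 (lor_coe_pos hw x)) 2, fun v u => ?_⟩
  rw [roundMetric, roundMetric, h3, h3, inner_smul_left, inner_smul_right,
    LinearIsometryEquiv.inner_map_map, RCLike.conj_to_real]
  ring

end Mob

/-! ### The surface measure of the sphere -/

section Surface

open Set
open scoped Pointwise

/-- The radial projection to the sphere (with an arbitrary value at the origin). -/
def dirS (y : E3) : S2 :=
  if h : y = 0 then hemisphereParam 0 else ⟨‖y‖⁻¹ • y, by simp [norm_smul, h]⟩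

lemma coe_dirS {y : E3} (hy : y ≠ 0) : (dirS y : E3) = ‖y‖⁻¹ • y := by
  rw [dirS, dif_neg hy]

lemma dirS_smul {r : ℝ} (hr : 0 < r) (x : S2) : dirS (r • (x : E3)) = x := by
  ext1
  rw [coe_dirS (smul_ne_zero hr.ne' (coe_ne_zero x)), norm_smul, Real.norm_eq_abs, abs_of_pos hr]
  simp [smul_smul, hr.ne']

lemma norm_smul_dirS (y : E3) : ‖y‖ • (dirS y : E3) = y := by
  by_cases hy : y = 0
  · simp [hy]
  · rw [coe_dirS hy, smul_smul, mul_inv_cancel₀ (norm_ne_zero_iff.2 hy), one_smul]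

lemma measurable_dirS : Measurable dirS := by
  have h : Measurable fun y : E3 => if y = 0 then (hemisphereParam 0 : E3) else ‖y‖⁻¹ • y :=
    Measurable.ite (measurableSet_singleton 0) measurable_const (by fun_prop)
  refine (MeasurableEmbedding.subtype_coe Metric.isClosed_sphere.measurableSet).measurable_comp_iff.1 ?_
  convert h using 1
  funext y
  by_cases hy : y = 0 <;> simp [dirS, hy]

/-- The punctured open unit ball. -/
def pball : Set E3 := Metric.ball 0 1 \ {0}

lemma measurableSet_pball : MeasurableSet pball :=
  Metric.isOpen_ball.measurableSet.diff (measurableSet_singleton 0)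

lemma preimage_dirS_inter (s : Set S2) :
    dirS ⁻¹' s ∩ pball = Ioo (0 : ℝ) 1 • ((↑) '' s : Set E3) := by
  ext y
  simp only [pball, mem_inter_iff, mem_preimage, mem_sdiff, mem_ball_zero_iff, mem_singleton_iff,
    Set.mem_smul]
  constructor
  · rintro ⟨h1, h2, h3⟩
    exact ⟨‖y‖, ⟨norm_pos_iff.2 h3, h2⟩, _, ⟨_, h1, rfl⟩, norm_smul_dirS y⟩
  · rintro ⟨r, hr, _, ⟨x, hx, rfl⟩, rfl⟩
    refine ⟨by rwa [dirS_smul hr.1], ?_, smul_ne_zero hr.1.ne' (coe_ne_zero x)⟩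
    rw [norm_smul, Real.norm_eq_abs, abs_of_pos hr.1]
    simpa using hr.2

lemma roundVolume_apply {s : Set S2} (hs : MeasurableSet s) :
    roundVolume s = 3 * volume (Ioo (0 : ℝ) 1 • ((↑) '' s : Set E3)) := by
  rw [roundVolume, Measure.toSphere_apply' _ hs]
  simp

lemma roundVolume_eq_map :
    roundVolume = (3 : ℝ≥0∞) • (volume.restrict pball).map dirS := by
  ext s hs
  rw [roundVolume_apply hs, Measure.smul_apply, Measure.map_apply measurable_dirS hs,
    Measure.restrict_apply (measurable_dirS hs), preimage_dirS_inter, smul_eq_mul]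

lemma roundVolume_real_univ : roundVolume.real univ = 4 * Real.pi := by
  rw [roundVolume, Measure.toSphere_real_apply_univ, Measure.real, EuclideanSpace.volume_ball_fin_three]
  have h : 0 ≤ Real.pi * 4 / 3 := by positivity
  simp [ENNReal.toReal_ofReal h]
  ring

lemma roundVolume_eq_zero_of_subset {s : Set S2} {K : Submodule ℝ E3} (hK : K ≠ ⊤)
    (hs : ∀ x ∈ s, (x : E3) ∈ K) : roundVolume s = 0 := by
  have hm : MeasurableSet {x : S2 | (x : E3) ∈ K} :=
    measurable_subtype_coe K.closed_of_finiteDimensional.measurableSet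
  refine measure_mono_null (t := {x : S2 | (x : E3) ∈ K}) hs ?_
  rw [roundVolume_apply hm]
  refine mul_eq_zero_of_right _ (measure_mono_null ?_ (Measure.addHaar_submodule volume K hK))
  rintro _ ⟨r, -, _, ⟨x, hx, rfl⟩, rfl⟩
  exact K.smul_mem r hx

lemma roundVolume_equator {p : E3} (hp : p ≠ 0) : roundVolume {x : S2 | ⟪p, (x : E3)⟫_ℝ = 0} = 0 := by
  refine roundVolume_eq_zero_of_subset (K := (ℝ ∙ p)ᗮ) (fun h => hp ?_) fun x hx => ?_
  · have : p ∈ (ℝ ∙ p)ᗮ := by rw [h]; trivial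
    simpa using Submodule.mem_orthogonal_singleton_iff_inner_right.1 this
  · exact Submodule.mem_orthogonal_singleton_iff_inner_right.2 hx

instance : NullSingletonClass roundVolume where
  measure_singleton x := by
    refine roundVolume_eq_zero_of_subset (K := ℝ ∙ (x : E3)) (fun h => ?_) fun y hy => ?_
    · have h1 := finrank_span_singleton (K := ℝ) (coe_ne_zero x)
      rw [h, finrank_top] at h1
      simp at h1
    · rw [mem_singleton_iff.1 hy]; exact Submodule.mem_span_singleton_self _

/-- The determinant of a rank one perturbation of a multiple of the identity. -/
lemma det_smul_id_add {q : E3} (hq : ‖q‖ = 1) (a b : ℝ) :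
    (a • ContinuousLinearMap.id ℝ E3 + b • (innerSL ℝ q).smulRight q).det = a ^ 3 + a ^ 2 * b := by
  have h : q 0 * q 0 + q 1 * q 1 + q 2 * q 2 = 1 := by
    rw [← inner_eq_sum, real_inner_self_eq_norm_sq, hq, one_pow]
  rw [ContinuousLinearMap.det, ← LinearMap.det_toMatrix (EuclideanSpace.basisFun (Fin 3) ℝ).toBasis]
  have hM : LinearMap.toMatrix (EuclideanSpace.basisFun (Fin 3) ℝ).toBasis
      (EuclideanSpace.basisFun (Fin 3) ℝ).toBasis
      ((a • ContinuousLinearMap.id ℝ E3 + b • (innerSL ℝ q).smulRight q : E3 →L[ℝ] E3) : E3 →ₗ[ℝ] E3)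
      = Matrix.of fun i j => (if i = j then a else 0) + b * (q j * q i) := by
    ext i j
    rw [LinearMap.toMatrix_apply]
    simp [EuclideanSpace.inner_single_right]
  rw [hM, Matrix.det_fin_three]
  simp
  linear_combination (a ^ 2 * b) * h

lemma abs_det_refl {p : E3} (hp : p ≠ 0) : |(refl p : E3 →L[ℝ] E3).det| = 1 := by
  have hq : ‖‖p‖⁻¹ • p‖ = 1 := by simp [norm_smul, hp]
  have : (refl p : E3 →L[ℝ] E3) = (1 : ℝ) • ContinuousLinearMap.id ℝ E3 +
      (-2 : ℝ) • (innerSL ℝ (‖p‖⁻¹ • p)).smulRight (‖p‖⁻¹ • p) := by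
    ext1 v
    change refl p v = _
    rw [refl, Submodule.reflection_orthogonal_apply, Submodule.reflection_singleton_apply]
    simp [two_smul, smul_smul]
    have h0 : ‖p‖ ≠ 0 := norm_ne_zero_iff.2 hp
    have h1 : ‖p‖⁻¹ * ⟪p, v⟫_ℝ * ‖p‖⁻¹ = ⟪p, v⟫_ℝ / ‖p‖ ^ 2 := by
      field_simp
    rw [h1]
    abel
  rw [this, det_smul_id_add hq]
  norm_num

/-- The one-homogeneous extension of a Möbius transformation to `ℝ³`. -/
def homMob (w y : E3) : E3 := ‖y‖ • mob w (‖y‖⁻¹ • y)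

/-- Tangentially the derivative is that of `mob`. Radially it sends x to `mob w x`, which is minus
the reflected x; so the inner factor must be −1 on x, and this fixes the coefficient −(lor⁻¹ + 1).
-/
lemma hasFDerivAt_homMob {w : E3} (hw : ‖w‖ < 1) {y : E3} (hy : y ≠ 0) :
    HasFDerivAt (homMob w) ((refl (dirS y + w) : E3 →L[ℝ] E3) ∘L
      ((lor w (dirS y))⁻¹ • ContinuousLinearMap.id ℝ E3 + (-((lor w (dirS y))⁻¹ + 1)) •
        (innerSL ℝ (dirS y : E3)).smulRight (dirS y : E3))) y := by
  set r := ‖y‖ with hr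
  set x : S2 := dirS y with hxdef
  have hr0 : 0 < r := norm_pos_iff.2 hy
  have hx : ‖(x : E3)‖ = 1 := by simp
  have hyx : r⁻¹ • y = x := (coe_dirS hy).symm
  have hN : HasFDerivAt (fun z : E3 => ‖z‖⁻¹ • z)
      (r⁻¹ • (ContinuousLinearMap.id ℝ E3 - (innerSL ℝ (x : E3)).smulRight (x : E3))) y := by
    have h1 : HasFDerivAt (fun z : E3 => r⁻¹ • z) (r⁻¹ • ContinuousLinearMap.id ℝ E3) y :=
      (hasFDerivAt_id y).const_smul r⁻¹
    have h2 := hasFDerivAt_normalize hx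
    rw [← hyx] at h2
    have h3 := h2.comp y h1
    rw [hyx] at h3
    refine (h3.congr_of_eventuallyEq (Filter.Eventually.of_forall fun z => ?_)).congr_fderiv ?_
    · simp [norm_smul, abs_of_pos hr0, smul_smul, hr0.ne']
    · ext1 v; simp [smul_sub, smul_smul]
  have hnorm : HasFDerivAt (fun z : E3 => ‖z‖) (innerSL ℝ (x : E3)) y := by
    have h2 := ((hasStrictFDerivAt_norm_sq y).hasFDerivAt).sqrt (by simp [hy])
    simp only [Real.sqrt_sq (norm_nonneg _)] at h2
    refine h2.congr_fderiv ?_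
    ext1 v
    rw [← hyx]
    simp
    rw [← hr]
    field_simp
  have hmob := hasFDerivAt_mob hw hx
  rw [← hyx] at hmob
  have h4 := hnorm.smul (HasFDerivAt.comp (f := fun z : E3 => ‖z‖⁻¹ • z) y hmob hN)
  rw [hyx] at h4
  refine h4.congr_fderiv ?_
  ext1 v
  have hRx : refl ((x : E3) + w) x = -mob w x := refl_add_apply hw hx
  simp only [add_apply, smul_apply, ContinuousLinearMap.comp_apply, ContinuousLinearMap.smulRight_apply,
    Function.comp_apply, sub_apply, ContinuousLinearMap.id_apply, innerSL_apply_apply]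
  change r • (lor w x)⁻¹ • refl ((x : E3) + w) (r⁻¹ • (v - ⟪(x : E3), v⟫_ℝ • (x : E3))) + _ =
    refl ((x : E3) + w) _
  rw [hyx]
  simp only [map_smul, map_sub, map_add, hRx, smul_sub, smul_smul, smul_neg]
  have e1 : r * ((lor w x)⁻¹ * r⁻¹) = (lor w x)⁻¹ := by field_simp
  rw [← mul_assoc] at e1
  simp only [← mul_assoc, e1]
  module

lemma abs_det_fderiv_homMob {w : E3} (hw : ‖w‖ < 1) (y : E3) :
    |((refl (dirS y + w) : E3 →L[ℝ] E3) ∘L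
      ((lor w (dirS y))⁻¹ • ContinuousLinearMap.id ℝ E3 + (-((lor w (dirS y))⁻¹ + 1)) •
        (innerSL ℝ (dirS y : E3)).smulRight (dirS y : E3))).det| = ((lor w (dirS y))⁻¹) ^ 2 := by
  have h := det_smul_id_add (q := (dirS y : E3)) (by simp) (lor w (dirS y))⁻¹
    (-((lor w (dirS y))⁻¹ + 1))
  have hc : ∀ A B : E3 →L[ℝ] E3, (A ∘L B).det = A.det * B.det := fun A B => by
    simp [ContinuousLinearMap.det]
  rw [hc, h, abs_mul, abs_det_refl (add_ne_zero_of_norm hw (by simp)), one_mul]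
  rw [show (lor w (dirS y))⁻¹ ^ 3 + (lor w (dirS y))⁻¹ ^ 2 * -((lor w (dirS y))⁻¹ + 1)
    = -((lor w (dirS y))⁻¹ ^ 2) by ring, abs_neg, abs_of_nonneg (by positivity)]

lemma homMob_eq (w : E3) (hw : ‖w‖ < 1) {y : E3} (hy : y ≠ 0) :
    homMob w y = ‖y‖ • (mobS w hw (dirS y) : E3) := by
  rw [homMob, coe_mobS, coe_dirS hy]

/-- **Change of variables** on the sphere under a Möbius transformation. -/
theorem lintegral_comp_mobS {w : E3} (hw : ‖w‖ < 1) {g : S2 → ℝ≥0∞} (hg : Measurable g) :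
    ∫⁻ x, ENNReal.ofReal (((lor w x)⁻¹) ^ 2) * g (mobS w hw x) ∂roundVolume
      = ∫⁻ x, g x ∂roundVolume := by
  have hmeas : Measurable fun x : S2 => ENNReal.ofReal (((lor w x)⁻¹) ^ 2) * g (mobS w hw x) := by
    have h1 := (continuous_lor (w := w)).measurable
    have h2 := (mobS w hw).continuous.measurable
    fun_prop
  have hmem : ∀ y ∈ pball, y ≠ 0 := fun y hy => hy.2
  have hdir : ∀ y ∈ pball, dirS (homMob w y) = mobS w hw (dirS y) := fun y hy => by
    rw [homMob_eq w hw (hmem y hy), dirS_smul (norm_pos_iff.2 (hmem y hy))]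
  have hnorm : ∀ y ∈ pball, ‖homMob w y‖ = ‖y‖ := fun y hy => by
    rw [homMob_eq w hw (hmem y hy), norm_smul, norm_norm, norm_eq_of_mem_sphere, mul_one]
  have hinj : InjOn (homMob w) pball := fun y hy z hz h => by
    rw [← norm_smul_dirS y, ← norm_smul_dirS z, ← hnorm y hy, ← hnorm z hz, h]
    congr 2
    have h3 : mobS w hw (dirS y) = mobS w hw (dirS z) := by rw [← hdir y hy, ← hdir z hz, h]
    exact (mobS w hw).injective h3
  have himg : homMob w '' pball = pball := by
    refine Subset.antisymm ?_ fun y hy => ?_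
    · rintro _ ⟨y, hy, rfl⟩
      have h1 := hnorm y hy
      refine ⟨by simpa [h1] using hy.1, fun h => hy.2 ?_⟩
      rw [mem_singleton_iff] at h
      rw [h, norm_zero] at h1
      simpa using norm_eq_zero.1 h1.symm
    · have hy0 : 0 < ‖y‖ := norm_pos_iff.2 (hmem y hy)
      refine ⟨‖y‖ • ((mobS w hw).symm (dirS y) : E3), ⟨?_, ?_⟩, ?_⟩
      · simpa [norm_smul] using hy.1
      · exact smul_ne_zero hy0.ne' (coe_ne_zero _)
      · rw [homMob_eq w hw (smul_ne_zero hy0.ne' (coe_ne_zero _)), dirS_smul hy0]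
        simp [norm_smul, norm_smul_dirS]
  -- The extension preserves norms and maps the punctured ball bijectively to itself with Jacobian
  -- lor⁻², so the spherical formula follows from the one in ℝ³.
  have h := lintegral_image_eq_lintegral_abs_det_fderiv_mul volume measurableSet_pball
    (fun y hy => (hasFDerivAt_homMob hw (hmem y hy)).hasFDerivWithinAt) hinj (fun y => g (dirS y))
  rw [himg] at h
  rw [roundVolume_eq_map, lintegral_smul_measure, lintegral_smul_measure,
    lintegral_map hmeas measurable_dirS, lintegral_map hg measurable_dirS, h]
  congr 1
  refine setLIntegral_congr_fun measurableSet_pball fun y hy => ?_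
  simp only [abs_det_fderiv_homMob hw, hdir y hy]

lemma integral_comp_mobS {w : E3} (hw : ‖w‖ < 1) {g : S2 → ℝ} (hg : Measurable g) :
    ∫ x, ((lor w x)⁻¹) ^ 2 * g (mobS w hw x) ∂roundVolume = ∫ x, g x ∂roundVolume := by
  have h1 : Measurable fun x : S2 => ENNReal.ofReal (((lor w x)⁻¹) ^ 2) := by
    have h1 := (continuous_lor (w := w)).measurable
    fun_prop
  have h2 := (mobS w hw).continuous.measurable
  have hmap : (roundVolume.withDensity fun x => ENNReal.ofReal (((lor w x)⁻¹) ^ 2)).map (mobS w hw)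
      = roundVolume := by
    ext s hs
    rw [Measure.map_apply h2 hs, withDensity_apply _ (h2 hs), ← lintegral_indicator (h2 hs),
      ← lintegral_indicator_one hs, ← lintegral_comp_mobS hw (measurable_one.indicator hs)]
    congr 1
    funext x
    by_cases hx : mobS w hw x ∈ s <;> simp [hx]
  conv_rhs => rw [← hmap]
  rw [integral_map h2.aemeasurable hg.aestronglyMeasurable,
    integral_withDensity_eq_integral_toReal_smul h1 (by simp)]
  refine integral_congr_ae (Filter.Eventually.of_forall fun x => ?_)
  simp only [ENNReal.toReal_ofReal (sq_nonneg _), smul_eq_mul]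

/-- The reflection of the sphere in the plane orthogonal to `p`. -/
def reflS (p : E3) : S2 → S2 := fun x => ⟨refl p x, by simp⟩

@[simp] lemma coe_reflS (p : E3) (x : S2) : (reflS p x : E3) = refl p x := rfl

lemma continuous_reflS (p : E3) : Continuous (reflS p) :=
  ((refl p).continuous.comp continuous_subtype_val).subtype_mk _

lemma reflS_reflS (p : E3) (x : S2) : reflS p (reflS p x) = x := by
  ext1; simp [Submodule.reflection_reflection]

lemma measurePreserving_reflS (p : E3) : MeasurePreserving (reflS p) roundVolume roundVolume := by
  refine ⟨(continuous_reflS p).measurable, ?_⟩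
  ext s hs
  have hs' := (continuous_reflS p).measurable hs
  rw [Measure.map_apply (continuous_reflS p).measurable hs, roundVolume_apply hs, roundVolume_apply hs',
    ← (refl p).measurePreserving.measure_preimage_equiv (f := (refl p).toMeasurableEquiv)
      (Ioo (0 : ℝ) 1 • ((↑) '' s : Set E3))]
  congr 2
  ext y
  constructor
  · rintro ⟨r, hr, _, ⟨x, hx, rfl⟩, rfl⟩
    exact ⟨r, hr, _, ⟨_, hx, rfl⟩, by simp⟩
  · rintro ⟨r, hr, _, ⟨x, hx, rfl⟩, h⟩
    refine ⟨r, hr, _, ⟨reflS p x, by simpa [reflS_reflS] using hx, rfl⟩, ?_⟩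
    apply (refl p).injective
    simpa [Submodule.reflection_reflection] using h

/-- The squared form of (1 − d²/2)‖Lv‖ ≤ s below, with D = d², S = s², and m the squared distance of
v from the axis. A ball of radius 1/8 about e/2 has s > 3/8 and m ≤ 1/64. -/
lemma cap_aux {D S m : ℝ} (hD : 0 ≤ D) (hD1 : D ≤ 1) (hS : 9 / 64 ≤ S) (hm : m ≤ 1 / 64) :
    (1 - D / 2) ^ 2 * (S + D * m) ≤ S := by
  have e0 : 0 ≤ (1 - D / 2) ^ 2 := sq_nonneg _
  have e1 : (1 - D / 2) ^ 2 * (S + D * m) ≤ (1 - D / 2) ^ 2 * (S + D * (1 / 64)) := by gcongr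
  have e2 : (1 - D / 2) ^ 2 ≤ 1 := by nlinarith
  have e3 : (1 - D / 2) ^ 2 * (D * (1 / 64)) ≤ D * (1 / 64) := by nlinarith
  have e4 : (1 - D / 2) ^ 2 ≤ 1 - 3 / 4 * D := by nlinarith
  have e5 : (1 - D / 2) ^ 2 * S ≤ (1 - 3 / 4 * D) * S := by gcongr
  nlinarith

/-- The cone over a cap contains an ellipsoid. -/
lemma image_ball_subset_cone {e : E3} (he1 : ‖e‖ = 1) {d : ℝ} (hdpos : 0 < d) (hd1 : d ≤ 1)
    {L : E3 →L[ℝ] E3} (hL : ∀ v, L v = d • v + (1 - d) • ⟪e, v⟫_ℝ • e) :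
    L '' Metric.ball ((1 / 2 : ℝ) • e) (1 / 8) ⊆
      Ioo (0 : ℝ) 1 • ((↑) '' {z : S2 | 1 - d ^ 2 / 2 ≤ ⟪e, (z : E3)⟫_ℝ} : Set E3) := by
  rintro _ ⟨v, hv, rfl⟩
  set h := v - (1 / 2 : ℝ) • e with hh
  have hv' : ‖h‖ < 1 / 8 := by rwa [Metric.mem_ball, dist_eq_norm] at hv
  set s := ⟪e, v⟫_ℝ with hs
  have hsh : s = 1 / 2 + ⟪e, h⟫_ℝ := by
    rw [hs, hh, inner_sub_right, inner_smul_right, real_inner_self_eq_norm_sq, he1]; ring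
  have hsb : |⟪e, h⟫_ℝ| < 1 / 8 := by
    refine lt_of_le_of_lt (abs_real_inner_le_norm e h) ?_
    rw [he1, one_mul]; exact hv'
  obtain ⟨hb1, hb2⟩ := abs_lt.1 hsb
  have hvn : ‖v‖ ^ 2 - s ^ 2 ≤ 1 / 64 := by
    have h1 : ‖v‖ ^ 2 = ‖h‖ ^ 2 + ⟪e, h⟫_ℝ + 1 / 4 := by
      have : v = h + (1 / 2 : ℝ) • e := by rw [hh]; abel
      rw [this, norm_add_sq_real, norm_smul, he1, inner_smul_right, real_inner_comm]
      norm_num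
      ring
    rw [h1, hsh]
    nlinarith [norm_nonneg h, sq_nonneg (⟪e, h⟫_ℝ)]
  have hvn0 : 0 ≤ ‖v‖ ^ 2 - s ^ 2 := by
    have h1 : |s| ≤ ‖v‖ := by simpa [he1] using abs_real_inner_le_norm e v
    have := sq_le_sq' (abs_le.1 h1).1 (abs_le.1 h1).2
    linarith
  have hLn : ‖L v‖ ^ 2 = s ^ 2 + d ^ 2 * (‖v‖ ^ 2 - s ^ 2) := by
    rw [hL, norm_add_sq_real, norm_smul, norm_smul, norm_smul, he1, inner_smul_left,
      inner_smul_right, inner_smul_right, real_inner_comm e v, ← hs]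
    simp only [RCLike.conj_to_real, mul_pow, Real.norm_eq_abs, sq_abs]
    ring
  have hLe : ⟪e, L v⟫_ℝ = s := by
    rw [hL, inner_add_right, inner_smul_right, inner_smul_right, inner_smul_right,
      real_inner_self_eq_norm_sq, he1, ← hs]
    ring
  have hdd : d ^ 2 ≤ 1 := by nlinarith
  have hLpos : 0 < ‖L v‖ := by
    refine norm_pos_iff.2 fun h0 => ?_
    rw [h0, inner_zero_right] at hLe
    linarith
  have hL1 : ‖L v‖ < 1 := by
    have : ‖L v‖ ^ 2 < 1 := by rw [hLn]; nlinarith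
    nlinarith
  have hkey : (1 - d ^ 2 / 2) * ‖L v‖ ≤ s := by
    refine abs_le_of_sq_le_sq' ?_ (by linarith) |>.2
    rw [mul_pow, hLn]
    exact cap_aux (sq_nonneg d) hdd (by nlinarith) hvn
  refine ⟨‖L v‖, ⟨hLpos, hL1⟩, _, ⟨dirS (L v), ?_, rfl⟩, norm_smul_dirS _⟩
  rw [mem_ofPred_eq, coe_dirS (norm_pos_iff.1 hLpos), inner_smul_right, hLe, inv_mul_eq_div]
  rwa [le_div_iff₀ hLpos]

/-- A cap that contains two points at distance `d` has area at least a multiple of `d ^ 2`. -/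
theorem cap_area_ge {a : E3} {β : ℝ} {x y : S2} (hx : ⟪a, (x : E3)⟫_ℝ ≤ β) (hy : ⟪a, (y : E3)⟫_ℝ ≤ β) :
    ‖(x : E3) - y‖ ^ 2 ≤ 256 * roundVolume.real {z : S2 | ⟪a, (z : E3)⟫_ℝ ≤ β} := by
  have hpi := Real.pi_gt_three
  have hd2 : ‖(x : E3) - y‖ ≤ 2 := by
    refine (norm_sub_le _ _).trans (by simp; norm_num)
  rcases eq_or_ne a 0 with rfl | ha
  · have hβ : 0 ≤ β := by simpa using hx
    have : {z : S2 | ⟪(0 : E3), (z : E3)⟫_ℝ ≤ β} = univ := by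
      ext z; simp [hβ]
    rw [this, roundVolume_real_univ]
    nlinarith [norm_nonneg ((x : E3) - y)]
  set d := ‖(x : E3) - y‖ / 2 with hd
  rcases eq_or_ne d 0 with hd0 | hd0
  · have : ‖(x : E3) - y‖ = 0 := by linarith
    rw [this]
    simp only [ne_eq, OfNat.ofNat_ne_zero, not_false_eq_true, zero_pow]
    positivity
  have hdpos : 0 < d := lt_of_le_of_ne (by positivity) hd0.symm
  have hd1 : d ≤ 1 := by linarith
  have ha0 : 0 < ‖a‖ := norm_pos_iff.2 ha
  set e : E3 := -(‖a‖⁻¹ • a) with he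
  have he1 : ‖e‖ = 1 := by rw [he, norm_neg, norm_smul, norm_inv, norm_norm, inv_mul_cancel₀ ha0.ne']
  have hae : a = -(‖a‖ • e) := by
    rw [he, smul_neg, neg_neg, smul_smul, mul_inv_cancel₀ ha0.ne', one_smul]
  have hcond : ∀ z : E3, ⟪a, z⟫_ℝ = -(‖a‖ * ⟪e, z⟫_ℝ) := fun z => by
    conv_lhs => rw [hae]
    rw [inner_neg_left, inner_smul_left, RCLike.conj_to_real]
  -- By the triangle inequality one of the two points is at distance at least d from the cap's
  -- center e, so the cap contains the concentric cap of chordal radius d.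
  obtain ⟨u, hu, hue⟩ : ∃ u : S2, ⟪a, (u : E3)⟫_ℝ ≤ β ∧ d ≤ ‖(u : E3) - e‖ := by
    by_contra! h
    have h1 := h x hx
    have h2 := h y hy
    have h3 : ‖(x : E3) - y‖ ≤ ‖(x : E3) - e‖ + ‖(y : E3) - e‖ := by
      rw [show (x : E3) - y = (x - e) - (y - e) by abel]
      exact norm_sub_le _ _
    linarith
  have hβ : -(‖a‖ * (1 - d ^ 2 / 2)) ≤ β := by
    refine le_trans ?_ hu
    rw [hcond]
    have h1 : d ^ 2 ≤ ‖(u : E3) - e‖ ^ 2 := by gcongr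
    rw [norm_sub_sq_real, he1, norm_eq_of_mem_sphere, real_inner_comm] at h1
    nlinarith
  let L : E3 →L[ℝ] E3 := d • ContinuousLinearMap.id ℝ E3 + (1 - d) • (innerSL ℝ e).smulRight e
  have hL : ∀ v, L v = d • v + (1 - d) • ⟪e, v⟫_ℝ • e := fun v => by simp [L]
  have hdet : L.det = d ^ 2 := by
    rw [det_smul_id_add he1]; ring
  have hsub : L '' Metric.ball ((1 / 2 : ℝ) • e) (1 / 8) ⊆
      Ioo (0 : ℝ) 1 • ((↑) '' {z : S2 | ⟪a, (z : E3)⟫_ℝ ≤ β} : Set E3) := by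
    refine (image_ball_subset_cone he1 hdpos hd1 hL).trans
      (Set.smul_subset_smul_left (image_mono fun z hz => ?_))
    rw [mem_ofPred_eq] at hz
    rw [mem_ofPred_eq, hcond]
    refine le_trans ?_ hβ
    rw [neg_le_neg_iff]
    gcongr
  have hmeas : MeasurableSet {z : S2 | ⟪a, (z : E3)⟫_ℝ ≤ β} :=
    measurableSet_le (by fun_prop) measurable_const
  -- Here d² is the determinant of L, and 3 converts cone volume to area. The bound is πd²/128,
  -- while ‖x − y‖² = 4d², so 256 suffices.
  have hvol : ENNReal.ofReal (3 * (d ^ 2 * ((1 / 8) ^ 3 * (Real.pi * 4 / 3)))) ≤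
      roundVolume {z : S2 | ⟪a, (z : E3)⟫_ℝ ≤ β} := by
    rw [roundVolume_apply hmeas, ENNReal.ofReal_mul (by norm_num)]
    refine mul_le_mul' (by simp) (le_trans (le_of_eq ?_) (measure_mono hsub))
    have h1 := Measure.addHaar_image_continuousLinearMap (volume : Measure E3) L
      (Metric.ball ((1 / 2 : ℝ) • e) (1 / 8))
    have h2 : LinearMap.det (L : E3 →ₗ[ℝ] E3) = d ^ 2 := hdet
    rw [h1, h2, EuclideanSpace.volume_ball_fin_three, abs_of_nonneg (sq_nonneg _),
      ENNReal.ofReal_mul (sq_nonneg _), ENNReal.ofReal_mul (by norm_num),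
      ENNReal.ofReal_pow (p := 1 / 8) (by norm_num)]
  have h2 := (ENNReal.ofReal_le_iff_le_toReal (measure_ne_top _ _)).1 hvol
  change _ ≤ roundVolume.real _ at h2
  have h3 : ‖(x : E3) - y‖ ^ 2 = 4 * d ^ 2 := by rw [hd]; ring
  have h4 : 3 * d ^ 2 ≤ Real.pi * d ^ 2 := by gcongr
  nlinarith [sq_nonneg d]

end Surface

/-! ### The Dirichlet form and Green's formula -/

/-- The Dirichlet form `∫ ⟨∇f, ∇g⟩ dv`. -/
def dirichlet (f g : S2 → ℝ) : ℝ := ∫ x, ⟪sphGrad f x, sphGrad g x⟫_ℝ ∂roundVolume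

lemma continuous_inner_sphGrad {f g : S2 → ℝ} (hf : ContMDiff (𝓡 2) 𝓘(ℝ, ℝ) 1 f)
    (hg : ContMDiff (𝓡 2) 𝓘(ℝ, ℝ) 1 g) : Continuous fun x => ⟪sphGrad f x, sphGrad g x⟫_ℝ :=
  (continuous_sphGrad hf).inner (continuous_sphGrad hg)

/-- Conformal invariance of the Dirichlet form. -/
theorem dirichlet_comp_mobS {w : E3} (hw : ‖w‖ < 1) (f g : SmoothFun) :
    dirichlet (f ∘ mobS w hw) (g ∘ mobS w hw) = dirichlet f g := by
  have h := (continuous_inner_sphGrad f.contMDiff_one g.contMDiff_one).measurable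
  rw [dirichlet, dirichlet, ← integral_comp_mobS hw h]
  simp only [inner_sphGrad_comp_mobS hw f.contMDiff_one g.contMDiff_one]

section Green

open Set Filter Topology

lemma fderiv_radialExt_smul {f : S2 → ℝ} (hf : ContMDiff (𝓡 2) 𝓘(ℝ, ℝ) 1 f) {r : ℝ} (hr : 0 < r)
    (x : S2) : fderiv ℝ (radialExt f) (r • (x : E3)) = r⁻¹ • fderiv ℝ (radialExt f) (x : E3) := by
  have h1 : radialExt f = fun y => radialExt f (r⁻¹ • y) := by
    funext y
    by_cases hy : y = 0
    · simp [hy]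
    · rw [radialExt, dif_neg hy, radialExt, dif_neg (smul_ne_zero (inv_ne_zero hr.ne') hy)]
      congr 2
      rw [norm_smul, norm_inv, Real.norm_eq_abs, abs_of_pos hr, smul_smul, mul_inv, inv_inv]
      field_simp
  have h2 : HasFDerivAt (radialExt f) (fderiv ℝ (radialExt f) (x : E3)) (r⁻¹ • r • (x : E3)) := by
    rw [smul_smul, inv_mul_cancel₀ hr.ne', one_smul]
    exact (differentiableAt_radialExt hf x).hasFDerivAt
  have h3 := h2.comp (r • (x : E3)) ((hasFDerivAt_id (r • (x : E3))).const_smul r⁻¹)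
  have h4 : HasFDerivAt (radialExt f) _ (r • (x : E3)) :=
    h3.congr_of_eventuallyEq (Eventually.of_forall fun y => congrFun h1 y)
  rw [h4.fderiv]
  ext v; simp

lemma radialExt_smul (f : S2 → ℝ) {r : ℝ} (hr : 0 < r) (x : S2) :
    radialExt f (r • (x : E3)) = f x := by
  rw [radialExt, dif_neg (smul_ne_zero hr.ne' (coe_ne_zero x))]
  congr 1
  ext1
  simp [norm_smul, abs_of_pos hr, smul_smul, hr.ne']

lemma finrank_E3 : Module.finrank ℝ E3 = 3 := by simp

lemma integral_polar (F : E3 → ℝ) :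
    ∫ y, F y = ∫ q : S2 × Ioi (0 : ℝ), F ((q.2 : ℝ) • (q.1 : E3))
      ∂(roundVolume.prod (Measure.volumeIoiPow 2)) := by
  have h1 := (volume : Measure E3).measurePreserving_homeomorphUnitSphereProd
  rw [finrank_E3] at h1
  have h2 := h1.integral_comp (Homeomorph.measurableEmbedding _)
    (fun q : S2 × Ioi (0 : ℝ) => F ((q.2 : ℝ) • (q.1 : E3)))
  rw [roundVolume]
  refine Eq.trans ?_ h2
  have h3 := integral_subtype_comap (μ := (volume : Measure E3))
    (measurableSet_singleton (0 : E3)).compl F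
  rw [restrict_compl_singleton] at h3
  rw [← h3]
  refine integral_congr_ae (Eventually.of_forall fun y => ?_)
  have := (homeomorphUnitSphereProd E3).symm_apply_apply y
  simp only
  congr 1
  exact (congrArg Subtype.val this).symm

lemma integrable_polar {F : E3 → ℝ} (hF : Integrable F) :
    Integrable (fun q : S2 × Ioi (0 : ℝ) => F ((q.2 : ℝ) • (q.1 : E3)))
      (roundVolume.prod (Measure.volumeIoiPow 2)) := by
  have h1 := (volume : Measure E3).measurePreserving_homeomorphUnitSphereProd
  rw [finrank_E3] at h1
  rw [roundVolume]
  refine (h1.integrable_comp_emb (Homeomorph.measurableEmbedding _)).1 ?_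
  have h3 := (integrableOn_iff_comap_subtypeVal (μ := (volume : Measure E3))
    (measurableSet_singleton (0 : E3)).compl).1 hF.integrableOn
  refine h3.congr (Eventually.of_forall fun y => ?_)
  have := (homeomorphUnitSphereProd E3).symm_apply_apply y
  simp only [Function.comp_apply]
  congr 1
  exact (congrArg Subtype.val this).symm

lemma continuous_mul_of_eventually_zero {a b : E3 → ℝ} (ha : ∀ y, y ≠ 0 → ContinuousAt a y)
    (hb : Continuous b) (hb0 : b =ᶠ[𝓝 0] 0) : Continuous fun y => a y * b y := by
  rw [continuous_iff_continuousAt]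
  intro y
  rcases eq_or_ne y 0 with rfl | hy
  · refine (continuousAt_const (y := (0 : ℝ))).congr ?_
    filter_upwards [hb0] with z hz
    rw [hz]; simp
  · exact (ha y hy).mul hb.continuousAt

/-- A smooth radial cutoff function supported in an annulus. -/
def cutoff (y : E3) : ℝ := (⟨1 / 2, 1, by norm_num, by norm_num⟩ : ContDiffBump (2 : ℝ)) (‖y‖ ^ 2)

lemma contDiff_cutoff : ContDiff ℝ ∞ cutoff := by
  unfold cutoff
  exact (ContDiffBump.contDiff _).comp (contDiff_norm_sq ℝ)

lemma cutoff_eq_zero {y : E3} (hy : ‖y‖ ^ 2 ∉ Ioo (1 : ℝ) 3) : cutoff y = 0 := by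
  refine ContDiffBump.zero_of_le_dist _ ?_
  simp only [mem_Ioo, not_and_or, not_lt] at hy
  rw [Real.dist_eq]
  rcases hy with hy | hy
  · rw [abs_of_nonpos (by linarith)]; norm_num; linarith
  · rw [abs_of_nonneg (by linarith)]; norm_num; linarith

lemma cutoff_eventually_zero : ∀ᶠ y : E3 in 𝓝 0, cutoff y = 0 := by
  filter_upwards [Metric.ball_mem_nhds (0 : E3) one_pos] with y hy
  rw [mem_ball_zero_iff] at hy
  refine cutoff_eq_zero fun h => ?_
  nlinarith [h.1, norm_nonneg y]

lemma hasCompactSupport_cutoff : HasCompactSupport cutoff := by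
  refine HasCompactSupport.intro (isCompact_closedBall (0 : E3) 2) fun y hy => ?_
  rw [mem_closedBall_zero_iff, not_le] at hy
  exact cutoff_eq_zero fun h => by nlinarith [h.2]

lemma cutoff_smul {r : ℝ} (x : S2) :
    cutoff (r • (x : E3)) = (⟨1 / 2, 1, by norm_num, by norm_num⟩ : ContDiffBump (2 : ℝ)) (r ^ 2) := by
  rw [cutoff, norm_smul, norm_eq_of_mem_sphere, mul_one, Real.norm_eq_abs, sq_abs]

/-- The factor r⁻² comes from the two gradients of radially constant functions, each homogeneous of
degree −1. -/
lemma exists_pos_integral_cutoff : ∃ k : Ioi (0 : ℝ) → ℝ,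
    (∀ (r : Ioi (0 : ℝ)) (x : S2), k r = cutoff ((r : ℝ) • (x : E3)) * ((r : ℝ)⁻¹) ^ 2) ∧
      0 < ∫ r, k r ∂(Measure.volumeIoiPow 2) := by
  let b : ContDiffBump (2 : ℝ) := ⟨1 / 2, 1, by norm_num, by norm_num⟩
  refine ⟨fun r => b ((r : ℝ) ^ 2) * ((r : ℝ)⁻¹) ^ 2, fun r x => by rw [cutoff_smul], ?_⟩
  have h1 : ∫ r : Ioi (0 : ℝ), b ((r : ℝ) ^ 2) * ((r : ℝ)⁻¹) ^ 2 ∂(Measure.volumeIoiPow 2)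
      = ∫ r in Ioi (0 : ℝ), b (r ^ 2) := by
    rw [Measure.volumeIoiPow, integral_withDensity_eq_integral_toReal_smul (by fun_prop) (by simp),
      integral_subtype_comap measurableSet_Ioi
        (fun r : ℝ => (ENNReal.ofReal (r ^ 2)).toReal • (b (r ^ 2) * (r⁻¹) ^ 2))]
    refine setIntegral_congr_fun measurableSet_Ioi fun r hr => ?_
    have hr' : r ≠ 0 := (mem_Ioi.1 hr).ne'
    simp only [ENNReal.toReal_ofReal (sq_nonneg r), smul_eq_mul]
    field_simp
  rw [h1]
  have hcont : Continuous fun r : ℝ => b (r ^ 2) := b.continuous.comp (by fun_prop)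
  have hint : IntegrableOn (fun r : ℝ => b (r ^ 2)) (Ioi 0) := by
    refine (hcont.integrable_of_hasCompactSupport ?_).integrableOn
    refine HasCompactSupport.intro (isCompact_closedBall (0 : ℝ) 2) fun r hr => ?_
    rw [mem_closedBall_zero_iff, not_le, Real.norm_eq_abs] at hr
    refine b.zero_of_le_dist ?_
    have : 4 < r ^ 2 := by rw [← sq_abs]; nlinarith
    rw [Real.dist_eq, abs_of_nonneg (by linarith)]
    change (1 : ℝ) ≤ _
    linarith
  rw [setIntegral_pos_iff_support_of_nonneg_ae (Eventually.of_forall fun r => b.nonneg) hint]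
  refine lt_of_lt_of_le (b := volume (Ioo (1.3 : ℝ) 1.5)) (by simp; norm_num) (measure_mono ?_)
  intro r hr
  refine ⟨?_, mem_Ioi.2 (by linarith [hr.1])⟩
  rw [Function.mem_support]
  refine (b.pos_of_mem_ball ?_).ne'
  rw [Metric.mem_ball, Real.dist_eq, abs_lt]
  change -(1 : ℝ) < _ ∧ _ < (1 : ℝ)
  constructor <;> nlinarith [hr.1, hr.2]

/-- **Green's formula**, in the weak form that `f ↦ ∫ ⟨∇f, ∇ψ⟩ dv` is integration against an integrable
function. -/
theorem exists_green (ψ : SmoothFun) : ∃ h : S2 → ℝ, Integrable h roundVolume ∧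
    ∀ f : SmoothFun, dirichlet f ψ = ∫ x, f x * h x ∂roundVolume := by
  let g : E3 → E3 →L[ℝ] ℝ := fderiv ℝ (radialExt ψ)
  have hg : ∀ y, y ≠ 0 → ContDiffAt ℝ ∞ g y := fun y hy =>
    (contDiffAt_radialExt ψ.contMDiff hy).fderiv_right (by simp)
  -- The field is the gradient of the radial extension of ψ, cut off to an annulus. Integration by
  -- parts in ℝ³ then has no boundary terms and avoids the origin.
  let G : Fin 3 → E3 → ℝ := fun i y => g y (EuclideanSpace.single i 1) * cutoff y
  have hG0 : ∀ i, G i =ᶠ[𝓝 0] 0 := fun i => by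
    filter_upwards [cutoff_eventually_zero] with y hy
    simp [G, hy]
  have hG : ∀ i, ContDiff ℝ ∞ (G i) := fun i => by
    rw [contDiff_iff_contDiffAt]
    intro y
    rcases eq_or_ne y 0 with rfl | hy
    · exact (contDiffAt_const (c := (0 : ℝ))).congr_of_eventuallyEq (hG0 i)
    · exact ((hg y hy).clm_apply contDiffAt_const).mul contDiff_cutoff.contDiffAt
  have hGsupp : ∀ i, HasCompactSupport (G i) := fun i => hasCompactSupport_cutoff.mul_left
  let G' : Fin 3 → E3 → ℝ := fun i y => fderiv ℝ (G i) y (EuclideanSpace.single i 1)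
  have hG' : ∀ i, Continuous (G' i) := fun i =>
    ((hG i).continuous_fderiv (by simp)).clm_apply continuous_const
  have hG'supp : ∀ i, HasCompactSupport (G' i) := fun i =>
    (hGsupp i).fderiv_apply ℝ (EuclideanSpace.single i 1)
  have hG'0 : ∀ i, G' i =ᶠ[𝓝 0] 0 := fun i => by
    filter_upwards [(hG0 i).eventuallyEq_nhds] with y hy
    simp only [G', hy.fderiv_eq]
    simp
  have hG'i : ∀ i, Integrable (G' i) := fun i => (hG' i).integrable_of_hasCompactSupport (hG'supp i)
  obtain ⟨k, hk, hkpos⟩ := exists_pos_integral_cutoff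
  set c := ∫ r, k r ∂(Measure.volumeIoiPow 2) with hc
  let H : E3 → ℝ := fun y => ∑ i, G' i y
  have hH : Integrable H := integrable_finsetSum _ fun i _ => hG'i i
  have hHpolar := integrable_polar hH
  refine ⟨fun x => -(c⁻¹ * ∫ r : Ioi (0 : ℝ), H ((r : ℝ) • (x : E3)) ∂(Measure.volumeIoiPow 2)),
    (hHpolar.integral_prod_left.const_mul _).neg, fun f => ?_⟩
  have hfd : ∀ y, y ≠ 0 → ContDiffAt ℝ ∞ (radialExt f) y := fun y hy =>
    contDiffAt_radialExt f.contMDiff hy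
  have hfg' : ∀ i, Continuous fun y => radialExt f y * G' i y := fun i =>
    continuous_mul_of_eventually_zero (fun y hy => (hfd y hy).continuousAt) (hG' i) (hG'0 i)
  have hfg : ∀ i, Continuous fun y => radialExt f y * G i y := fun i =>
    continuous_mul_of_eventually_zero (fun y hy => (hfd y hy).continuousAt) (hG i).continuous (hG0 i)
  have hf'g : ∀ i, Continuous fun y =>
      fderiv ℝ (radialExt f) y (EuclideanSpace.single i 1) * G i y := fun i =>
    continuous_mul_of_eventually_zero (fun y hy =>
      (((hfd y hy).fderiv_right (m := 0) (by simp)).continuousAt).clm_apply continuousAt_const)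
      (hG i).continuous (hG0 i)
  have hi1 : ∀ i, Integrable fun y => radialExt f y * G' i y := fun i =>
    (hfg' i).integrable_of_hasCompactSupport (hG'supp i).mul_left
  have hi2 : ∀ i, Integrable fun y =>
      fderiv ℝ (radialExt f) y (EuclideanSpace.single i 1) * G i y := fun i =>
    (hf'g i).integrable_of_hasCompactSupport (hGsupp i).mul_left
  have hparts : ∀ i, ∫ y, radialExt f y * G' i y
      = -∫ y, fderiv ℝ (radialExt f) y (EuclideanSpace.single i 1) * G i y := fun i => by
    refine integral_mul_fderiv_eq_neg_fderiv_mul_of_integrable (hi2 i) (hi1 i)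
      ((hfg i).integrable_of_hasCompactSupport (hGsupp i).mul_left) (fun y hy => ?_)
      (fun y _ => (hG i).differentiable (by simp) y)
    have hy0 : y ≠ 0 := by
      rintro rfl
      exact notMem_tsupport_iff_eventuallyEq.2 (hG0 i) hy
    exact (hfd y hy0).differentiableAt (by simp)
  have hsum : ∫ y, radialExt f y * H y
      = -∫ y, cutoff y * ⟪gradient (radialExt f) y, gradient (radialExt ψ) y⟫_ℝ := by
    have h1 : ∀ y, cutoff y * ⟪gradient (radialExt f) y, gradient (radialExt ψ) y⟫_ℝ
        = ∑ i, fderiv ℝ (radialExt f) y (EuclideanSpace.single i 1) * G i y := fun y => by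
      have h2 : ∀ (u : E3 → ℝ) i, fderiv ℝ u y (EuclideanSpace.single i 1) = gradient u y i :=
        fun u i => by
          rw [← inner_gradient_left, EuclideanSpace.inner_single_right]; simp
      simp only [G, g, h2, inner_eq_sum, Fin.sum_univ_three]
      ring
    simp only [h1, H, Finset.mul_sum]
    rw [integral_finsetSum _ fun i _ => hi1 i, integral_finsetSum _ fun i _ => hi2 i,
      ← Finset.sum_neg_distrib]
    exact Finset.sum_congr rfl fun i _ => hparts i
  -- By homogeneity the integrand separates in polar coordinates into the Dirichlet integrand and a
  -- radial factor with integral `c`.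
  have hleft : ∫ y, cutoff y * ⟪gradient (radialExt f) y, gradient (radialExt ψ) y⟫_ℝ
      = dirichlet f ψ * c := by
    rw [integral_polar, dirichlet, hc, ← integral_prod_mul]
    refine integral_congr_ae (Eventually.of_forall fun q => ?_)
    have hr : 0 < (q.2 : ℝ) := q.2.2
    have h1 : ∀ u : SmoothFun, gradient (radialExt u) ((q.2 : ℝ) • (q.1 : E3))
        = (q.2 : ℝ)⁻¹ • sphGrad u q.1 := fun u => by
      rw [gradient, fderiv_radialExt_smul u.contMDiff_one hr, map_smulₛₗ, sphGrad, gradient]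
      simp
    simp only [h1, inner_smul_left, inner_smul_right, hk q.2 q.1, RCLike.conj_to_real]
    ring
  have hright : ∫ y, radialExt f y * H y
      = ∫ x, f x * ∫ r : Ioi (0 : ℝ), H ((r : ℝ) • (x : E3)) ∂(Measure.volumeIoiPow 2)
        ∂roundVolume := by
    have hint : Integrable fun y => radialExt f y * H y := by
      simp only [H, Finset.mul_sum]
      exact integrable_finsetSum _ fun i _ => hi1 i
    rw [integral_polar, integral_prod _ (integrable_polar hint)]
    refine integral_congr_ae (Eventually.of_forall fun x => ?_)
    simp only
    rw [← integral_const_mul]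
    refine integral_congr_ae (Eventually.of_forall fun r => ?_)
    simp only
    rw [radialExt_smul f r.2]
  rw [hright, hleft] at hsum
  have h2 : dirichlet f ψ = -(c⁻¹ * ∫ x, f x * ∫ r : Ioi (0 : ℝ), H ((r : ℝ) • (x : E3))
      ∂(Measure.volumeIoiPow 2) ∂roundVolume) := by
    rw [hsum]
    field_simp
  rw [h2, ← integral_const_mul, ← integral_neg]
  refine integral_congr_ae (Eventually.of_forall fun x => ?_)
  simp only
  ring

end Green

/-! ### Admissible measures have no atoms -/

section Atoms

open Set Filter Topology

instance : CompleteSpace W12 :=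
  inferInstanceAs (CompleteSpace (LinearMap.range sobolevGraph).topologicalClosure)

lemma inner_toL2 (μ : Measure S2) [IsFiniteMeasure μ] (f g : SmoothFun) :
    ⟪toL2 μ f, toL2 μ g⟫_ℝ = ∫ x, f x * g x ∂μ := by
  rw [L2.inner_def]
  refine integral_congr_ae ?_
  filter_upwards [(memLp_smoothFun μ f).coeFn_toLp, (memLp_smoothFun μ g).coeFn_toLp] with x hf hg
  change ⟪((memLp_smoothFun μ f).toLp f) x, ((memLp_smoothFun μ g).toLp g) x⟫_ℝ = _
  rw [hf, hg]
  simp [mul_comm]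

lemma inner_gradL2 (f g : SmoothFun) : ⟪gradL2 f, gradL2 g⟫_ℝ = dirichlet f g := by
  rw [L2.inner_def]
  refine integral_congr_ae ?_
  filter_upwards [(memLp_sphGrad roundVolume f).coeFn_toLp,
    (memLp_sphGrad roundVolume g).coeFn_toLp] with x hf hg
  change ⟪((memLp_sphGrad roundVolume f).toLp (sphGrad f)) x,
    ((memLp_sphGrad roundVolume g).toLp (sphGrad g)) x⟫_ℝ = _
  rw [hf, hg]

lemma inner_toW12 (f g : SmoothFun) :
    ⟪toW12 f, toW12 g⟫_ℝ = ∫ x, f x * g x ∂roundVolume + dirichlet f g := by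
  change ⟪sobolevGraph f, sobolevGraph g⟫_ℝ = _
  rw [WithLp.prod_inner_apply, ← inner_toL2, ← inner_gradL2]
  rfl

lemma dense_toW12 (v : W12) {ε : ℝ} (hε : 0 < ε) : ∃ f : SmoothFun, ‖v - toW12 f‖ < ε := by
  have hv : (v : WithLp 2 (Lp ℝ 2 roundVolume × Lp E3 2 roundVolume)) ∈
      closure (LinearMap.range sobolevGraph : Set _) := v.2
  obtain ⟨_, ⟨f, rfl⟩, hf⟩ := Metric.mem_closure_iff.1 hv ε hε
  refine ⟨f, ?_⟩
  rw [dist_eq_norm] at hf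
  exact hf

/-- A bounded sequence of smooth functions with bounded energy that tends to zero almost everywhere
tends to zero weakly in `W^{1,2}`. -/
lemma tendsto_inner_toW12 {f : ℕ → SmoothFun} {C K : ℝ} (hC : ∀ n x, |f n x| ≤ C)
    (hK : ∀ n, dirichlet (f n) (f n) ≤ K)
    (hlim : ∀ᵐ x ∂roundVolume, Tendsto (fun n => f n x) atTop (𝓝 0)) (v : W12) :
    Tendsto (fun n => ⟪v, toW12 (f n)⟫_ℝ) atTop (𝓝 0) := by
  have hC0 : 0 ≤ C := (abs_nonneg _).trans (hC 0 (hemisphereParam 0))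
  -- Against a smooth ψ, Green's formula removes the derivatives from `f n`, and dominated
  -- convergence applies. Boundedness in the Sobolev norm then extends the limit to all v by
  -- density.
  have hsm : ∀ ψ : SmoothFun, Tendsto (fun n => ⟪toW12 ψ, toW12 (f n)⟫_ℝ) atTop (𝓝 0) := by
    intro ψ
    obtain ⟨h, hh, hgreen⟩ := exists_green ψ
    have hψ : Integrable ψ roundVolume := integrable_of_continuous _ ψ.contMDiff.continuous
    have h1 : ∀ n, ⟪toW12 ψ, toW12 (f n)⟫_ℝ = ∫ x, f n x * (ψ x + h x) ∂roundVolume := fun n => by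
      have hfn : AEStronglyMeasurable (f n) roundVolume :=
        (f n).contMDiff.continuous.aestronglyMeasurable
      have i1 : Integrable (fun x => f n x * ψ x) roundVolume :=
        hψ.bdd_mul hfn (Eventually.of_forall (hC n))
      have i2 : Integrable (fun x => f n x * h x) roundVolume :=
        hh.bdd_mul hfn (Eventually.of_forall (hC n))
      rw [real_inner_comm, inner_toW12, hgreen, ← integral_add i1 i2]
      simp only [mul_add]
    simp only [h1]
    have h0 : ∫ x, (0 : ℝ) * (ψ x + h x) ∂roundVolume = 0 := by simp
    rw [← h0]
    refine tendsto_integral_of_dominated_convergence (fun x => C * ‖ψ x + h x‖) (fun n => ?_)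
      ((hψ.add hh).norm.const_mul C) (fun n => Eventually.of_forall fun x => ?_) ?_
    · exact (f n).contMDiff.continuous.aestronglyMeasurable.mul (hψ.add hh).aestronglyMeasurable
    · rw [norm_mul]
      exact mul_le_mul_of_nonneg_right (hC n x) (norm_nonneg _)
    · filter_upwards [hlim] with x hx using hx.mul_const _
  have hbd : ∀ n, ‖toW12 (f n)‖ ≤ √(C ^ 2 * (4 * Real.pi) + K) := by
    intro n
    refine Real.le_sqrt_of_sq_le ?_
    rw [← real_inner_self_eq_norm_sq, inner_toW12]
    refine add_le_add ?_ (hK n)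
    have hi : Integrable (fun x => f n x * f n x) roundVolume :=
      integrable_of_continuous _ ((f n).contMDiff.continuous.mul (f n).contMDiff.continuous)
    calc ∫ x, f n x * f n x ∂roundVolume ≤ ∫ _, C ^ 2 ∂roundVolume := by
          refine integral_mono hi (integrable_const _) fun x => ?_
          simp only
          rw [← abs_mul_abs_self, sq]
          exact mul_self_le_mul_self (abs_nonneg _) (hC n x)
      _ = C ^ 2 * (4 * Real.pi) := by
          rw [integral_const, roundVolume_real_univ, smul_eq_mul, mul_comm]
  set B := √(C ^ 2 * (4 * Real.pi) + K)
  have hB : 0 ≤ B := Real.sqrt_nonneg _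
  rw [Metric.tendsto_atTop]
  intro ε hε
  obtain ⟨ψ, hψ⟩ := dense_toW12 v (ε := ε / (2 * (B + 1))) (by positivity)
  obtain ⟨N, hN⟩ := Metric.tendsto_atTop.1 (hsm ψ) (ε / 2) (by positivity)
  refine ⟨N, fun n hn => ?_⟩
  have h1 := hN n hn
  rw [dist_zero_right] at h1 ⊢
  have h2 : ⟪v, toW12 (f n)⟫_ℝ = ⟪v - toW12 ψ, toW12 (f n)⟫_ℝ + ⟪toW12 ψ, toW12 (f n)⟫_ℝ := by
    rw [inner_sub_left]; ring
  have h3 : ‖⟪v - toW12 ψ, toW12 (f n)⟫_ℝ‖ ≤ ε / (2 * (B + 1)) * B :=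
    (norm_inner_le_norm _ _).trans (mul_le_mul hψ.le (hbd n) (norm_nonneg _) (by positivity))
  have h4 : ε / (2 * (B + 1)) * B ≤ ε / 2 := by
    rw [div_mul_eq_mul_div, div_le_div_iff₀ (by positivity) (by positivity)]
    nlinarith
  rw [h2]
  refine (norm_add_le _ _).trans_lt ?_
  linarith

lemma mob_neg_unit {p : E3} (hp : ‖p‖ = 1) {s : ℝ} (hs : s ≠ 1) : mob (s • p) (-p) = -p := by
  have h1 : -p + s • p = (s - 1) • p := by rw [sub_smul, one_smul]; abel
  have h2 : (s - 1) ≠ 0 := sub_ne_zero.2 hs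
  rw [mob, h1, norm_smul, norm_smul, hp, mul_one, mul_one, Real.norm_eq_abs, Real.norm_eq_abs, sq_abs,
    sq_abs, smul_smul, ← add_smul]
  have h3 : s + (1 - s ^ 2) / (s - 1) ^ 2 * (s - 1) = -1 := by
    field_simp
    ring
  rw [h3, neg_one_smul]

/-- In two dimensions the Dirichlet energy is conformally invariant, so composing one function with
Möbius maps that concentrate at q gives bounded functions of constant energy, equal to 1 at q and
tending to 0 elsewhere. They tend weakly to 0 in the Sobolev space, so continuity of the embedding
sends their μ-integrals to 0; by dominated convergence those integrals tend to μ{q}. -/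
theorem Admissible.measure_singleton {μ : Measure S2} [IsFiniteMeasure μ] (hμ : Admissible μ) (q : S2) :
    μ {q} = 0 := by
  obtain ⟨T, -, hT⟩ := hμ
  set p : E3 := -(q : E3) with hp
  have hp1 : ‖p‖ = 1 := by simp [hp]
  let l : SmoothFun := SmoothFun.ofRestrict (fun y => (1 - ⟪p, y⟫_ℝ) / 2) fun x =>
    (contDiffAt_const.sub (contDiffAt_const.inner ℝ contDiffAt_id)).div_const 2
  have hl : ∀ x : S2, l x = (1 - ⟪p, (x : E3)⟫_ℝ) / 2 := fun _ => rfl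
  have hl1 : ∀ x, |l x| ≤ 1 := fun x => by
    have := abs_le.1 (abs_real_inner_le_norm p (x : E3))
    rw [hp1, norm_eq_of_mem_sphere] at this
    rw [hl, abs_le]
    constructor <;> linarith [this.1, this.2]
  let s : ℕ → ℝ := fun n => 1 - 1 / ((n : ℝ) + 2)
  have hs0 : ∀ n : ℕ, 0 < 1 / ((n : ℝ) + 2) ∧ 1 / ((n : ℝ) + 2) ≤ 1 := fun n =>
    ⟨by positivity, by rw [div_le_one (by positivity)]; linarith [Nat.cast_nonneg (α := ℝ) n]⟩
  have hslim : Tendsto s atTop (𝓝 1) := by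
    have h1 : Tendsto (fun n : ℕ => 1 - 1 / ((n : ℝ) + 2)) atTop (𝓝 (1 - 0)) := by
      refine tendsto_const_nhds.sub (tendsto_const_nhds.div_atTop ?_)
      exact tendsto_atTop_add_const_right _ _ tendsto_natCast_atTop_atTop
    rw [sub_zero] at h1
    exact h1
  have hw : ∀ n, ‖s n • p‖ < 1 := fun n => by
    rw [norm_smul, hp1, mul_one, Real.norm_eq_abs, abs_lt]
    simp only [s]
    constructor <;> linarith [(hs0 n).1, (hs0 n).2]
  let f : ℕ → SmoothFun := fun n => l.compMap (mobS (s n • p) (hw n)) (contMDiff_mobS (hw n))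
  have hfq : ∀ n, f n q = 1 := fun n => by
    have h1 : (mobS (s n • p) (hw n) q : E3) = -p := by
      have hsn : s n ≠ 1 := by simp only [s]; linarith [(hs0 n).1]
      rw [coe_mobS, show (q : E3) = -p by simp [hp], mob_neg_unit hp1 hsn]
    change l (mobS (s n • p) (hw n) q) = 1
    rw [hl, h1, inner_neg_right, real_inner_self_eq_norm_sq, hp1]
    norm_num
  have hfx : ∀ x, x ≠ q → Tendsto (fun n => f n x) atTop (𝓝 0) := fun x hx => by
    have hne : (x : E3) + p ≠ 0 := fun h => hx (Subtype.ext (by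
      rw [add_eq_zero_iff_eq_neg.1 h, hp, neg_neg]))
    have h1 : Tendsto (fun n => mob (s n • p) x) atTop (𝓝 (mob p x)) := by
      refine (continuousAt_mob hne).tendsto.comp (Tendsto.prodMk_nhds ?_ tendsto_const_nhds)
      simpa using hslim.smul_const p
    rw [mob_of_norm_eq_one hp1] at h1
    have h2 : Tendsto (fun n => (1 - ⟪p, mob (s n • p) x⟫_ℝ) / 2) atTop (𝓝 ((1 - ⟪p, p⟫_ℝ) / 2)) :=
      ((tendsto_const_nhds.sub (tendsto_const_nhds.inner (𝕜 := ℝ) h1)).div_const 2)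
    rw [real_inner_self_eq_norm_sq, hp1, one_pow, sub_self, zero_div] at h2
    exact h2
  have hae : ∀ᵐ x ∂roundVolume, x ≠ q := by
    rw [ae_iff]; simp
  have hweak := tendsto_inner_toW12 (f := f) (C := 1) (K := dirichlet l l) (fun n x => hl1 _)
    (fun n => (dirichlet_comp_mobS (hw n) l l).le) (by filter_upwards [hae] with x hx using hfx x hx)
  let one : SmoothFun := SmoothFun.ofRestrict (fun _ => 1) fun _ => contDiffAt_const
  let φ : W12 →L[ℝ] ℝ := (innerSL ℝ (toL2 μ one)).comp T
  have hφ : ∀ n, φ (toW12 (f n)) = ∫ x, f n x ∂μ := fun n => by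
    change ⟪toL2 μ one, T (toW12 (f n))⟫_ℝ = _
    rw [hT, inner_toL2]
    refine integral_congr_ae (Eventually.of_forall fun x => ?_)
    change (1 : ℝ) * f n x = f n x
    rw [one_mul]
  have hlim1 : Tendsto (fun n => ∫ x, f n x ∂μ) atTop (𝓝 0) := by
    refine (hweak ((InnerProductSpace.toDual ℝ W12).symm φ)).congr fun n => ?_
    rw [InnerProductSpace.toDual_symm_apply, hφ]
  have hlim2 : Tendsto (fun n => ∫ x, f n x ∂μ) atTop (𝓝 (∫ x, ({q} : Set S2).indicator 1 x ∂μ)) := by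
    refine tendsto_integral_of_dominated_convergence (fun _ => 1)
      (fun n => (f n).contMDiff.continuous.aestronglyMeasurable) (integrable_const _)
      (fun n => Eventually.of_forall fun x => hl1 _) (Eventually.of_forall fun x => ?_)
    by_cases hx : x = q
    · subst hx
      simp only [hfq]
      simp
    · simpa [hx] using hfx x hx
  have h1 := tendsto_nhds_unique hlim1 hlim2
  rw [integral_indicator_one (measurableSet_singleton q)] at h1
  exact (measureReal_eq_zero_iff).1 h1.symm

end Atoms

/-! ### Folding the sphere along a circle -/

section Fold

open Set Filter Topology

/-- The reflection of the half-space `⟪p, y⟫ < 0` onto `⟪p, y⟫ > 0`. -/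
def hfold (p y : E3) : E3 := y + (|⟪p, y⟫_ℝ| - ⟪p, y⟫_ℝ) • p

lemma continuous_hfold : Continuous fun q : E3 × E3 => hfold q.1 q.2 := by
  unfold hfold; fun_prop

lemma tendsto_hfold {p y : ℕ → E3} {p₀ y₀ : E3} (hp : Tendsto p atTop (𝓝 p₀))
    (hy : Tendsto y atTop (𝓝 y₀)) : Tendsto (fun n => hfold (p n) (y n)) atTop (𝓝 (hfold p₀ y₀)) :=
  (continuous_hfold.tendsto (p₀, y₀)).comp (hp.prodMk_nhds hy)

lemma tendsto_mob {w y : ℕ → E3} {w₀ y₀ : E3} (hw : Tendsto w atTop (𝓝 w₀))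
    (hy : Tendsto y atTop (𝓝 y₀)) (h : y₀ + w₀ ≠ 0) :
    Tendsto (fun n => mob (w n) (y n)) atTop (𝓝 (mob w₀ y₀)) :=
  (continuousAt_mob h).tendsto.comp (hw.prodMk_nhds hy)

lemma hfold_of_nonneg {p y : E3} (h : 0 ≤ ⟪p, y⟫_ℝ) : hfold p y = y := by
  simp [hfold, abs_of_nonneg h]

lemma hfold_of_nonpos {p y : E3} (hp : ‖p‖ = 1) (h : ⟪p, y⟫_ℝ ≤ 0) : hfold p y = refl p y := by
  rw [hfold, abs_of_nonpos h, refl_apply hp, sub_eq_add_neg y, ← neg_smul]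
  ring_nf

lemma norm_hfold {p : E3} (hp : ‖p‖ = 1) (y : E3) : ‖hfold p y‖ = ‖y‖ := by
  rcases le_total 0 ⟪p, y⟫_ℝ with h | h
  · rw [hfold_of_nonneg h]
  · rw [hfold_of_nonpos hp h, LinearIsometryEquiv.norm_map]

lemma hfold_neg {p : E3} (hp : ‖p‖ = 1) (y : E3) : hfold (-p) y = refl p (hfold p y) := by
  rw [refl_apply hp]
  simp only [hfold, inner_neg_left, abs_neg, inner_add_right, inner_smul_right,
    real_inner_self_eq_norm_sq, hp]
  module

lemma dirS_of_norm {y : E3} (hy : ‖y‖ = 1) : (dirS y : E3) = y := by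
  rw [coe_dirS (norm_ne_zero_iff.1 (by rw [hy]; exact one_ne_zero)), hy, inv_one, one_smul]

/-- The folding of the sphere along the circle `(1 + s ^ 2) ⟪p, x⟫ + 2 * s = 0`. -/
def fold (p : S2) (s : ℝ) (x : S2) : S2 :=
  if s = 1 then x else dirS (mob (-(s • (p : E3))) (hfold p (mob (s • (p : E3)) x)))

lemma fold_one (p : S2) : fold p 1 = id := by
  funext x; simp [fold]

lemma norm_smul_lt_one (p : S2) {s : ℝ} (hs0 : 0 ≤ s) (hs : s < 1) : ‖s • (p : E3)‖ < 1 := by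
  rw [norm_smul, norm_eq_of_mem_sphere, mul_one, Real.norm_eq_abs, abs_of_nonneg hs0]
  exact hs

lemma coe_fold (p : S2) {s : ℝ} (hs0 : 0 ≤ s) (hs : s < 1) (x : S2) :
    (fold p s x : E3) = mob (-(s • (p : E3))) (hfold p (mob (s • (p : E3)) x)) := by
  rw [fold, if_neg hs.ne]
  refine dirS_of_norm (norm_mob (by rw [norm_neg]; exact norm_smul_lt_one p hs0 hs) ?_)
  rw [norm_hfold (by simp), norm_mob (norm_smul_lt_one p hs0 hs) (by simp)]

lemma measurable_fold (p : S2) (s : ℝ) : Measurable (fold p s) := by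
  by_cases hs : s = 1
  · rw [hs, fold_one]; exact measurable_id
  · have h : fold p s = fun x : S2 => dirS (mob (-(s • (p : E3))) (hfold p (mob (s • (p : E3)) x))) := by
      funext x; rw [fold, if_neg hs]
    rw [h]
    have h1 : Measurable (hfold p) :=
      (continuous_hfold.comp (continuous_const.prodMk continuous_id)).measurable
    exact measurable_dirS.comp ((measurable_mob _).comp (h1.comp
      ((measurable_mob _).comp measurable_subtype_coe)))

/-- For s = 0 the circle is the same for p and −p and only the retained hemisphere changes. This is
the symmetry at the start of the homotopy. -/
lemma fold_neg_zero (p x : S2) : fold (-p) 0 x = reflS p (fold p 0 x) := by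
  have hx : mob 0 (x : E3) = x := mob_zero (by simp)
  have h1 : ‖hfold (p : E3) x‖ = 1 := by rw [norm_hfold (by simp)]; simp
  have h2 : ‖hfold (-(p : E3)) x‖ = 1 := by rw [norm_hfold (by simp)]; simp
  ext1
  rw [coe_reflS, coe_fold _ le_rfl one_pos, coe_fold _ le_rfl one_pos]
  simp only [zero_smul, neg_zero, hx, mob_zero h1]
  rw [show ((-p : S2) : E3) = -(p : E3) from rfl, mob_zero h2, hfold_neg (by simp)]

lemma fold_eq_imp (p : S2) {s : ℝ} (hs0 : 0 ≤ s) (hs : s < 1) {x z : S2} (h : fold p s x = z) :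
    x = z ∨ (x : E3) = mob (-(s • (p : E3))) (refl p (mob (s • (p : E3)) z)) := by
  have hw := norm_smul_lt_one p hs0 hs
  have hx : ‖(x : E3)‖ = 1 := by simp
  have hp : ‖(p : E3)‖ = 1 := by simp
  have h1 : hfold p (mob (s • (p : E3)) x) = mob (s • (p : E3)) z := by
    rw [← h, coe_fold p hs0 hs, mob_mob_neg hw]
    rw [norm_hfold hp, norm_mob hw hx]
  rcases le_total 0 ⟪(p : E3), mob (s • (p : E3)) x⟫_ℝ with h2 | h2
  · left
    rw [hfold_of_nonneg h2] at h1
    have := congrArg (mob (-(s • (p : E3)))) h1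
    rw [mob_neg_mob hw hx, mob_neg_mob hw (by simp)] at this
    exact Subtype.ext this
  · right
    rw [hfold_of_nonpos hp h2] at h1
    rw [← h1, Submodule.reflection_reflection, mob_neg_mob hw hx]

/-- Fibers of a fold have at most two points, so folding creates no atoms. -/
lemma nullSingletonClass_map_fold (m : Measure S2) [NullSingletonClass m] (p : S2) {s : ℝ} (hs0 : 0 ≤ s)
    (hs : s ≤ 1) : NullSingletonClass (m.map (fold p s)) where
  measure_singleton z := by
    rcases hs.eq_or_lt with rfl | hs
    · rw [fold_one, Measure.map_id]; exact measure_singleton z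
    · rw [Measure.map_apply (measurable_fold p s) (measurableSet_singleton z)]
      have h : fold p s ⁻¹' {z} ⊆
          {z, dirS (mob (-(s • (p : E3))) (refl p (mob (s • (p : E3)) z)))} := fun x hx => by
        rcases fold_eq_imp p hs0 hs hx with h | h
        · exact Or.inl h
        · right
          have hx1 : ‖(x : E3)‖ = 1 := by simp
          rw [mem_singleton_iff]
          refine Subtype.ext ?_
          rw [← h, dirS_of_norm hx1]
      exact measure_mono_null h ((Set.toFinite _).measure_zero m)

lemma inner_mob_smul {p x : E3} (hp : ‖p‖ = 1) (hx : ‖x‖ = 1) {s : ℝ} (hs : |s| < 1) :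
    ⟪p, mob (s • p) x⟫_ℝ = ((1 + s ^ 2) * ⟪p, x⟫_ℝ + 2 * s) / ‖x + s • p‖ ^ 2 := by
  have hw : ‖s • p‖ < 1 := by rwa [norm_smul, hp, mul_one]
  have h := (norm_add_sq_pos hw hx).ne'
  have h1 : ‖x + s • p‖ ^ 2 = 1 + 2 * s * ⟪p, x⟫_ℝ + s ^ 2 := by
    rw [norm_add_sq_of_norm hx, inner_smul_right, real_inner_comm, norm_smul, hp, mul_one,
      Real.norm_eq_abs, sq_abs]
    ring
  have h2 : ⟪p, mob (s • p) x⟫_ℝ = s + (1 - s ^ 2) / ‖x + s • p‖ ^ 2 * (⟪p, x⟫_ℝ + s) := by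
    rw [mob, norm_smul, hp, mul_one, Real.norm_eq_abs, sq_abs, inner_add_right,
      inner_smul_right, inner_smul_right, inner_add_right, inner_smul_right,
      real_inner_self_eq_norm_sq, hp, one_pow, mul_one]
  rw [h2, eq_div_iff h, add_mul, mul_right_comm _ _ (‖x + s • p‖ ^ 2), div_mul_cancel₀ _ h, h1]
  ring

lemma fold_of_nonneg (p : S2) {s : ℝ} (hs0 : 0 ≤ s) (hs : s ≤ 1) {x : S2}
    (h : 0 ≤ (1 + s ^ 2) * ⟪(p : E3), x⟫_ℝ + 2 * s) : fold p s x = x := by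
  rcases hs.eq_or_lt with rfl | hs
  · rw [fold_one]; rfl
  · ext1
    rw [coe_fold p hs0 hs, hfold_of_nonneg, mob_neg_mob (norm_smul_lt_one p hs0 hs) (by simp)]
    rw [inner_mob_smul (by simp) (by simp) (by rwa [abs_of_nonneg hs0])]
    positivity

/-- The only delicate case is s₀ = 1: the circle shrinks to −p₀, and any other point eventually lies
on the side that is left fixed. -/
lemma tendsto_fold {p : ℕ → S2} {s : ℕ → ℝ} {p₀ x : S2} {s₀ : ℝ} (hp : Tendsto p atTop (𝓝 p₀))
    (hs : Tendsto s atTop (𝓝 s₀)) (h : ∀ n, s n ∈ Icc (0 : ℝ) 1) (h₀ : s₀ ∈ Icc (0 : ℝ) 1)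
    (hx : x ≠ -p₀) : Tendsto (fun n => fold (p n) (s n) x) atTop (𝓝 (fold p₀ s₀ x)) := by
  have hpc : Tendsto (fun n => (p n : E3)) atTop (𝓝 (p₀ : E3)) :=
    (continuous_subtype_val.tendsto p₀).comp hp
  rcases h₀.2.eq_or_lt with h1 | h1
  · have hlim : Tendsto (fun n => (1 + s n ^ 2) * ⟪(p n : E3), (x : E3)⟫_ℝ + 2 * s n) atTop
        (𝓝 ((1 + s₀ ^ 2) * ⟪(p₀ : E3), (x : E3)⟫_ℝ + 2 * s₀)) :=
      (((hs.pow 2).const_add 1).mul (hpc.inner tendsto_const_nhds)).add (hs.const_mul 2)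
    have hpos : 0 < (1 + s₀ ^ 2) * ⟪(p₀ : E3), (x : E3)⟫_ℝ + 2 * s₀ := by
      have h2 : (p₀ : E3) + x ≠ 0 := fun h => hx (Subtype.ext (by
        rw [show ((-p₀ : S2) : E3) = -(p₀ : E3) from rfl]; exact eq_neg_of_add_eq_zero_right h))
      have h3 := norm_add_sq_real (p₀ : E3) (x : E3)
      rw [norm_eq_of_mem_sphere, norm_eq_of_mem_sphere] at h3
      have h4 : 0 < ‖(p₀ : E3) + x‖ ^ 2 := pow_pos (norm_pos_iff.2 h2) 2
      rw [h1]
      linarith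
    rw [fold_of_nonneg p₀ h₀.1 h₀.2 hpos.le]
    refine tendsto_const_nhds.congr' ?_
    filter_upwards [hlim.eventually (lt_mem_nhds hpos)] with n hn
    rw [fold_of_nonneg (p n) (h n).1 (h n).2 hn.le]
  · rw [tendsto_subtype_rng, coe_fold p₀ h₀.1 h1]
    have hw := norm_smul_lt_one p₀ h₀.1 h1
    have hsp : Tendsto (fun n => s n • (p n : E3)) atTop (𝓝 (s₀ • (p₀ : E3))) := hs.smul hpc
    have e1 : Tendsto (fun n => mob (s n • (p n : E3)) x) atTop (𝓝 (mob (s₀ • (p₀ : E3)) x)) :=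
      (continuousAt_mob (add_ne_zero_of_norm hw (by simp))).tendsto.comp
        (hsp.prodMk_nhds tendsto_const_nhds)
    have e2 : Tendsto (fun n => hfold (p n) (mob (s n • (p n : E3)) x)) atTop
        (𝓝 (hfold p₀ (mob (s₀ • (p₀ : E3)) x))) :=
      tendsto_hfold hpc e1
    have e3 : Tendsto (fun n => mob (-(s n • (p n : E3))) (hfold (p n) (mob (s n • (p n : E3)) x)))
        atTop (𝓝 (mob (-(s₀ • (p₀ : E3))) (hfold p₀ (mob (s₀ • (p₀ : E3)) x)))) := by
      refine tendsto_mob hsp.neg e2 ?_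
      refine add_ne_zero_of_norm (by rwa [norm_neg]) ?_
      rw [norm_hfold (by simp), norm_mob hw (by simp)]
    refine e3.congr' ?_
    filter_upwards [hs.eventually (gt_mem_nhds h1)] with n hn
    rw [coe_fold (p n) (h n).1 hn]

/-- The integrand of a weighted centre of mass depends continuously on the parameters. -/
lemma tendsto_integral_smul_mob {m : Measure S2} {g : S2 → ℝ} (hg : Integrable g m)
    {w : ℕ → E3} {w₀ : E3} {G : ℕ → S2 → S2} {G₀ : S2 → S2} (hG : ∀ n, Measurable (G n))
    (hw : ∀ n, ‖w n‖ < 1) (hw₀ : ‖w₀‖ < 1) (hlim : Tendsto w atTop (𝓝 w₀))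
    (hGlim : ∀ᵐ x ∂m, Tendsto (fun n => G n x) atTop (𝓝 (G₀ x))) :
    Tendsto (fun n => ∫ x, g x • mob (w n) (G n x) ∂m) atTop (𝓝 (∫ x, g x • mob w₀ (G₀ x) ∂m)) := by
  refine tendsto_integral_of_dominated_convergence (fun x => ‖g x‖) (fun n => ?_) hg.norm
    (fun n => Eventually.of_forall fun x => ?_) ?_
  · exact hg.aestronglyMeasurable.smul ((measurable_mob _).comp
      (measurable_subtype_coe.comp (hG n))).aestronglyMeasurable
  · rw [norm_smul]
    exact mul_le_of_le_one_right (norm_nonneg _) (norm_mob_coe_le (hw n).le _)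
  · filter_upwards [hGlim] with x hx
    refine tendsto_const_nhds.smul ((continuousAt_mob
      (add_ne_zero_of_norm hw₀ (by simp))).tendsto.comp (hlim.prodMk_nhds ?_))
    exact (continuous_subtype_val.tendsto _).comp hx

lemma bary_map (m : Measure S2) {G : S2 → S2} (hG : Measurable G) (w : E3) :
    bary (m.map G) w = ∫ x, mob w (G x) ∂m :=
  integral_map hG.aemeasurable
    ((measurable_mob w).comp measurable_subtype_coe).aestronglyMeasurable

lemma ae_ne_neg (m : Measure S2) [NullSingletonClass m] (q : S2) : ∀ᵐ x ∂m, x ≠ q := by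
  rw [ae_iff]; simp

lemma integral_refl (m : Measure S2) (p : E3) (F : S2 → E3) :
    ∫ x, refl p (F x) ∂m = refl p (∫ x, F x ∂m) :=
  (refl p).toContinuousLinearEquiv.integral_comp_comm F

lemma map_fold_ne_zero {μ : Measure S2} (hμ : μ ≠ 0) (p : S2) (s : ℝ) : μ.map (fold p s) ≠ 0 := by
  rwa [Ne, Measure.map_eq_zero_iff (measurable_fold p s).aemeasurable]

/-! ### Balanced folds -/

section Balanced

variable {μ : Measure S2} [IsFiniteMeasure μ] [NullSingletonClass μ]

lemma exists_foldCenter (hμ : μ ≠ 0) (q : S2 × unitInterval) :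
    ∃ w : E3, ‖w‖ < 1 ∧ ∫ x, mob w (fold q.1 q.2 x) ∂μ = 0 := by
  have := nullSingletonClass_map_fold μ q.1 q.2.2.1 q.2.2.2
  obtain ⟨w, hw, h⟩ := exists_bary_eq_zero (map_fold_ne_zero hμ q.1 q.2)
  exact ⟨w, hw, by rwa [bary_map μ (measurable_fold _ _)] at h⟩

lemma foldCenter_unique (hμ : μ ≠ 0) (q : S2 × unitInterval) {w z : E3} (hw : ‖w‖ < 1) (hz : ‖z‖ < 1)
    (h1 : ∫ x, mob w (fold q.1 q.2 x) ∂μ = 0) (h2 : ∫ x, mob z (fold q.1 q.2 x) ∂μ = 0) : z = w := by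
  have := nullSingletonClass_map_fold μ q.1 q.2.2.1 q.2.2.2
  rw [← bary_map μ (measurable_fold _ _)] at h1 h2
  exact bary_zero_unique (map_fold_ne_zero hμ q.1 q.2) hw hz h1 h2

lemma ae_tendsto_fold (m : Measure S2) [NullSingletonClass m] {q : ℕ → S2 × unitInterval}
    {q₀ : S2 × unitInterval} (hq : Tendsto q atTop (𝓝 q₀)) :
    ∀ᵐ x ∂m, Tendsto (fun n => fold (q n).1 (q n).2 x) atTop (𝓝 (fold q₀.1 q₀.2 x)) := by
  filter_upwards [ae_ne_neg m (-q₀.1)] with x hx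
  exact tendsto_fold ((continuous_fst.tendsto q₀).comp hq)
    (((continuous_subtype_val.comp continuous_snd).tendsto q₀).comp hq) (fun n => (q n).2.2) q₀.2.2 hx

/-- Compactness and uniqueness. A limit of centers cannot lie on the unit sphere, where the center
of mass would be μ(S²)w ≠ 0, so it is the unique center of the limit fold. -/
lemma continuous_foldCenter (hμ : μ ≠ 0) {W : S2 × unitInterval → E3} (hW : ∀ q, ‖W q‖ < 1)
    (h0 : ∀ q, ∫ x, mob (W q) (fold q.1 q.2 x) ∂μ = 0) : Continuous W := by
  rw [continuous_iff_continuousAt]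
  intro q₀
  rw [ContinuousAt, tendsto_iff_seq_tendsto]
  intro q hq
  refine tendsto_of_subseq_tendsto fun ns hns => ?_
  obtain ⟨w, hw, ms, hms, hlim⟩ := (isCompact_closedBall (0 : E3) 1).tendsto_subseq
    (x := fun n => W (q (ns n))) fun n => by simpa using (hW _).le
  refine ⟨ms, ?_⟩
  have hq' : Tendsto (fun n => q (ns (ms n))) atTop (𝓝 q₀) :=
    hq.comp (hns.comp hms.tendsto_atTop)
  have hnull := nullSingletonClass_map_fold μ q₀.1 q₀.2.2.1 q₀.2.2.2
  have hae : ∀ᵐ x ∂μ, (fold q₀.1 q₀.2 x : E3) + w ≠ 0 :=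
    ae_of_ae_map (measurable_fold _ _).aemeasurable (ae_coe_add_ne_zero _ w)
  have h1 := tendsto_integral_mob (μ := μ) (fun n => measurable_fold (q (ns (ms n))).1 (q (ns (ms n))).2)
    (fun n => hW (q (ns (ms n)))) hlim ((ae_tendsto_fold μ hq').and hae)
  simp only [h0] at h1
  have h2 := tendsto_nhds_unique h1 tendsto_const_nhds
  have hw1 : ‖w‖ < 1 := by
    have hle : ‖w‖ ≤ 1 := by simpa using hw
    refine lt_of_le_of_ne hle fun h => ?_
    simp only [mob_of_norm_eq_one h, integral_const] at h2
    rcases smul_eq_zero.1 h2 with h3 | h3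
    · rw [measureReal_eq_zero_iff] at h3
      exact hμ (Measure.measure_univ_eq_zero.1 h3)
    · rw [h3, norm_zero] at h; exact zero_ne_one h
  have h3 : w = W q₀ := foldCenter_unique hμ q₀ (hW q₀) hw1 (h0 q₀) h2
  rw [← h3]
  exact hlim

/-- Each fold has a unique balancing parameter, so the difference of the two weighted moments is a
continuous field on S² × [0,1]. Uniqueness carries the symmetries of the folds over to it: it is
independent of p at s = 1 and reflected under p ↦ −p at s = 0. The topological obstruction supplies
a zero. -/
theorem exists_balanced_fold (hμ : μ ≠ 0) {h ψ : S2 → ℝ} (hh : Integrable h roundVolume)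
    (hψ : Integrable ψ μ) : ∃ (p : S2) (s : ℝ) (w : E3), 0 ≤ s ∧ s ≤ 1 ∧ ‖w‖ < 1 ∧
      ∫ x, mob w (fold p s x) ∂μ = 0 ∧
      ∫ x, h x • mob w (fold p s x) ∂roundVolume = ∫ x, ψ x • mob w (fold p s x) ∂μ := by
  choose W hW h0 using exists_foldCenter hμ
  have hWc := continuous_foldCenter hμ hW h0
  let V : S2 × unitInterval → E3 := fun q =>
    ∫ x, h x • mob (W q) (fold q.1 q.2 x) ∂roundVolume - ∫ x, ψ x • mob (W q) (fold q.1 q.2 x) ∂μ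
  have hV : Continuous V := by
    rw [continuous_iff_seqContinuous]
    intro q q₀ hq
    have hw : Tendsto (fun n => W (q n)) atTop (𝓝 (W q₀)) := (hWc.tendsto q₀).comp hq
    exact (tendsto_integral_smul_mob hh (fun n => measurable_fold _ _) (fun n => hW _) (hW _) hw
      (ae_tendsto_fold _ hq)).sub (tendsto_integral_smul_mob hψ (fun n => measurable_fold _ _)
      (fun n => hW _) (hW _) hw (ae_tendsto_fold _ hq))
  have h1 : ∀ p q, V (p, 1) = V (q, 1) := by
    intro p q
    have hpq : W (p, 1) = W (q, 1) := by
      refine foldCenter_unique hμ (q, 1) (hW _) (hW _) (h0 _) ?_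
      have := h0 (p, 1)
      simp only [Set.Icc.coe_one, fold_one] at this ⊢
      exact this
    simp only [V, hpq, Set.Icc.coe_one, fold_one]
  have h2 : ∀ p : S2, V (-p, 0) = refl p (V (p, 0)) := by
    intro p
    have hmob : ∀ x, mob (refl p (W (p, 0))) (fold (-p) 0 x) = refl p (mob (W (p, 0)) (fold p 0 x)) :=
      fun x => by rw [fold_neg_zero, coe_reflS, map_mob]
    have hp : W (-p, 0) = refl p (W (p, 0)) := by
      refine foldCenter_unique hμ (-p, 0) ?_ (hW _) ?_ (h0 _)
      · rw [LinearIsometryEquiv.norm_map]; exact hW _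
      · have := h0 (p, 0)
        simp only [Set.Icc.coe_zero] at this ⊢
        simp only [hmob]
        rw [integral_refl, this, map_zero]
    simp only [V, Set.Icc.coe_zero, hp, hmob, map_sub]
    rw [← integral_refl, ← integral_refl]
    simp only [map_smul]
  obtain ⟨q, hq⟩ := exists_eq_zero_of_homotopy hV h1 h2
  exact ⟨q.1, q.2, W q, q.2.2.1, q.2.2.2, hW q, h0 q, sub_eq_zero.1 hq⟩

end Balanced

end Fold

/-! ### The quadratic form and its negative directions -/

section Spectral

open Set Filter Topology

lemma sq_le_mul_of_quadratic {a b c : ℝ} (h : ∀ t : ℝ, 0 ≤ a + 2 * t * b + t ^ 2 * c) : b ^ 2 ≤ a * c := by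
  have := discrim_le_zero (a := c) (b := 2 * b) (c := a) fun t => by
    have := h t
    nlinarith
  rw [discrim] at this
  linarith

/-! ### Forms with at most two negative directions -/

section Abstract

variable {V H₁ H₂ : Type*} [AddCommGroup V] [Module ℝ V]
  [NormedAddCommGroup H₁] [InnerProductSpace ℝ H₁] [NormedAddCommGroup H₂] [InnerProductSpace ℝ H₂]
  (G : V →ₗ[ℝ] H₁) (T : V →ₗ[ℝ] H₂)

/-- The form `⟪G f, G g⟫ - 2 ⟪T f, T g⟫`. -/
def excess (f g : V) : ℝ := ⟪G f, G g⟫_ℝ - 2 * ⟪T f, T g⟫_ℝ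

lemma excess_comm (f g : V) : excess G T f g = excess G T g f := by
  rw [excess, excess, real_inner_comm, real_inner_comm (T f)]

lemma excess_add_left (f g h : V) : excess G T (f + g) h = excess G T f h + excess G T g h := by
  simp only [excess, map_add, inner_add_left]; ring

lemma excess_smul_left (c : ℝ) (f h : V) : excess G T (c • f) h = c * excess G T f h := by
  simp only [excess, map_smul, real_inner_smul_left]; ring

lemma excess_add_right (f g h : V) : excess G T h (f + g) = excess G T h f + excess G T h g := by
  simp only [excess, map_add, inner_add_right]; ring

lemma excess_smul_right (c : ℝ) (f h : V) : excess G T h (c • f) = c * excess G T h f := by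
  simp only [excess, map_smul, real_inner_smul_right]; ring

lemma excess_sum_self {ι : Type*} [Fintype ι] {f : ι → V}
    (h : ∀ i j, i ≠ j → excess G T (f i) (f j) = 0) (a : ι → ℝ) :
    excess G T (∑ i, a i • f i) (∑ i, a i • f i) = ∑ i, a i ^ 2 * excess G T (f i) (f i) := by
  classical
  have h1 : excess G T (∑ i, a i • f i) (∑ i, a i • f i)
      = ∑ i, ∑ j, a i * a j * excess G T (f i) (f j) := by
    simp only [excess, map_sum, map_smul, sum_inner, inner_sum, real_inner_smul_left,
      real_inner_smul_right, Finset.mul_sum, mul_sub, Finset.sum_sub_distrib]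
    congr 1 <;> refine Finset.sum_congr rfl fun i _ => Finset.sum_congr rfl fun j _ => by
      rw [real_inner_comm]; ring
  rw [h1]
  refine Finset.sum_congr rfl fun i _ => ?_
  rw [Finset.sum_eq_single i (fun j _ hj => by rw [h i j hj.symm, mul_zero]) (by simp)]
  ring

variable {G T}

/-- On the span the form is at most −mΣa², whereas ‖T‖² ≤ KΣa²; the Rayleigh quotient thus stays
below 2 − m/K, uniformly. -/
lemma exists_bound_of_excess_neg {ι : Type*} [Fintype ι] [Nonempty ι] {f : ι → V}
    (h : ∀ i j, i ≠ j → excess G T (f i) (f j) = 0) (hneg : ∀ i, excess G T (f i) (f i) < 0) :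
    ∃ κ : ℝ, 0 ≤ κ ∧ κ < 2 ∧ ∀ a : ι → ℝ,
      ‖G (∑ i, a i • f i)‖ ^ 2 ≤ κ * ‖T (∑ i, a i • f i)‖ ^ 2 := by
  obtain ⟨i₀, -, hm⟩ := Finset.exists_min_image Finset.univ (fun i => -excess G T (f i) (f i))
    Finset.univ_nonempty
  set m := -excess G T (f i₀) (f i₀)
  have hm0 : 0 < m := neg_pos.2 (hneg i₀)
  set K := ∑ i, ‖T (f i)‖ ^ 2 + 1
  have hK : 0 < K := by positivity
  refine ⟨max 0 (2 - m / K), le_max_left _ _, max_lt two_pos (by linarith [div_pos hm0 hK]), fun a => ?_⟩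
  have h1 : excess G T (∑ i, a i • f i) (∑ i, a i • f i) ≤ -m * ∑ i, a i ^ 2 := by
    rw [excess_sum_self G T h, Finset.mul_sum]
    refine Finset.sum_le_sum fun i _ => ?_
    nlinarith [hm i (Finset.mem_univ i), sq_nonneg (a i)]
  have h2 : ‖T (∑ i, a i • f i)‖ ^ 2 ≤ (∑ i, a i ^ 2) * K := by
    have h3 : ‖T (∑ i, a i • f i)‖ ≤ ∑ i, |a i| * ‖T (f i)‖ := by
      rw [map_sum]
      refine (norm_sum_le _ _).trans_eq (Finset.sum_congr rfl fun i _ => ?_)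
      rw [map_smul, norm_smul, Real.norm_eq_abs]
    calc ‖T (∑ i, a i • f i)‖ ^ 2 ≤ (∑ i, |a i| * ‖T (f i)‖) ^ 2 :=
          pow_le_pow_left₀ (norm_nonneg _) h3 2
      _ ≤ (∑ i, |a i| ^ 2) * ∑ i, ‖T (f i)‖ ^ 2 := Finset.sum_mul_sq_le_sq_mul_sq _ _ _
      _ ≤ (∑ i, a i ^ 2) * K := by
          simp only [sq_abs]
          exact mul_le_mul_of_nonneg_left (by simp [K]) (Finset.sum_nonneg fun i _ => sq_nonneg _)
  have h4 : m / K * ‖T (∑ i, a i • f i)‖ ^ 2 ≤ m * ∑ i, a i ^ 2 := by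
    rw [div_mul_eq_mul_div, div_le_iff₀ hK]
    nlinarith
  rw [excess, real_inner_self_eq_norm_sq, real_inner_self_eq_norm_sq] at h1
  have h5 := le_max_right 0 (2 - m / K)
  nlinarith [sq_nonneg ‖T (∑ i, a i • f i)‖]

variable (G T) in
/-- The form `excess` made positive along two directions. -/
def augmented (e ψ : V) (α β : ℝ) (f g : V) : ℝ :=
  excess G T f g + α * (excess G T f e * excess G T g e) + β * (excess G T f ψ * excess G T g ψ)

lemma augmented_add_smul (e ψ : V) (α β t : ℝ) (f g : V) :
    augmented G T e ψ α β (f + t • g) (f + t • g) = augmented G T e ψ α β f f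
      + 2 * t * augmented G T e ψ α β f g + t ^ 2 * augmented G T e ψ α β g g := by
  simp only [augmented, excess_add_left, excess_add_right, excess_smul_left, excess_smul_right,
    excess_comm G T g f]
  ring

lemma norm_sub_proj_le (e f : V) (he : T e ≠ 0) :
    ‖T (f + (-(⟪T f, T e⟫_ℝ / ‖T e‖ ^ 2)) • e)‖ ^ 2 ≤ ‖T f‖ ^ 2 := by
  have h : 0 < ‖T e‖ ^ 2 := pow_pos (norm_pos_iff.2 he) 2
  rw [map_add, map_smul, ← real_inner_self_eq_norm_sq (_ + _)]
  simp only [inner_add_left, inner_add_right, real_inner_smul_left, real_inner_smul_right,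
    real_inner_comm (T f) (T e)]
  rw [real_inner_self_eq_norm_sq, real_inner_self_eq_norm_sq]
  have h1 : ⟪T f, T e⟫_ℝ = ⟪T f, T e⟫_ℝ / ‖T e‖ ^ 2 * ‖T e‖ ^ 2 := by field_simp
  generalize ⟪T f, T e⟫_ℝ / ‖T e‖ ^ 2 = r at *
  rw [h1]
  nlinarith [mul_nonneg (sq_nonneg r) h.le]

/-- If `excess` has at most two negative directions, one of which is `e` with `G e = 0`, then a
suitable augmented form is positive and controlled by the two norms. -/
theorem exists_augmented_nonneg {e : V} (hGe : G e = 0) (hTe : T e ≠ 0)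
    (hind : ∀ f : Fin 3 → V, (∀ i j, i ≠ j → excess G T (f i) (f j) = 0) →
      ∃ i, 0 ≤ excess G T (f i) (f i)) :
    ∃ (ψ : V) (α β : ℝ), ∀ f, 0 ≤ augmented G T e ψ α β f f ∧
      augmented G T e ψ α β f f ≤ 3 * ‖G f‖ ^ 2 + 8 * ‖T f‖ ^ 2 := by
  set a := ‖T e‖ ^ 2 with ha
  have ha0 : 0 < a := pow_pos (norm_pos_iff.2 hTe) 2
  have hQe : ∀ f, excess G T f e = -2 * ⟪T f, T e⟫_ℝ := fun f => by
    rw [excess, hGe, inner_zero_right]; ring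
  have hQee : excess G T e e = -2 * a := by rw [hQe, real_inner_self_eq_norm_sq]
  -- `P` removes the T-component along e. As G e = 0 it does not change G f, and since `excess`
  -- takes the value −2a on e, it adds `excess f e` squared over 2a to the form.
  set P : V → V := fun f => f + (-(⟪T f, T e⟫_ℝ / a)) • e with hP
  have hGP : ∀ f, G (P f) = G f := fun f => by simp [hP, hGe]
  have hTP : ∀ f, ‖T (P f)‖ ^ 2 ≤ ‖T f‖ ^ 2 := fun f => norm_sub_proj_le e f hTe
  have hPe : ∀ f, ⟪T (P f), T e⟫_ℝ = 0 := fun f => by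
    simp only [hP, map_add, map_smul, inner_add_left, real_inner_smul_left,
      real_inner_self_eq_norm_sq, ← ha]
    field_simp
    ring
  have hPP : ∀ f, excess G T (P f) (P f)
      = excess G T f f + 1 / (2 * a) * (excess G T f e * excess G T f e) := fun f => by
    have h1 : excess G T (P f) e = 0 := by rw [hQe, hPe, mul_zero]
    have h2 : excess G T (P f) (P f) = excess G T (P f) f := by
      change excess G T (P f) (f + _ • e) = _
      rw [excess_add_right, excess_smul_right, h1, mul_zero, add_zero]
    rw [h2]
    simp only [hP, excess_add_left, excess_smul_left, excess_comm G T e f, hQe]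
    field_simp
  have hEf : ∀ f, excess G T f f = ‖G f‖ ^ 2 - 2 * ‖T f‖ ^ 2 := fun f => by
    rw [excess, real_inner_self_eq_norm_sq, real_inner_self_eq_norm_sq]
  by_cases hA : ∀ f, ⟪T f, T e⟫_ℝ = 0 → 0 ≤ excess G T f f
  · refine ⟨0, 1 / (2 * a), 0, fun f => ?_⟩
    have h1 : augmented G T e 0 (1 / (2 * a)) 0 f f = excess G T (P f) (P f) := by
      rw [hPP, augmented]; ring
    rw [h1]
    refine ⟨hA _ (hPe f), ?_⟩
    rw [hEf, hGP]
    nlinarith [sq_nonneg ‖T (P f)‖, sq_nonneg ‖T f‖, sq_nonneg ‖G f‖]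
  push Not at hA
  obtain ⟨f₁, hf₁e, hf₁⟩ := hA
  set S : Set ℝ := {r | ∃ f, ⟪T f, T e⟫_ℝ = 0 ∧ ‖T f‖ = 1 ∧ r = ‖G f‖ ^ 2} with hS
  have hnorm : ∀ f, ⟪T f, T e⟫_ℝ = 0 → 0 < ‖T f‖ → ‖G f‖ ^ 2 / ‖T f‖ ^ 2 ∈ S := fun f hf h => by
    refine ⟨‖T f‖⁻¹ • f, ?_, ?_, ?_⟩
    · rw [map_smul, real_inner_smul_left, hf, mul_zero]
    · rw [map_smul, norm_smul, norm_inv, norm_norm, inv_mul_cancel₀ h.ne']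
    · rw [map_smul, norm_smul, norm_inv, norm_norm, mul_pow, inv_pow]
      field_simp
  have hbdd : BddBelow S := ⟨0, by rintro _ ⟨f, -, -, rfl⟩; positivity⟩
  have hf₁T : 0 < ‖T f₁‖ := by
    rw [hEf] at hf₁
    by_contra h
    have h0 : ‖T f₁‖ = 0 := le_antisymm (not_lt.1 h) (norm_nonneg _)
    rw [h0] at hf₁
    nlinarith [sq_nonneg ‖G f₁‖]
  set l := sInf S with hl
  have hl0 : 0 ≤ l := Real.sInf_nonneg (by rintro _ ⟨f, -, -, rfl⟩; positivity)
  have hl2 : l < 2 := by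
    refine (csInf_le hbdd (hnorm f₁ hf₁e hf₁T)).trans_lt ?_
    rw [div_lt_iff₀ (by positivity)]
    rw [hEf] at hf₁
    linarith
  have hlow : ∀ f, ⟪T f, T e⟫_ℝ = 0 → l * ‖T f‖ ^ 2 ≤ ‖G f‖ ^ 2 := fun f hf => by
    rcases (norm_nonneg (T f)).eq_or_lt with h | h
    · rw [← h]; nlinarith [sq_nonneg ‖G f‖]
    · rw [← le_div_iff₀ (by positivity)]
      exact csInf_le hbdd (hnorm f hf h)
  -- An approximate minimizer suffices: the slack (2 − l)/2 ensures 2 − l ≤ 2q for q = −`excess ψ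
  -- ψ`, which keeps the upper bound independent of how small q is.
  obtain ⟨_, ⟨ψ, hψe, hψ1, rfl⟩, hψlt⟩ := exists_lt_of_csInf_lt ⟨_, hnorm f₁ hf₁e hf₁T⟩
    (show sInf S < l + (2 - l) / 2 by linarith)
  set q := 2 - ‖G ψ‖ ^ 2 with hq
  have hq0 : 0 < q := by rw [hq]; linarith
  have hQψ : excess G T ψ ψ = -q := by rw [hEf, hψ1, hq]; ring
  have hQψe : excess G T ψ e = 0 := by rw [hQe, hψe]; ring
  have hPψ : ∀ f, excess G T (P f) ψ = excess G T f ψ := fun f => by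
    simp only [hP, excess_add_left, excess_smul_left]
    rw [excess_comm G T e ψ, hQψe]; ring
  refine ⟨ψ, 1 / (2 * a), 1 / q, fun f => ?_⟩
  have hB : augmented G T e ψ (1 / (2 * a)) (1 / q) f f
      = excess G T (P f) (P f) + 1 / q * excess G T (P f) ψ ^ 2 := by
    rw [hPP, hPψ, augmented]; ring
  rw [hB]
  constructor
  -- `u` is orthogonal to e and ψ for the form, both of which are negative, so the index hypothesis
  -- makes the form nonnegative on u.
  · set u := P f + (excess G T (P f) ψ / q) • ψ with hu
    have h1 : excess G T u ψ = 0 := by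
      rw [hu, excess_add_left, excess_smul_left, hQψ]
      field_simp
      ring
    have h2 : excess G T u e = 0 := by
      rw [hu, excess_add_left, excess_smul_left, hQψe, hQe, hPe]; ring
    have h3 : excess G T u u = excess G T (P f) (P f) + 1 / q * excess G T (P f) ψ ^ 2 := by
      simp only [hu, excess_add_left, excess_add_right, excess_smul_left, excess_smul_right,
        excess_comm G T ψ (P f), hQψ]
      field_simp
      ring
    rw [← h3]
    obtain ⟨i, hi⟩ := hind ![e, ψ, u] (by
      intro i j hij
      fin_cases i <;> fin_cases j <;>
        simp [hQψe, h1, h2, excess_comm G T e ψ, excess_comm G T e u, excess_comm G T ψ u] at hij ⊢)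
    fin_cases i
    · simp only [Fin.zero_eta, Matrix.cons_val_zero, hQee] at hi
      linarith
    · simp only [Fin.mk_one, Matrix.cons_val_one, Matrix.cons_val_zero, hQψ] at hi
      linarith
    · simpa using hi
  -- Cauchy–Schwarz for ‖G‖² − l‖T‖², which is nonnegative on the T-complement of e by the choice of
  -- l and is at most q on ψ. The gain of q absorbs the division by q in the rank one term.
  · have hN : (⟪G (P f), G ψ⟫_ℝ - l * ⟪T (P f), T ψ⟫_ℝ) ^ 2
        ≤ (‖G (P f)‖ ^ 2 - l * ‖T (P f)‖ ^ 2) * (‖G ψ‖ ^ 2 - l * ‖T ψ‖ ^ 2) := by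
      refine sq_le_mul_of_quadratic fun t => ?_
      have h := hlow (P f + t • ψ) (by
        rw [map_add, map_smul, inner_add_left, real_inner_smul_left, hPe, hψe]; ring)
      simp only [← real_inner_self_eq_norm_sq, map_add, map_smul, inner_add_left, inner_add_right,
        real_inner_smul_left, real_inner_smul_right, real_inner_comm (G (P f)) (G ψ),
        real_inner_comm (T (P f)) (T ψ)] at h ⊢
      linarith
    have hT : ⟪T (P f), T ψ⟫_ℝ ^ 2 ≤ ‖T (P f)‖ ^ 2 := by
      have := abs_real_inner_le_norm (T (P f)) (T ψ)
      rw [hψ1, mul_one] at this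
      rw [← sq_abs]
      exact pow_le_pow_left₀ (abs_nonneg _) this 2
    have h1 := hTP f
    have h2 : excess G T (P f) ψ = (⟪G (P f), G ψ⟫_ℝ - l * ⟪T (P f), T ψ⟫_ℝ)
        - (2 - l) * ⟪T (P f), T ψ⟫_ℝ := by rw [excess]; ring
    rw [hψ1, one_pow, mul_one] at hN
    have hη : ‖G ψ‖ ^ 2 - l ≤ q := by rw [hq]; linarith
    have hN0 : 0 ≤ ‖G (P f)‖ ^ 2 - l * ‖T (P f)‖ ^ 2 := by linarith [hlow (P f) (hPe f)]
    have h3 : excess G T (P f) ψ ^ 2 ≤ q * (2 * ‖G (P f)‖ ^ 2 + 8 * ‖T (P f)‖ ^ 2) := by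
      have h4 : excess G T (P f) ψ ^ 2
          ≤ 2 * (⟪G (P f), G ψ⟫_ℝ - l * ⟪T (P f), T ψ⟫_ℝ) ^ 2 + 2 * ((2 - l) * ⟪T (P f), T ψ⟫_ℝ) ^ 2 := by
        rw [h2]
        linarith [sq_nonneg ((⟪G (P f), G ψ⟫_ℝ - l * ⟪T (P f), T ψ⟫_ℝ) + (2 - l) * ⟪T (P f), T ψ⟫_ℝ)]
      have h5 : (⟪G (P f), G ψ⟫_ℝ - l * ⟪T (P f), T ψ⟫_ℝ) ^ 2 ≤ q * ‖G (P f)‖ ^ 2 := by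
        have h6 := mul_le_mul_of_nonneg_left hη hN0
        have h7 : 0 ≤ q * (l * ‖T (P f)‖ ^ 2) := by positivity
        have h8 : (‖G (P f)‖ ^ 2 - l * ‖T (P f)‖ ^ 2) * q
            = q * ‖G (P f)‖ ^ 2 - q * (l * ‖T (P f)‖ ^ 2) := by ring
        linarith
      have h8 : ((2 - l) * ⟪T (P f), T ψ⟫_ℝ) ^ 2 ≤ q * (4 * ‖T (P f)‖ ^ 2) := by
        rw [mul_pow]
        have h9 : (2 - l) ^ 2 ≤ q * 4 := by
          have h11 : 2 - l ≤ 2 * q := by rw [hq]; linarith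
          calc (2 - l) ^ 2 = (2 - l) * (2 - l) := sq _
            _ ≤ 2 * q * 2 := mul_le_mul h11 (by linarith) (by linarith) (by linarith)
            _ = q * 4 := by ring
        calc (2 - l) ^ 2 * ⟪T (P f), T ψ⟫_ℝ ^ 2 ≤ q * 4 * ‖T (P f)‖ ^ 2 :=
              mul_le_mul h9 hT (sq_nonneg _) (by positivity)
          _ = _ := by ring
      linarith
    have h10 : 1 / q * excess G T (P f) ψ ^ 2 ≤ 2 * ‖G (P f)‖ ^ 2 + 8 * ‖T (P f)‖ ^ 2 := by
      rw [one_div, inv_mul_le_iff₀ hq0]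
      exact h3
    rw [hEf]
    rw [hGP] at h10 ⊢
    nlinarith [sq_nonneg ‖T (P f)‖]

end Abstract

/-! ### The form of a measure whose second eigenvalue is at least two -/

variable {μ : Measure S2} [IsFiniteMeasure μ]

lemma lintegral_enorm_sq {F : Type*} [NormedAddCommGroup F] [SecondCountableTopology F] (m : Measure S2)
    [IsFiniteMeasure m] {f : S2 → F} (hf : Continuous f) :
    ∫⁻ x, ‖f x‖ₑ ^ 2 ∂m = ENNReal.ofReal (∫ x, ‖f x‖ ^ 2 ∂m) := by
  have hi : Integrable (fun x => ‖f x‖ ^ 2) m := integrable_of_continuous m (hf.norm.pow 2)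
  rw [ofReal_integral_eq_lintegral_ofReal hi (Eventually.of_forall fun x => sq_nonneg _)]
  refine lintegral_congr fun x => ?_
  rw [ENNReal.ofReal_pow (norm_nonneg _), ofReal_norm]

lemma norm_gradL2_sq (f : SmoothFun) : ‖gradL2 f‖ ^ 2 = ∫ x, ‖sphGrad f x‖ ^ 2 ∂roundVolume := by
  rw [← real_inner_self_eq_norm_sq, inner_gradL2]
  simp only [dirichlet, real_inner_self_eq_norm_sq]

lemma norm_toL2_sq (f : SmoothFun) : ‖toL2 μ f‖ ^ 2 = ∫ x, f x ^ 2 ∂μ := by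
  rw [← real_inner_self_eq_norm_sq, inner_toL2]
  simp only [sq]

lemma rayleigh_le {f : SmoothFun} {κ : ℝ} (hκ : 0 ≤ κ) (h : ‖gradL2 f‖ ^ 2 ≤ κ * ‖toL2 μ f‖ ^ 2) :
    rayleigh μ f ≤ ENNReal.ofReal κ := by
  refine ENNReal.div_le_of_le_mul ?_
  rw [lintegral_enorm_sq _ (continuous_sphGrad f.contMDiff_one),
    lintegral_enorm_sq _ f.contMDiff.continuous, ← ENNReal.ofReal_mul hκ, ← norm_gradL2_sq]
  refine ENNReal.ofReal_le_ofReal (h.trans_eq ?_)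
  rw [norm_toL2_sq]
  simp only [Real.norm_eq_abs, sq_abs]

/-- Three orthogonal negative directions would span an admissible trial space with Rayleigh
quotients bounded by some κ < 2. Its dimension does not drop in L²(μ), since the form is nonnegative
on functions that vanish there. -/
lemma exists_excess_nonneg (hμ : 2 ≤ eigenvalue 2 μ) {f : Fin 3 → SmoothFun}
    (h : ∀ i j, i ≠ j → excess gradL2 (toL2 μ) (f i) (f j) = 0) :
    ∃ i, 0 ≤ excess gradL2 (toL2 μ) (f i) (f i) := by
  by_contra! hneg
  obtain ⟨κ, hκ0, hκ2, hκ⟩ := exists_bound_of_excess_neg h hneg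
  have hli : LinearIndependent ℝ (fun i => toL2 μ (f i)) := by
    rw [Fintype.linearIndependent_iff]
    intro a ha i
    have h1 : toL2 μ (∑ i, a i • f i) = 0 := by simpa using ha
    have h2 := excess_sum_self gradL2 (toL2 μ) h a
    rw [excess, h1, inner_zero_left, mul_zero, sub_zero, real_inner_self_eq_norm_sq] at h2
    have h3 : ∑ i, a i ^ 2 * excess gradL2 (toL2 μ) (f i) (f i) ≤ a i ^ 2 * excess gradL2 (toL2 μ) (f i) (f i) := by
      rw [← Finset.add_sum_erase _ _ (Finset.mem_univ i)]
      have : ∑ j ∈ Finset.univ.erase i, a j ^ 2 * excess gradL2 (toL2 μ) (f j) (f j) ≤ 0 :=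
        Finset.sum_nonpos fun j _ => mul_nonpos_of_nonneg_of_nonpos (sq_nonneg _) (hneg j).le
      linarith
    by_contra hai
    have h4 : 0 < a i ^ 2 := by positivity
    nlinarith [sq_nonneg ‖gradL2 (∑ i, a i • f i)‖, hneg i]
  have hli' : LinearIndependent ℝ f := hli.of_comp (toL2 μ)
  have hle : eigenvalue 2 μ ≤ ENNReal.ofReal κ := by
    refine iInf_le_of_le (Submodule.span ℝ (range f)) (iInf_le_of_le ?_ (iInf_le_of_le ?_ ?_))
    · rw [finrank_span_eq_card hli']; simp
    · rw [Submodule.map_span, ← range_comp]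
      exact (finrank_span_eq_card hli).trans (by simp)
    · refine iSup_le fun u => iSup_le fun hu => iSup_le fun _ => ?_
      obtain ⟨a, rfl⟩ := (Submodule.mem_span_range_iff_exists_fun ℝ).1 hu
      exact rayleigh_le hκ0 (hκ a)
  have h5 : ENNReal.ofReal κ < 2 := by
    rw [show (2 : ℝ≥0∞) = ENNReal.ofReal 2 by simp]
    exact (ENNReal.ofReal_lt_ofReal_iff two_pos).2 hκ2
  exact (hμ.trans hle).not_gt h5

/-- The constant function `1`. -/
def oneFun : SmoothFun := SmoothFun.ofRestrict (fun _ => 1) fun _ => contDiffAt_const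

@[simp] lemma oneFun_apply (x : S2) : oneFun x = 1 := rfl

lemma gradL2_oneFun : gradL2 oneFun = 0 := by
  rw [← norm_eq_zero, ← sq_eq_zero_iff, norm_gradL2_sq]
  have : ∀ x, sphGrad oneFun x = 0 := fun x => sphGrad_const 1 x
  simp [this]

lemma excess_eq (f g : SmoothFun) :
    excess gradL2 (toL2 μ) f g = dirichlet f g - 2 * ∫ x, f x * g x ∂μ := by
  rw [excess, inner_gradL2, inner_toL2]

theorem exists_augmented_form (hμ0 : μ ≠ 0) (hμ : 2 ≤ eigenvalue 2 μ) :
    ∃ (ψ : SmoothFun) (α β : ℝ), ∀ u ζ : SmoothFun,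
      0 ≤ augmented gradL2 (toL2 μ) oneFun ψ α β u u ∧
      augmented gradL2 (toL2 μ) oneFun ψ α β u ζ ^ 2 ≤ augmented gradL2 (toL2 μ) oneFun ψ α β u u
        * (3 * dirichlet ζ ζ + 8 * ∫ x, ζ x ^ 2 ∂μ) := by
  have hT : toL2 μ oneFun ≠ 0 := fun h => by
    have h1 := norm_toL2_sq (μ := μ) oneFun
    rw [h, norm_zero] at h1
    simp only [oneFun_apply, one_pow, integral_const, smul_eq_mul, mul_one] at h1
    have h2 : μ.real univ = 0 := by linarith
    rw [measureReal_eq_zero_iff] at h2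
    exact hμ0 (Measure.measure_univ_eq_zero.1 h2)
  obtain ⟨ψ, α, β, h⟩ := exists_augmented_nonneg gradL2_oneFun hT
    fun f hf => exists_excess_nonneg hμ hf
  refine ⟨ψ, α, β, fun u ζ => ⟨(h u).1, ?_⟩⟩
  have h1 : augmented gradL2 (toL2 μ) oneFun ψ α β u ζ ^ 2 ≤ augmented gradL2 (toL2 μ) oneFun ψ α β u u
      * augmented gradL2 (toL2 μ) oneFun ψ α β ζ ζ := by
    refine sq_le_mul_of_quadratic fun t => ?_
    rw [← augmented_add_smul]
    exact (h _).1
  refine h1.trans (mul_le_mul_of_nonneg_left ?_ (h u).1)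
  have h2 := (h ζ).2
  rwa [← real_inner_self_eq_norm_sq, inner_gradL2, norm_toL2_sq] at h2

end Spectral

/-! ### Energy densities of maps into the sphere -/

section Energy

open Set Filter Topology

/-- The energy density of a map into the sphere. -/
def energyDensity (N : S2 → S2) (x : S2) : ℝ := ∑ i, ‖sphGrad (coordFun i ∘ N) x‖ ^ 2

lemma energyDensity_nonneg (N : S2 → S2) (x : S2) : 0 ≤ energyDensity N x :=
  Finset.sum_nonneg fun _ _ => sq_nonneg _

lemma energyDensity_id (x : S2) : energyDensity id x = 2 := sum_norm_sphGrad_coordFun x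

lemma contMDiff_coordFun_comp {N : S2 → S2} (hN : ContMDiff (𝓡 2) (𝓡 2) ∞ N) (i : Fin 3) :
    ContMDiff (𝓡 2) 𝓘(ℝ, ℝ) 1 (coordFun i ∘ N) :=
  ((coordFun i).compMap N hN).contMDiff_one

lemma continuous_energyDensity {N : S2 → S2} (hN : ContMDiff (𝓡 2) (𝓡 2) ∞ N) :
    Continuous (energyDensity N) :=
  continuous_finsetSum _ fun i _ => (continuous_sphGrad (contMDiff_coordFun_comp hN i)).norm.pow 2

lemma energyDensity_comp_mobS {N : S2 → S2} (hN : ContMDiff (𝓡 2) (𝓡 2) ∞ N) {a : E3} (ha : ‖a‖ < 1)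
    (x : S2) : energyDensity (N ∘ mobS a ha) x = (lor a x)⁻¹ ^ 2 * energyDensity N (mobS a ha x) := by
  rw [energyDensity, energyDensity, Finset.mul_sum]
  refine Finset.sum_congr rfl fun i _ => ?_
  rw [← Function.comp_assoc, ← real_inner_self_eq_norm_sq,
    inner_sphGrad_comp_mobS ha (contMDiff_coordFun_comp hN i) (contMDiff_coordFun_comp hN i),
    real_inner_self_eq_norm_sq]

/-- Half the gradient of |N|² = 1. This identity cancels the cross terms in the next two formulas.
-/
lemma sum_coordFun_smul_sphGrad {N : S2 → S2} (hN : ContMDiff (𝓡 2) (𝓡 2) ∞ N) (x : S2) :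
    ∑ i, (N x : E3) i • sphGrad (coordFun i ∘ N) x = 0 := by
  have hc := contMDiff_coordFun_comp hN
  have h1 : (coordFun 0 ∘ N) * (coordFun 0 ∘ N) + ((coordFun 1 ∘ N) * (coordFun 1 ∘ N)
      + (coordFun 2 ∘ N) * (coordFun 2 ∘ N)) = fun _ => (1 : ℝ) := by
    funext y
    have := sum_coord_sq (N y)
    rw [Fin.sum_univ_three] at this
    simp only [Pi.add_apply, Pi.mul_apply, Function.comp_apply, coordFun_apply]
    linarith
  have h2 := sphGrad_const 1 x
  rw [← h1, sphGrad_add ((hc 0).mul (hc 0)) (((hc 1).mul (hc 1)).add ((hc 2).mul (hc 2))), Pi.add_apply,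
    sphGrad_add ((hc 1).mul (hc 1)) ((hc 2).mul (hc 2)), Pi.add_apply, sphGrad_mul (hc 0) (hc 0),
    sphGrad_mul (hc 1) (hc 1), sphGrad_mul (hc 2) (hc 2)] at h2
  simp only [← two_smul ℝ (_ • _ : E3), ← smul_add] at h2
  rw [Fin.sum_univ_three, add_assoc]
  exact (smul_eq_zero.1 h2).resolve_left two_ne_zero

lemma dirichlet_mul_right {N : S2 → S2} (hN : ContMDiff (𝓡 2) (𝓡 2) ∞ N) (θ : SmoothFun) :
    ∑ i, dirichlet (coordFun i ∘ N) ((coordFun i ∘ N) * θ)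
      = ∫ x, θ x * energyDensity N x ∂roundVolume := by
  have hc := contMDiff_coordFun_comp hN
  simp only [dirichlet]
  rw [← integral_finsetSum _ fun i _ => integrable_of_continuous _
    (continuous_inner_sphGrad (hc i) ((hc i).mul θ.contMDiff_one))]
  refine integral_congr_ae (Eventually.of_forall fun x => ?_)
  have h1 : ∑ i, ⟪(N x : E3) i • sphGrad (coordFun i ∘ N) x, sphGrad θ x⟫_ℝ = 0 := by
    rw [← sum_inner, sum_coordFun_smul_sphGrad hN, inner_zero_left]
  simp only
  rw [energyDensity, Finset.mul_sum, ← add_zero (∑ i, θ x * _), ← h1, ← Finset.sum_add_distrib]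
  refine Finset.sum_congr rfl fun i _ => ?_
  rw [sphGrad_mul (hc i) θ.contMDiff_one, inner_add_right, real_inner_smul_right,
    real_inner_smul_right, real_inner_smul_left, real_inner_self_eq_norm_sq]
  simp only [Function.comp_apply, coordFun_apply]
  ring

lemma dirichlet_mul_mul {N : S2 → S2} (hN : ContMDiff (𝓡 2) (𝓡 2) ∞ N) (θ : SmoothFun) :
    ∑ i, dirichlet ((coordFun i ∘ N) * θ) ((coordFun i ∘ N) * θ)
      = ∫ x, θ x ^ 2 * energyDensity N x ∂roundVolume + dirichlet θ θ := by
  have hc := contMDiff_coordFun_comp hN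
  have hm := fun i => (hc i).mul θ.contMDiff_one
  simp only [dirichlet]
  rw [← integral_finsetSum _ fun i _ => integrable_of_continuous _
    (continuous_inner_sphGrad (hm i) (hm i)), ← integral_add]
  rotate_left
  · exact integrable_of_continuous _ ((θ.contMDiff.continuous.pow 2).mul (continuous_energyDensity hN))
  · exact integrable_of_continuous _ (continuous_inner_sphGrad θ.contMDiff_one θ.contMDiff_one)
  refine integral_congr_ae (Eventually.of_forall fun x => ?_)
  have h1 : ∑ i, 2 * θ x * ⟪(N x : E3) i • sphGrad (coordFun i ∘ N) x, sphGrad θ x⟫_ℝ = 0 := by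
    rw [← Finset.mul_sum, ← sum_inner, sum_coordFun_smul_sphGrad hN, inner_zero_left, mul_zero]
  have h2 : ⟪sphGrad θ x, sphGrad θ x⟫_ℝ = ∑ i, (N x : E3) i ^ 2 * ⟪sphGrad θ x, sphGrad θ x⟫_ℝ := by
    rw [← Finset.sum_mul, sum_coord_sq, one_mul]
  simp only
  rw [energyDensity, Finset.mul_sum, h2, ← add_zero (∑ i, θ x ^ 2 * _), ← h1, ← Finset.sum_add_distrib,
    ← Finset.sum_add_distrib]
  refine Finset.sum_congr rfl fun i _ => ?_
  rw [sphGrad_mul (hc i) θ.contMDiff_one]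
  simp only [inner_add_right, inner_add_left, real_inner_smul_right, real_inner_smul_left,
    Function.comp_apply, coordFun_apply, real_inner_comm (sphGrad (coordFun i ∘ N) x) (sphGrad θ x)]
  rw [real_inner_self_eq_norm_sq (sphGrad (coordFun i ∘ N) x)]
  ring

/-! ### Smooth approximation of the reflection fold -/

/-- The fold of the sphere along the great circle orthogonal to `p`. -/
def hfoldS (p x : S2) : S2 := ⟨hfold p x, by simp [norm_hfold]⟩

@[simp] lemma coe_hfoldS (p x : S2) : (hfoldS p x : E3) = hfold p x := rfl

lemma continuous_hfoldS (p : S2) : Continuous (hfoldS p) :=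
  (continuous_hfold.comp (continuous_const.prodMk continuous_subtype_val)).subtype_mk _

/-- The ambient formula for the smoothed fold. -/
def smoothFoldE (p : E3) (ε : ℝ) (y : E3) : E3 :=
  (√(1 + ε ^ 2))⁻¹ • (y + (√(⟪p, y⟫_ℝ ^ 2 + ε ^ 2) - ⟪p, y⟫_ℝ) • p)

lemma norm_smoothFoldE {p y : E3} (hp : ‖p‖ = 1) (hy : ‖y‖ = 1) (ε : ℝ) : ‖smoothFoldE p ε y‖ = 1 := by
  have h1 : ‖y + (√(⟪p, y⟫_ℝ ^ 2 + ε ^ 2) - ⟪p, y⟫_ℝ) • p‖ = √(1 + ε ^ 2) := by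
    rw [eq_comm, Real.sqrt_eq_iff_eq_sq (by positivity) (norm_nonneg _), norm_add_sq_real, norm_smul,
      mul_pow, real_inner_smul_right, hp, hy, real_inner_comm p y, Real.norm_eq_abs, sq_abs]
    have h2 : √(⟪p, y⟫_ℝ ^ 2 + ε ^ 2) ^ 2 = ⟪p, y⟫_ℝ ^ 2 + ε ^ 2 := Real.sq_sqrt (by positivity)
    nlinarith
  have h3 : 0 < √(1 + ε ^ 2) := Real.sqrt_pos.2 (by positivity)
  rw [smoothFoldE, norm_smul, h1, norm_inv, Real.norm_eq_abs, abs_of_pos h3, inv_mul_cancel₀ h3.ne']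

/-- The smoothed fold. -/
def smoothFold (p : S2) (ε : ℝ) (x : S2) : S2 :=
  ⟨smoothFoldE p ε x, by simp [norm_smoothFoldE]⟩

@[simp] lemma coe_smoothFold (p : S2) (ε : ℝ) (x : S2) :
    (smoothFold p ε x : E3) = smoothFoldE p ε x := rfl

lemma contDiff_smoothFoldE (p : E3) {ε : ℝ} (hε : 0 < ε) : ContDiff ℝ ∞ (smoothFoldE p ε) := by
  have h1 : ContDiff ℝ ∞ fun y : E3 => ⟪p, y⟫_ℝ := contDiff_const.inner ℝ contDiff_id
  have h2 : ContDiff ℝ ∞ fun y : E3 => √(⟪p, y⟫_ℝ ^ 2 + ε ^ 2) :=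
    ((h1.pow 2).add contDiff_const).sqrt fun y => by positivity
  have h3 : ContDiff ℝ ∞ fun y : E3 => y + (√(⟪p, y⟫_ℝ ^ 2 + ε ^ 2) - ⟪p, y⟫_ℝ) • p :=
    contDiff_id.add ((h2.sub h1).smul contDiff_const)
  exact h3.const_smul (√(1 + ε ^ 2))⁻¹

lemma contMDiff_smoothFold (p : S2) {ε : ℝ} (hε : 0 < ε) : ContMDiff (𝓡 2) (𝓡 2) ∞ (smoothFold p ε) :=
  contMDiff_sphere (fun _ => rfl) fun _ => (contDiff_smoothFoldE p hε).contDiffAt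

lemma hasFDerivAt_smoothFoldE (p : E3) {ε : ℝ} (hε : 0 < ε) (y : E3) :
    HasFDerivAt (smoothFoldE p ε) ((√(1 + ε ^ 2))⁻¹ • (ContinuousLinearMap.id ℝ E3 +
      ((⟪p, y⟫_ℝ / √(⟪p, y⟫_ℝ ^ 2 + ε ^ 2) - 1) • innerSL ℝ p).smulRight p)) y := by
  have h1 : HasFDerivAt (fun y : E3 => ⟪p, y⟫_ℝ) (innerSL ℝ p) y := (innerSL ℝ p).hasFDerivAt
  have h0 : 0 < ⟪p, y⟫_ℝ ^ 2 + ε ^ 2 := by positivity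
  have h2 := ((h1.pow 2).add_const (ε ^ 2)).sqrt h0.ne'
  have h4 := (((hasFDerivAt_id y).add ((h2.sub h1).smul_const p)).const_smul (√(1 + ε ^ 2))⁻¹)
  refine HasFDerivAt.congr_fderiv (f := smoothFoldE p ε) h4 ?_
  ext1 v
  simp only [smul_apply, add_apply, ContinuousLinearMap.id_apply,
    ContinuousLinearMap.smulRight_apply, sub_apply, smul_eq_mul]
  congr 4
  have h3 : √(⟪p, y⟫_ℝ ^ 2 + ε ^ 2) ≠ 0 := (Real.sqrt_pos.2 h0).ne'
  simp
  field_simp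

lemma sphGrad_comp_smoothFold {f : S2 → ℝ} (hf : ContMDiff (𝓡 2) 𝓘(ℝ, ℝ) 1 f) (p : S2) {ε : ℝ}
    (hε : 0 < ε) (x : S2) :
    sphGrad (f ∘ smoothFold p ε) x =
      let g := sphGrad f (smoothFold p ε x)
      let h := (√(1 + ε ^ 2))⁻¹ • (g +
        ((⟪(p : E3), x⟫_ℝ / √(⟪(p : E3), x⟫_ℝ ^ 2 + ε ^ 2) - 1) * ⟪(p : E3), g⟫_ℝ) • (p : E3))
      h - ⟪(x : E3), h⟫_ℝ • (x : E3) := by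
  extract_lets g h
  refine ext_inner_right ℝ fun v => ?_
  rw [inner_sphGrad_comp hf (coe_smoothFold p ε) (hasFDerivAt_smoothFoldE p hε x)]
  simp only [h, smul_apply, add_apply,
    ContinuousLinearMap.id_apply, ContinuousLinearMap.smulRight_apply, innerSL_apply_apply, smul_eq_mul,
    inner_add_left, inner_add_right, inner_sub_left, inner_sub_right, real_inner_smul_left,
    real_inner_smul_right, real_inner_comm g]
  simp only [g]
  rw [real_inner_comm (p : E3) (x : E3)]
  ring

lemma norm_sub_inner_smul_le {x : E3} (hx : ‖x‖ = 1) (h : E3) : ‖h - ⟪x, h⟫_ℝ • x‖ ≤ ‖h‖ := by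
  refine le_of_sq_le_sq ?_ (norm_nonneg _)
  rw [norm_sub_sq_real, real_inner_smul_right, norm_smul, hx, mul_one, Real.norm_eq_abs, sq_abs,
    real_inner_comm x h]
  nlinarith [sq_nonneg ⟪x, h⟫_ℝ]

lemma norm_add_mul_inner_smul_le {p : E3} (hp : ‖p‖ = 1) {c : ℝ} (hc : c ^ 2 ≤ 1) (g : E3) :
    ‖g + ((c - 1) * ⟪p, g⟫_ℝ) • p‖ ≤ ‖g‖ := by
  refine le_of_sq_le_sq ?_ (norm_nonneg _)
  rw [norm_add_sq_real, real_inner_smul_right, norm_smul, hp, mul_one, Real.norm_eq_abs, sq_abs,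
    real_inner_comm p g]
  nlinarith [mul_nonneg (sub_nonneg.2 hc) (sq_nonneg ⟪p, g⟫_ℝ)]

/-- The smoothed fold is a contraction: its derivative multiplies the p-direction by a number in
[−1, 1] and then scales by (1 + ε²)^(−1/2). This gives the domination needed as ε → 0. -/
lemma norm_sphGrad_comp_smoothFold_le {f : S2 → ℝ} (hf : ContMDiff (𝓡 2) 𝓘(ℝ, ℝ) 1 f) (p : S2)
    {ε : ℝ} (hε : 0 < ε) (x : S2) :
    ‖sphGrad (f ∘ smoothFold p ε) x‖ ≤ ‖sphGrad f (smoothFold p ε x)‖ := by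
  rw [sphGrad_comp_smoothFold hf p hε]
  refine (norm_sub_inner_smul_le (by simp) _).trans ?_
  rw [norm_smul]
  refine (mul_le_of_le_one_left (norm_nonneg _) ?_).trans (norm_add_mul_inner_smul_le (by simp) ?_ _)
  · rw [norm_inv, Real.norm_eq_abs, abs_of_nonneg (Real.sqrt_nonneg _)]
    exact inv_le_one_of_one_le₀ (Real.one_le_sqrt.2 (by nlinarith [sq_nonneg ε]))
  · rw [div_pow, Real.sq_sqrt (by positivity), div_le_one (by positivity)]
    nlinarith [sq_nonneg ε]

lemma tendsto_smoothFold (p x : S2) {ε : ℕ → ℝ} (hε : Tendsto ε atTop (𝓝 0)) :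
    Tendsto (fun n => smoothFold p (ε n) x) atTop (𝓝 (hfoldS p x)) := by
  rw [tendsto_subtype_rng]
  have h : Continuous fun t : ℝ => smoothFoldE p t x := by
    unfold smoothFoldE
    have h1 : Continuous fun t : ℝ => (√(1 + t ^ 2))⁻¹ :=
      Continuous.inv₀ (by fun_prop) fun t => (Real.sqrt_pos.2 (by positivity)).ne'
    exact h1.smul (by fun_prop)
  have h1 := (h.tendsto 0).comp hε
  have h2 : smoothFoldE p 0 x = hfold p x := by simp [smoothFoldE, hfold, Real.sqrt_sq_eq_abs]
  rw [h2] at h1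
  exact h1

/-- Off the great circle the derivative of the limit fold is the identity or the reflection, an
isometry in either case. -/
lemma tendsto_norm_sphGrad_comp_smoothFold {f : S2 → ℝ} (hf : ContMDiff (𝓡 2) 𝓘(ℝ, ℝ) 1 f) (p : S2)
    {ε : ℕ → ℝ} (hε0 : ∀ n, 0 < ε n) (hε : Tendsto ε atTop (𝓝 0)) {x : S2} (hx : ⟪(p : E3), x⟫_ℝ ≠ 0) :
    Tendsto (fun n => ‖sphGrad (f ∘ smoothFold p (ε n)) x‖) atTop (𝓝 ‖sphGrad f (hfoldS p x)‖) := by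
  have hp : ‖(p : E3)‖ = 1 := by simp
  set σ := ⟪(p : E3), x⟫_ℝ with hσ
  set g₀ := sphGrad f (hfoldS p x) with hg₀
  have hg : Tendsto (fun n => sphGrad f (smoothFold p (ε n) x)) atTop (𝓝 g₀) :=
    ((continuous_sphGrad hf).tendsto _).comp (tendsto_smoothFold p x hε)
  have hk : Tendsto (fun n => (√(1 + ε n ^ 2))⁻¹) atTop (𝓝 1) := by
    have h : Tendsto (fun n => (√(1 + ε n ^ 2))⁻¹) atTop (𝓝 (√(1 + 0 ^ 2))⁻¹) :=
      ((hε.pow 2).const_add 1).sqrt.inv₀ (by simp)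
    simpa using h
  have hc : Tendsto (fun n => σ / √(σ ^ 2 + ε n ^ 2) - 1) atTop (𝓝 (σ / |σ| - 1)) := by
    have h : Tendsto (fun n => σ / √(σ ^ 2 + ε n ^ 2) - 1) atTop (𝓝 (σ / √(σ ^ 2 + 0 ^ 2) - 1)) :=
      (tendsto_const_nhds.div ((hε.pow 2).const_add _).sqrt
        (by simpa [Real.sqrt_sq_eq_abs] using hx)).sub_const 1
    simpa [Real.sqrt_sq_eq_abs] using h
  set h₀ := g₀ + ((σ / |σ| - 1) * ⟪(p : E3), g₀⟫_ℝ) • (p : E3) with hh₀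
  have hh : Tendsto (fun n => (√(1 + ε n ^ 2))⁻¹ • (sphGrad f (smoothFold p (ε n) x) +
      ((σ / √(σ ^ 2 + ε n ^ 2) - 1) * ⟪(p : E3), sphGrad f (smoothFold p (ε n) x)⟫_ℝ) • (p : E3)))
      atTop (𝓝 ((1 : ℝ) • h₀)) :=
    hk.smul (hg.add ((hc.mul (tendsto_const_nhds.inner hg)).smul_const _))
  rw [one_smul] at hh
  have hlim := hh.sub ((tendsto_const_nhds (x := (x : E3))).inner (𝕜 := ℝ) hh |>.smul_const (x : E3))
  have key : ⟪(x : E3), h₀⟫_ℝ = 0 ∧ ‖h₀‖ = ‖g₀‖ := by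
    have ht := inner_sphGrad_self hf (hfoldS p x)
    rw [← hg₀, coe_hfoldS] at ht
    rcases lt_or_gt_of_ne hx with h | h
    · have e1 : h₀ = refl p g₀ := by
        rw [refl_apply hp, hh₀, abs_of_neg h, div_neg, div_self hx, sub_eq_add_neg g₀, ← neg_smul]
        ring_nf
      rw [e1, LinearIsometryEquiv.norm_map]
      rw [hfold_of_nonpos hp h.le, ← LinearIsometryEquiv.inner_map_map (refl p),
        Submodule.reflection_reflection, real_inner_comm] at ht
      exact ⟨ht, rfl⟩
    · have e1 : h₀ = g₀ := by rw [hh₀, abs_of_pos h, div_self hx]; simp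
      rw [hfold_of_nonneg h.le, real_inner_comm] at ht
      rw [e1]; exact ⟨ht, rfl⟩
  rw [key.1, zero_smul, sub_zero] at hlim
  rw [← key.2]
  refine hlim.norm.congr fun n => ?_
  rw [sphGrad_comp_smoothFold hf p (hε0 n)]

lemma energyDensity_comp_smoothFold_le {N : S2 → S2} (hN : ContMDiff (𝓡 2) (𝓡 2) ∞ N) (p : S2) {ε : ℝ}
    (hε : 0 < ε) (x : S2) :
    energyDensity (N ∘ smoothFold p ε) x ≤ energyDensity N (smoothFold p ε x) :=
  Finset.sum_le_sum fun i _ => pow_le_pow_left₀ (norm_nonneg _)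
    (norm_sphGrad_comp_smoothFold_le (contMDiff_coordFun_comp hN i) p hε x) 2

lemma tendsto_integral_mul_energyDensity {N : S2 → S2} (hN : ContMDiff (𝓡 2) (𝓡 2) ∞ N) (p : S2)
    {ε : ℕ → ℝ} (hε0 : ∀ n, 0 < ε n) (hε : Tendsto ε atTop (𝓝 0)) {θ : S2 → ℝ} (hθ : Continuous θ) :
    Tendsto (fun n => ∫ x, θ x * energyDensity (N ∘ smoothFold p (ε n)) x ∂roundVolume) atTop
      (𝓝 (∫ x, θ x * energyDensity N (hfoldS p x) ∂roundVolume)) := by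
  obtain ⟨C, hC⟩ := isCompact_univ.exists_bound_of_continuousOn (continuous_energyDensity hN).continuousOn
  refine tendsto_integral_of_dominated_convergence (fun x => ‖θ x‖ * C) (fun n => ?_)
    (integrable_of_continuous _ (hθ.norm.mul continuous_const)) (fun n => Eventually.of_forall fun x => ?_)
    ?_
  · exact (hθ.mul (continuous_energyDensity
      (hN.comp (contMDiff_smoothFold p (hε0 n))))).aestronglyMeasurable
  · rw [norm_mul]
    refine mul_le_mul_of_nonneg_left ?_ (norm_nonneg _)
    rw [Real.norm_eq_abs, abs_of_nonneg (energyDensity_nonneg _ _)]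
    exact (energyDensity_comp_smoothFold_le hN p (hε0 n) x).trans
      ((le_abs_self _).trans (hC _ (mem_univ _)))
  · have hae : ∀ᵐ x : S2 ∂roundVolume, ⟪(p : E3), x⟫_ℝ ≠ 0 := by
      rw [ae_iff]
      simpa using roundVolume_equator (coe_ne_zero p)
    filter_upwards [hae] with x hx
    refine tendsto_const_nhds.mul (tendsto_finsetSum _ fun i _ => ?_)
    exact (tendsto_norm_sphGrad_comp_smoothFold (contMDiff_coordFun_comp hN i) p hε0 hε hx).pow 2

end Energy

/-! ### The stability inequality along approximating maps -/

section Limit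

open Set Filter Topology

lemma sum_dirichlet_coordFun {N : S2 → S2} (hN : ContMDiff (𝓡 2) (𝓡 2) ∞ N) :
    ∑ i, dirichlet (coordFun i ∘ N) (coordFun i ∘ N) = ∫ x, energyDensity N x ∂roundVolume := by
  have hc := contMDiff_coordFun_comp hN
  simp only [dirichlet]
  rw [← integral_finsetSum _ fun i _ => integrable_of_continuous _
    (continuous_inner_sphGrad (hc i) (hc i))]
  simp only [real_inner_self_eq_norm_sq, energyDensity]

lemma abs_coord_le (x : S2) (i : Fin 3) : |(x : E3) i| ≤ 1 := by
  have h := PiLp.norm_apply_le (x : E3) i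
  rwa [norm_eq_of_mem_sphere, Real.norm_eq_abs] at h

lemma tendsto_integral_coord {m : Measure S2} {g : S2 → ℝ} (hg : Integrable g m) {N : ℕ → S2 → S2}
    {N₀ : S2 → S2} (hN : ∀ n, Continuous (N n)) (hlim : ∀ x, Tendsto (fun n => N n x) atTop (𝓝 (N₀ x)))
    (i : Fin 3) :
    Tendsto (fun n => ∫ x, (N n x : E3) i * g x ∂m) atTop (𝓝 (∫ x, (N₀ x : E3) i * g x ∂m)) := by
  refine tendsto_integral_of_dominated_convergence (fun x => ‖g x‖) (fun n => ?_) hg.norm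
    (fun n => Eventually.of_forall fun x => ?_) (Eventually.of_forall fun x => ?_)
  · exact ((coordFun i).contMDiff.continuous.comp (hN n)).aestronglyMeasurable.mul hg.aestronglyMeasurable
  · rw [norm_mul]
    exact mul_le_of_le_one_left (norm_nonneg _) (abs_coord_le _ i)
  · exact ((((coordFun i).contMDiff.continuous).tendsto _).comp (hlim x)).mul_const _

variable {μ : Measure S2} [IsFiniteMeasure μ]

/-- Cauchy–Schwarz for the augmented form, applied to u_i and Θu_i and summed over i. By the
balancing hypotheses the pairings of u_i with 1 and ψ tend to 0 while those of Θu_i converge, so the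
rank one corrections disappear on the left and in the first factor on the right. There, what
survives is the energy of the map minus 2μ, with or without the weight Θ. Only pointwise convergence
of the maps and convergence of the three energy integrals are used, so N₀ may be a fold. -/
theorem augmented_limit {ψ : SmoothFun} {α β : ℝ} {h : S2 → ℝ}
    (hform : ∀ u ζ : SmoothFun, 0 ≤ augmented gradL2 (toL2 μ) oneFun ψ α β u u ∧
      augmented gradL2 (toL2 μ) oneFun ψ α β u ζ ^ 2 ≤ augmented gradL2 (toL2 μ) oneFun ψ α β u u
        * (3 * dirichlet ζ ζ + 8 * ∫ x, ζ x ^ 2 ∂μ))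
    (hh : Integrable h roundVolume) (hgreen : ∀ f : SmoothFun, dirichlet f ψ = ∫ x, f x * h x ∂roundVolume)
    {N : ℕ → S2 → S2} {N₀ : S2 → S2} (hN : ∀ n, ContMDiff (𝓡 2) (𝓡 2) ∞ (N n))
    (hlim : ∀ x, Tendsto (fun n => N n x) atTop (𝓝 (N₀ x)))
    (h1 : ∀ i, ∫ x, (N₀ x : E3) i ∂μ = 0)
    (h2 : ∀ i, ∫ x, (N₀ x : E3) i * h x ∂roundVolume = 2 * ∫ x, (N₀ x : E3) i * ψ x ∂μ)
    (Θ : SmoothFun) {E Λ K : ℝ}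
    (hE : Tendsto (fun n => ∫ x, energyDensity (N n) x ∂roundVolume) atTop (𝓝 E))
    (hΛ : Tendsto (fun n => ∫ x, Θ x * energyDensity (N n) x ∂roundVolume) atTop (𝓝 Λ))
    (hK : Tendsto (fun n => ∫ x, Θ x ^ 2 * energyDensity (N n) x ∂roundVolume) atTop (𝓝 K)) :
    0 ≤ E - 2 * μ.real univ ∧ (Λ - 2 * ∫ x, Θ x ∂μ) ^ 2 ≤
      (E - 2 * μ.real univ) * (3 * (K + dirichlet Θ Θ) + 8 * ∫ x, Θ x ^ 2 ∂μ) := by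
  let u : ℕ → Fin 3 → SmoothFun := fun n i => (coordFun i).compMap (N n) (hN n)
  let ζ : ℕ → Fin 3 → SmoothFun := fun n i => u n i * Θ
  have hNc : ∀ n, Continuous (N n) := fun n => (hN n).continuous
  have hu : ∀ n i x, u n i x = (N n x : E3) i := fun _ _ _ => rfl
  have hζ : ∀ n i x, ζ n i x = (N n x : E3) i * Θ x := fun _ _ _ => rfl
  have hψ : Continuous ψ := ψ.contMDiff.continuous
  have hΘ : Continuous Θ := Θ.contMDiff.continuous
  have hQ1 : ∀ f : SmoothFun, excess gradL2 (toL2 μ) f oneFun = -2 * ∫ x, f x ∂μ := fun f => by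
    rw [excess, gradL2_oneFun, inner_zero_right, inner_toL2]
    simp
  have hQψ : ∀ f : SmoothFun, excess gradL2 (toL2 μ) f ψ
      = ∫ x, f x * h x ∂roundVolume - 2 * ∫ x, f x * ψ x ∂μ := fun f => by
    rw [excess_eq, hgreen]
  have lu1 : ∀ i, Tendsto (fun n => excess gradL2 (toL2 μ) (u n i) oneFun) atTop (𝓝 0) := fun i => by
    have := (tendsto_integral_coord (integrable_const (1 : ℝ) (μ := μ)) hNc hlim i).const_mul (-2)
    simp only [mul_one, h1, mul_zero] at this
    simpa only [hQ1, hu] using this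
  have luψ : ∀ i, Tendsto (fun n => excess gradL2 (toL2 μ) (u n i) ψ) atTop (𝓝 0) := fun i => by
    have := (tendsto_integral_coord hh hNc hlim i).sub
      ((tendsto_integral_coord (integrable_of_continuous μ hψ) hNc hlim i).const_mul 2)
    rw [h2, sub_self] at this
    simpa only [hQψ, hu] using this
  have lζ1 : ∀ i, ∃ c, Tendsto (fun n => excess gradL2 (toL2 μ) (ζ n i) oneFun) atTop (𝓝 c) := fun i => by
    have := (tendsto_integral_coord (integrable_of_continuous μ hΘ) hNc hlim i).const_mul (-2)
    exact ⟨_, this.congr fun n => by simp only [hQ1, hζ]⟩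
  have lζψ : ∀ i, ∃ c, Tendsto (fun n => excess gradL2 (toL2 μ) (ζ n i) ψ) atTop (𝓝 c) := fun i => by
    have hΘh : Integrable (fun x => Θ x * h x) roundVolume := by
      obtain ⟨C, hC⟩ := isCompact_univ.exists_bound_of_continuousOn hΘ.continuousOn
      exact hh.bdd_mul hΘ.aestronglyMeasurable (Eventually.of_forall fun x => hC x trivial)
    have := (tendsto_integral_coord hΘh hNc hlim i).sub
      ((tendsto_integral_coord (integrable_of_continuous μ (hΘ.mul hψ)) hNc hlim i).const_mul 2)
    exact ⟨_, this.congr fun n => by simp only [hQψ, hζ, mul_assoc, Pi.mul_apply]⟩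
  choose c1 hc1 using lζ1
  choose cψ hcψ using lζψ
  have huu : ∀ n, ∑ i, excess gradL2 (toL2 μ) (u n i) (u n i)
      = ∫ x, energyDensity (N n) x ∂roundVolume - 2 * μ.real univ := fun n => by
    simp only [excess_eq, Finset.sum_sub_distrib, ← Finset.mul_sum]
    congr 1
    · exact sum_dirichlet_coordFun (hN n)
    · rw [show ∑ i, ∫ x, u n i x * u n i x ∂μ = ∫ x, ∑ i, u n i x * u n i x ∂μ from
        (integral_finsetSum _ fun i _ => integrable_of_continuous μ
          ((u n i).contMDiff.continuous.mul (u n i).contMDiff.continuous)).symm]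
      have : ∀ x, ∑ i, u n i x * u n i x = 1 := fun x => by
        simp only [hu, ← sq]
        exact sum_coord_sq (N n x)
      simp [this]
  have huζ : ∀ n, ∑ i, excess gradL2 (toL2 μ) (u n i) (ζ n i)
      = ∫ x, Θ x * energyDensity (N n) x ∂roundVolume - 2 * ∫ x, Θ x ∂μ := fun n => by
    simp only [excess_eq, Finset.sum_sub_distrib, ← Finset.mul_sum]
    congr 1
    · exact dirichlet_mul_right (hN n) Θ
    · rw [show ∑ i, ∫ x, u n i x * ζ n i x ∂μ = ∫ x, ∑ i, u n i x * ζ n i x ∂μ from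
        (integral_finsetSum _ fun i _ => integrable_of_continuous μ
          ((u n i).contMDiff.continuous.mul (ζ n i).contMDiff.continuous)).symm]
      have : ∀ x, ∑ i, u n i x * ζ n i x = Θ x := fun x => by
        simp only [hu, hζ, ← mul_assoc, ← sq]
        rw [← Finset.sum_mul, sum_coord_sq, one_mul]
      simp only [this]
  have hζζ : ∀ n, ∑ i, (3 * dirichlet (ζ n i) (ζ n i) + 8 * ∫ x, ζ n i x ^ 2 ∂μ)
      = 3 * (∫ x, Θ x ^ 2 * energyDensity (N n) x ∂roundVolume + dirichlet Θ Θ)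
        + 8 * ∫ x, Θ x ^ 2 ∂μ := fun n => by
    rw [Finset.sum_add_distrib, ← Finset.mul_sum, ← Finset.mul_sum]
    congr 2
    · exact dirichlet_mul_mul (hN n) Θ
    · rw [show ∑ i, ∫ x, ζ n i x ^ 2 ∂μ = ∫ x, ∑ i, ζ n i x ^ 2 ∂μ from
        (integral_finsetSum _ fun i _ => integrable_of_continuous μ
          ((ζ n i).contMDiff.continuous.pow 2)).symm]
      have : ∀ x, ∑ i, ζ n i x ^ 2 = Θ x ^ 2 := fun x => by
        simp only [hζ, mul_pow]
        rw [← Finset.sum_mul, sum_coord_sq, one_mul]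
      simp only [this]
  have lB : Tendsto (fun n => ∑ i, augmented gradL2 (toL2 μ) oneFun ψ α β (u n i) (u n i)) atTop
      (𝓝 (E - 2 * μ.real univ)) := by
    have h3 := ((hE.sub_const (2 * μ.real univ)).add (tendsto_finsetSum Finset.univ fun i _ =>
      ((lu1 i).mul (lu1 i)).const_mul α)).add (tendsto_finsetSum Finset.univ fun i _ =>
      ((luψ i).mul (luψ i)).const_mul β)
    simp only [mul_zero, Finset.sum_const_zero, add_zero] at h3
    refine h3.congr fun n => ?_
    rw [← huu, ← Finset.sum_add_distrib, ← Finset.sum_add_distrib]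
    rfl
  have lC : Tendsto (fun n => ∑ i, augmented gradL2 (toL2 μ) oneFun ψ α β (u n i) (ζ n i)) atTop
      (𝓝 (Λ - 2 * ∫ x, Θ x ∂μ)) := by
    have h3 := ((hΛ.sub_const (2 * ∫ x, Θ x ∂μ)).add (tendsto_finsetSum Finset.univ fun i _ =>
      ((lu1 i).mul (hc1 i)).const_mul α)).add (tendsto_finsetSum Finset.univ fun i _ =>
      ((luψ i).mul (hcψ i)).const_mul β)
    simp only [zero_mul, mul_zero, Finset.sum_const_zero, add_zero] at h3
    refine h3.congr fun n => ?_
    rw [← huζ, ← Finset.sum_add_distrib, ← Finset.sum_add_distrib]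
    rfl
  have lD := ((hK.add_const (dirichlet Θ Θ)).const_mul 3).add_const (8 * ∫ x, Θ x ^ 2 ∂μ)
  refine ⟨ge_of_tendsto' lB fun n => Finset.sum_nonneg fun i _ => (hform _ (u n i)).1, ?_⟩
  refine le_of_tendsto_of_tendsto' (lC.pow 2) (lB.mul lD) fun n => ?_
  rw [← hζζ]
  refine Finset.sum_sq_le_sum_mul_sum_of_sq_le_mul _ (fun i _ => (hform _ (u n i)).1) (fun i _ => ?_)
    fun i _ => (hform _ _).2
  have h4 : 0 ≤ dirichlet (ζ n i) (ζ n i) := integral_nonneg fun x => by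
    simp only [real_inner_self_eq_norm_sq]; positivity
  have h5 : 0 ≤ ∫ x, ζ n i x ^ 2 ∂μ := integral_nonneg fun x => sq_nonneg _
  positivity

end Limit

/-! ### The stability inequality for smooth test functions -/

section Estimate

open Set Filter Topology

/-- Möbius transformations take caps to caps: multiplying by ‖mob w y − w‖² turns the affine
inequality in y into an affine one in `mob w y`. -/
lemma exists_halfspace_mob {w : E3} (hw : ‖w‖ < 1) (a : E3) (β : ℝ) :
    ∃ (a' : E3) (β' : ℝ), ∀ y : S2, ⟪a', mob w y⟫_ℝ ≤ β' ↔ ⟪a, (y : E3)⟫_ℝ ≤ β := by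
  set k := -⟪a, w⟫_ℝ - β with hk
  refine ⟨(1 - ‖w‖ ^ 2) • a - (2 * k) • w, (1 - ‖w‖ ^ 2) * ⟪a, w⟫_ℝ - k * (1 + ‖w‖ ^ 2), fun y => ?_⟩
  have hz : ‖mob w y‖ = 1 := norm_mob hw (by simp)
  have hy : mob (-w) (mob w y) = y := mob_neg_mob hw (by simp)
  have hw' : ‖-w‖ < 1 := by rwa [norm_neg]
  set z := mob w y
  have hpos := norm_add_sq_pos hw' hz
  have hsq : ‖z + -w‖ ^ 2 = 1 - 2 * ⟪z, w⟫_ℝ + ‖w‖ ^ 2 := by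
    rw [norm_add_sq_of_norm hz, inner_neg_right, norm_neg]; ring
  have h1 : ⟪a, (y : E3)⟫_ℝ * ‖z + -w‖ ^ 2
      = -⟪a, w⟫_ℝ * ‖z + -w‖ ^ 2 + (1 - ‖w‖ ^ 2) * (⟪a, z⟫_ℝ - ⟪a, w⟫_ℝ) := by
    rw [← hy, mob, inner_add_right, inner_smul_right, inner_neg_right, inner_add_right,
      inner_neg_right, norm_neg, add_mul, mul_right_comm, div_mul_cancel₀ _ hpos.ne']
    ring
  rw [show ⟪a, (y : E3)⟫_ℝ ≤ β ↔ ⟪a, (y : E3)⟫_ℝ * ‖z + -w‖ ^ 2 ≤ β * ‖z + -w‖ ^ 2 from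
    (mul_le_mul_iff_left₀ hpos).symm, h1, hsq, inner_sub_left, real_inner_smul_left, real_inner_smul_left,
    real_inner_comm z w]
  constructor <;> intro h <;> linarith [show (k : ℝ) = -⟪a, w⟫_ℝ - β from hk,
    show k * (1 - 2 * ⟪z, w⟫_ℝ + ‖w‖ ^ 2) = (-⟪a, w⟫_ℝ - β) * (1 - 2 * ⟪z, w⟫_ℝ + ‖w‖ ^ 2) by rw [hk]]

/-! ### Energy and caps under one and two Möbius transformations -/

section MobMob

variable {w a : E3} (hw : ‖w‖ < 1) (ha : ‖a‖ < 1)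

lemma energyDensity_mobS (x : S2) : energyDensity (mobS w hw) x = (lor w x)⁻¹ ^ 2 * 2 := by
  have h := energyDensity_comp_mobS contMDiff_id hw x
  rwa [energyDensity_id, Function.id_comp] at h

lemma integral_energyDensity_mobS : ∫ x, energyDensity (mobS w hw) x ∂roundVolume = 8 * Real.pi := by
  simp only [energyDensity_mobS]
  rw [integral_comp_mobS hw (g := fun _ => 2) measurable_const, integral_const, roundVolume_real_univ,
    smul_eq_mul]
  ring

lemma contMDiff_mobS_comp : ContMDiff (𝓡 2) (𝓡 2) ∞ (mobS w hw ∘ mobS a ha) :=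
  (contMDiff_mobS hw).comp (contMDiff_mobS ha)

lemma integral_comp_mul_energyDensity {g : S2 → ℝ} (hg : Measurable g) :
    ∫ y, g (mobS w hw (mobS a ha y)) * energyDensity (mobS w hw ∘ mobS a ha) y ∂roundVolume
      = 2 * ∫ z, g z ∂roundVolume := by
  have hm : Measurable (mobS w hw) := (contMDiff_mobS hw).continuous.measurable
  have h1 : Measurable fun z : S2 => (lor w z)⁻¹ ^ 2 * (2 * g (mobS w hw z)) :=
    (continuous_lor.measurable.inv.pow_const 2).mul ((hg.comp hm).const_mul 2)
  rw [← integral_const_mul, ← integral_comp_mobS hw (hg.const_mul 2), ← integral_comp_mobS ha h1]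
  refine integral_congr_ae (Eventually.of_forall fun y => ?_)
  simp only
  rw [energyDensity_comp_mobS (contMDiff_mobS hw) ha, energyDensity_mobS]
  ring

lemma exists_halfspace_mobS_comp (p : E3) : ∃ (a' : E3) (β' : ℝ), ∀ y : S2,
    ⟪a', (mobS w hw (mobS a ha y) : E3)⟫_ℝ ≤ β' ↔ ⟪p, (y : E3)⟫_ℝ ≤ 0 := by
  obtain ⟨a₁, β₁, h₁⟩ := exists_halfspace_mob ha p 0
  obtain ⟨a₂, β₂, h₂⟩ := exists_halfspace_mob hw a₁ β₁
  exact ⟨a₂, β₂, fun y => (h₂ (mobS a ha y)).trans (h₁ y)⟩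

end MobMob

/-- The lower hemisphere is moved to the upper one by the measure preserving reflection; the great
circle between them is null. -/
lemma integral_mul_comp_hfoldS (p : S2) {f e : S2 → ℝ} (hf : Continuous f) (he : Continuous e) :
    ∫ y, f y * e (hfoldS p y) ∂roundVolume = ∫ y in {y : S2 | 0 < ⟪(p : E3), y⟫_ℝ}, f y * e y ∂roundVolume
      + ∫ y in {y : S2 | 0 < ⟪(p : E3), y⟫_ℝ}, f (reflS p y) * e y ∂roundVolume := by
  have hp : ‖(p : E3)‖ = 1 := by simp
  have hc : Continuous fun y : S2 => ⟪(p : E3), y⟫_ℝ := by fun_prop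
  set P := {y : S2 | 0 < ⟪(p : E3), y⟫_ℝ} with hP
  have hPm : MeasurableSet P := (isOpen_lt continuous_const hc).measurableSet
  have hi : Integrable (fun y => f y * e (hfoldS p y)) roundVolume :=
    integrable_of_continuous _ (hf.mul (he.comp (continuous_hfoldS p)))
  rw [← integral_add_compl hPm hi]
  congr 1
  · refine setIntegral_congr_fun hPm fun y hy => ?_
    have : hfoldS p y = y := Subtype.ext (hfold_of_nonneg (le_of_lt hy))
    simp only [this]
  · have hemb : MeasurableEmbedding (reflS p) :=
      (continuous_reflS p).measurableEmbedding (Function.LeftInverse.injective (reflS_reflS p))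
    have hin : ∀ y : S2, ⟪(p : E3), (reflS p y : E3)⟫_ℝ = -⟪(p : E3), y⟫_ℝ := fun y => by
      rw [coe_reflS, refl_apply hp, inner_sub_right, real_inner_smul_right, real_inner_self_eq_norm_sq, hp]
      ring
    have h1 : ∫ y in Pᶜ, f y * e (hfoldS p y) ∂roundVolume
        = ∫ y in Pᶜ, f (reflS p (reflS p y)) * e (reflS p y) ∂roundVolume := by
      refine setIntegral_congr_fun hPm.compl fun y hy => ?_
      have : hfoldS p y = reflS p y := Subtype.ext (hfold_of_nonpos hp (not_lt.1 hy))
      simp only [this, reflS_reflS]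
    have h2 : Pᶜ = reflS p ⁻¹' {y : S2 | 0 ≤ ⟪(p : E3), y⟫_ℝ} := by
      ext y
      simp only [hP, mem_compl_iff, mem_ofPred_eq, mem_preimage, hin, not_lt, Left.nonneg_neg_iff]
    rw [h1, h2, (measurePreserving_reflS (p : E3)).setIntegral_preimage_emb hemb
      (fun y => f (reflS p y) * e y)]
    refine setIntegral_congr_set ?_
    have hae : ∀ᵐ y : S2 ∂roundVolume, ⟪(p : E3), y⟫_ℝ ≠ 0 := by
      rw [ae_iff]
      simpa using roundVolume_equator (coe_ne_zero p)
    filter_upwards [hae] with y hy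
    exact propext ⟨fun h => lt_of_le_of_ne h (Ne.symm hy), le_of_lt⟩

/-- Energy and first moments of the fold of a conformal map `M`, in terms of the area `A` of the cap
`M {⟪p, y⟫ ≤ 0}`. -/
theorem abs_integral_sub_le {e : S2 → ℝ} (he : Continuous e) (he0 : ∀ y, 0 ≤ e y) {M : S2 → S2}
    (hM : Continuous M) (hMe : ∀ g : S2 → ℝ, Measurable g →
      ∫ y, g (M y) * e y ∂roundVolume = 2 * ∫ z, g z ∂roundVolume)
    {p : S2} {a' : E3} {β' : ℝ} (hcap : ∀ y : S2, ⟪a', (M y : E3)⟫_ℝ ≤ β' ↔ ⟪(p : E3), (y : E3)⟫_ℝ ≤ 0)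
    {A : ℝ} (hA : A = roundVolume.real {z : S2 | ⟪a', (z : E3)⟫_ℝ ≤ β'}) :
    ∫ y, e (hfoldS p y) ∂roundVolume = 16 * Real.pi - 4 * A ∧
    ∀ φ : S2 → ℝ, Continuous φ → (∀ x, |φ x| ≤ 1) →
      ∫ y, φ (M y) ^ 2 * e (hfoldS p y) ∂roundVolume ≤ 16 * Real.pi ∧
      ∀ L : ℝ, 0 ≤ L → (∀ x y : S2, |φ x - φ y| ≤ L * ‖(x : E3) - y‖) →
        |∫ y, φ (M y) * e (hfoldS p y) ∂roundVolume
          - (2 * ∫ z, φ z ∂roundVolume + 8 * Real.pi * φ (M (-p)))|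
          ≤ 4 * A + 8 * Real.pi * (L * (16 * √A)) := by
  have hp : ‖(p : E3)‖ = 1 := by simp
  have hc : Continuous fun y : S2 => ⟪(p : E3), y⟫_ℝ := by fun_prop
  have hsplit := fun {f : S2 → ℝ} (hf : Continuous f) => integral_mul_comp_hfoldS p hf he
  set P := {y : S2 | 0 < ⟪(p : E3), y⟫_ℝ} with hP
  have hPm : MeasurableSet P := (isOpen_lt continuous_const hc).measurableSet
  set C := {z : S2 | ⟪a', (z : E3)⟫_ℝ ≤ β'} with hC
  have hCm : MeasurableSet C := by
    have : Continuous fun z : S2 => ⟪a', (z : E3)⟫_ℝ := by fun_prop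
    exact (isClosed_le this continuous_const).measurableSet
  have hPC : ∀ y, M y ∈ C ↔ y ∈ Pᶜ := fun y => by
    simp only [hC, hP, mem_ofPred_eq, mem_compl_iff, not_lt, hcap]
  have hA0 : 0 ≤ A := hA ▸ measureReal_nonneg
  have ie : Integrable e roundVolume := integrable_of_continuous _ he
  have htot : ∫ y, e y ∂roundVolume = 8 * Real.pi := by
    have := hMe (fun _ => 1) measurable_const
    simp only [one_mul, integral_const, roundVolume_real_univ, smul_eq_mul, mul_one] at this
    linarith
  -- The density `e` is carried by M to 2 dv, and M carries the folded hemisphere to the cap of area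
  -- A.
  have hPc : ∫ y in Pᶜ, e y ∂roundVolume = 2 * A := by
    have h1 := hMe (C.indicator 1) (measurable_one.indicator hCm)
    rw [integral_indicator_one hCm, ← hA] at h1
    rw [← h1, ← integral_indicator hPm.compl]
    refine integral_congr_ae (Eventually.of_forall fun y => ?_)
    by_cases hy : y ∈ Pᶜ
    · simp only [indicator_of_mem hy, indicator_of_mem ((hPC y).2 hy), Pi.one_apply, one_mul]
    · simp only [indicator_of_notMem hy, indicator_of_notMem (fun h => hy ((hPC y).1 h)), zero_mul]
  have hPe : ∫ y in P, e y ∂roundVolume = 8 * Real.pi - 2 * A := by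
    have := integral_add_compl hPm ie
    linarith
  refine ⟨?_, fun φ hφ hφ1 => ⟨?_, fun L hL hLip => ?_⟩⟩
  · have := hsplit (f := fun _ => 1) continuous_const
    simp only [one_mul, hPe] at this
    linarith
  · rw [hsplit (f := fun y => φ (M y) ^ 2) ((hφ.comp hM).pow 2)]
    have hle : ∀ f : S2 → S2, Continuous f →
        ∫ y in P, φ (M (f y)) ^ 2 * e y ∂roundVolume ≤ ∫ y in P, e y ∂roundVolume := fun f hf => by
      refine setIntegral_mono (integrable_of_continuous _
        (((hφ.comp (hM.comp hf)).pow 2).mul he)).integrableOn ie.integrableOn fun y => ?_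
      have : φ (M (f y)) ^ 2 ≤ 1 := (sq_le_one_iff_abs_le_one _).2 (hφ1 _)
      exact mul_le_of_le_one_left (he0 y) this
    have h1 := hle id continuous_id
    have h2 := hle _ (continuous_reflS p)
    simp only [id] at h1
    linarith
  -- The unfolded half gives 2∫φ dv up to the cap, an error of at most 2A. The reflected half is a
  -- mass 8π − 2A inside the cap, whose diameter is at most 16√A; completing it to 8π costs another
  -- 2A.
  · have hφM : Continuous fun y => φ (M y) := hφ.comp hM
    have i1 : Integrable (fun y => φ (M y) * e y) roundVolume := integrable_of_continuous _ (hφM.mul he)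
    have i2 : Integrable (fun y => φ (M (reflS p y)) * e y) roundVolume :=
      integrable_of_continuous _ ((hφM.comp (continuous_reflS p)).mul he)
    have i3 : Integrable (fun y => φ (M (-p)) * e y) roundVolume := ie.const_mul _
    rw [hsplit hφM]
    have h1 := integral_add_compl hPm i1
    rw [hMe φ hφ.measurable] at h1
    have h2 : |∫ y in Pᶜ, φ (M y) * e y ∂roundVolume| ≤ 2 * A := by
      rw [← hPc, ← Real.norm_eq_abs]
      refine (norm_integral_le_integral_norm _).trans ?_
      refine setIntegral_mono i1.norm.integrableOn ie.integrableOn fun y => ?_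
      simp only [norm_mul, Real.norm_eq_abs, abs_of_nonneg (he0 y)]
      exact mul_le_of_le_one_left (he0 y) (hφ1 _)
    have hd : ∀ y ∈ P, |φ (M (reflS p y)) - φ (M (-p))| ≤ L * (16 * √A) := fun y hy => by
      refine (hLip _ _).trans (mul_le_mul_of_nonneg_left ?_ hL)
      have hin1 : ⟪(p : E3), (reflS p y : E3)⟫_ℝ ≤ 0 := by
        rw [coe_reflS, refl_apply hp, inner_sub_right, real_inner_smul_right,
          real_inner_self_eq_norm_sq, hp]
        have : 0 < ⟪(p : E3), (y : E3)⟫_ℝ := hy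
        linarith
      have hin2 : ⟪(p : E3), ((-p : S2) : E3)⟫_ℝ ≤ 0 := by
        rw [show ((-p : S2) : E3) = -(p : E3) from rfl, inner_neg_right, real_inner_self_eq_norm_sq, hp]
        norm_num
      have h3 := cap_area_ge ((hcap _).2 hin1) ((hcap _).2 hin2)
      rw [← hC, ← hA] at h3
      rw [show (16 : ℝ) * √A = √(256 * A) by
        rw [Real.sqrt_mul (by norm_num), show (256 : ℝ) = 16 ^ 2 by norm_num, Real.sqrt_sq (by norm_num)]]
      exact Real.le_sqrt_of_sq_le h3
    have h4 : |∫ y in P, (φ (M (reflS p y)) - φ (M (-p))) * e y ∂roundVolume|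
        ≤ 8 * Real.pi * (L * (16 * √A)) := by
      have h5 : |∫ y in P, (φ (M (reflS p y)) - φ (M (-p))) * e y ∂roundVolume|
          ≤ ∫ y in P, L * (16 * √A) * e y ∂roundVolume := by
        rw [← Real.norm_eq_abs]
        refine (norm_integral_le_integral_norm _).trans ?_
        have i4 : Integrable (fun y => (φ (M (reflS p y)) - φ (M (-p))) * e y) roundVolume := by
          simp only [sub_mul]; exact i2.sub i3
        refine setIntegral_mono_on i4.norm.integrableOn (ie.const_mul _).integrableOn hPm fun y hy => ?_
        rw [norm_mul, Real.norm_eq_abs, Real.norm_eq_abs, abs_of_nonneg (he0 y)]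
        exact mul_le_mul_of_nonneg_right (hd y hy) (he0 y)
      refine h5.trans ?_
      rw [integral_const_mul, hPe, mul_comm]
      refine mul_le_mul_of_nonneg_right (by linarith) (by positivity)
    have h6 : ∫ y in P, (φ (M (reflS p y)) - φ (M (-p))) * e y ∂roundVolume
        = ∫ y in P, φ (M (reflS p y)) * e y ∂roundVolume - φ (M (-p)) * (8 * Real.pi - 2 * A) := by
      simp only [sub_mul]
      rw [integral_sub i2.integrableOn i3.integrableOn, integral_const_mul, hPe]
    have h7 : |2 * A * φ (M (-p))| ≤ 2 * A := by
      rw [abs_mul, abs_of_nonneg (by positivity : 0 ≤ 2 * A)]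
      exact mul_le_of_le_one_right (by positivity) (hφ1 _)
    rw [abs_le] at h2 h4 h7 ⊢
    constructor <;> linarith [h2.1, h2.2, h4.1, h4.2, h7.1, h7.2]

end Estimate

/-! ### Lipschitz functions on the sphere -/

section Lipschitz

open Set Filter Topology Convolution

lemma norm_dirS_sub_le {a : E3} (ha : 1 / 2 ≤ ‖a‖) (b : E3) :
    ‖(dirS a : E3) - dirS b‖ ≤ 4 * ‖a - b‖ := by
  have ha0 : 0 < ‖a‖ := by linarith
  have h1 : ‖a‖ • ((dirS a : E3) - dirS b) = (a - b) + (‖b‖ - ‖a‖) • (dirS b : E3) := by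
    rw [smul_sub, sub_smul, norm_smul_dirS, norm_smul_dirS]; abel
  have h2 : ‖a‖ * ‖(dirS a : E3) - dirS b‖ ≤ 2 * ‖a - b‖ := by
    calc ‖a‖ * ‖(dirS a : E3) - dirS b‖ = ‖(a - b) + (‖b‖ - ‖a‖) • (dirS b : E3)‖ := by
          rw [← h1, norm_smul, norm_norm]
      _ ≤ ‖a - b‖ + ‖(‖b‖ - ‖a‖) • (dirS b : E3)‖ := norm_add_le _ _
      _ ≤ ‖a - b‖ + ‖a - b‖ := by
          rw [norm_smul, norm_eq_of_mem_sphere, mul_one, Real.norm_eq_abs, norm_sub_rev a b]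
          exact add_le_add_right (abs_norm_sub_norm_le b a) _
      _ = _ := by ring
  nlinarith [norm_nonneg ((dirS a : E3) - dirS b)]

lemma dirS_coe (x : S2) : dirS (x : E3) = x := by
  have := dirS_smul one_pos x
  rwa [one_smul] at this

lemma radialExt_eq_dirS (f : S2 → ℝ) {y : E3} (hy : y ≠ 0) : radialExt f y = f (dirS y) := by
  rw [radialExt, dif_neg hy, dirS, dif_neg hy]

lemma norm_sphGrad_le_of_lipschitz {f : S2 → ℝ} (hf : ContMDiff (𝓡 2) 𝓘(ℝ, ℝ) 1 f) {L : ℝ}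
    (hL : 0 ≤ L) (h : ∀ x y : S2, |f x - f y| ≤ L * ‖(x : E3) - y‖) (x : S2) : ‖sphGrad f x‖ ≤ 4 * L := by
  rw [sphGrad, gradient, LinearIsometryEquiv.norm_map]
  refine (differentiableAt_radialExt hf x).hasFDerivAt.le_of_lip' (by positivity) ?_
  filter_upwards [isOpen_compl_singleton.mem_nhds (coe_ne_zero x)] with y hy
  rw [radialExt_eq_dirS f hy, radialExt_coe]
  refine (h _ _).trans ?_
  have h1 := norm_dirS_sub_le (a := (x : E3)) (by rw [norm_eq_of_mem_sphere]; norm_num) y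
  rw [dirS_coe, norm_sub_rev, norm_sub_rev (x : E3)] at h1
  nlinarith

/-- Points at distance at least 1/2 are handled by |f| ≤ 1. For nearer points the segment stays
outside the ball of radius 1/2, where the radial extension has gradient at most 2. -/
lemma lipschitz_of_norm_sphGrad_le {f : S2 → ℝ} (hf : ContMDiff (𝓡 2) 𝓘(ℝ, ℝ) 1 f)
    (h1 : ∀ x, |f x| ≤ 1) (h2 : ∀ x, ‖sphGrad f x‖ ≤ 1) (x y : S2) :
    |f x - f y| ≤ 4 * ‖(x : E3) - y‖ := by
  rcases lt_or_ge ‖(x : E3) - y‖ (1 / 2) with h | h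
  · have hball : ∀ z ∈ Metric.ball (x : E3) (1 / 2), 1 / 2 ≤ ‖z‖ := fun z hz => by
      rw [mem_ball_iff_norm'] at hz
      have := norm_sub_norm_le (x : E3) z
      rw [norm_eq_of_mem_sphere] at this
      linarith
    have hz0 : ∀ z ∈ Metric.ball (x : E3) (1 / 2), z ≠ 0 := fun z hz h0 => by
      have := hball z hz
      rw [h0, norm_zero] at this
      linarith
    have h3 := (convex_ball (x : E3) (1 / 2)).norm_image_sub_le_of_norm_fderiv_le (𝕜 := ℝ)
      (f := radialExt f) (C := 2) (x := y) (y := x)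
      (fun z hz => (contDiffAt_radialExt hf (hz0 z hz)).differentiableAt (by simp)) (fun z hz => ?_)
      (by rwa [mem_ball_iff_norm']) (Metric.mem_ball_self (by norm_num))
    · rw [radialExt_coe, radialExt_coe, Real.norm_eq_abs] at h3
      linarith [norm_nonneg ((x : E3) - y)]
    · have hz := hball z hz
      have hpos : 0 < ‖z‖ := by linarith
      rw [← norm_smul_dirS z, fderiv_radialExt_smul hf hpos, norm_smul, norm_inv, norm_norm]
      have h4 : ‖fderiv ℝ (radialExt f) (dirS z : E3)‖ ≤ 1 := by
        have := h2 (dirS z)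
        rwa [sphGrad, gradient, LinearIsometryEquiv.norm_map] at this
      have h5 : ‖z‖⁻¹ ≤ 2 := by
        rw [inv_le_comm₀ hpos two_pos]; linarith
      calc ‖z‖⁻¹ * ‖fderiv ℝ (radialExt f) (dirS z : E3)‖ ≤ 2 * 1 :=
            mul_le_mul h5 h4 (norm_nonneg _) two_pos.le
        _ = 2 := mul_one 2
  · have := abs_sub (f x) (f y)
    linarith [h1 x, h1 y]

/-- The mollification of a bounded Lipschitz function on the sphere. -/
theorem exists_smooth_lipschitz_approx {φ : S2 → ℝ} (hφ : Continuous φ) (h1 : ∀ x, |φ x| ≤ 1) {L : ℝ}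
    (hL : 0 ≤ L) (hlip : ∀ x y : S2, |φ x - φ y| ≤ L * ‖(x : E3) - y‖) {η : ℝ} (hη : 0 < η) :
    ∃ f : SmoothFun, (∀ x, |f x| ≤ 1) ∧ (∀ x y : S2, |f x - f y| ≤ 4 * L * ‖(x : E3) - y‖) ∧
      ∀ x, |f x - φ x| ≤ η := by
  -- The bound 1/2 keeps x − t in the region where the radial projection is controlled with factor
  -- 4; the other bound makes the uniform error 4Lr at most η.
  set r : ℝ := min (1 / 2) (η / (4 * L + 1)) with hr
  have hr0 : 0 < r := by positivity
  have hr2 : r ≤ 1 / 2 := min_le_left _ _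
  have hrη : 4 * L * r ≤ η := by
    have h : r ≤ η / (4 * L + 1) := min_le_right _ _
    rw [le_div_iff₀ (by positivity)] at h
    nlinarith
  let b : ContDiffBump (0 : E3) := ⟨r / 2, r, by positivity, by linarith⟩
  set k : E3 → ℝ := b.normed volume with hk
  set g : E3 → ℝ := fun y => φ (dirS y) with hg
  have hgm : Measurable g := hφ.measurable.comp measurable_dirS
  have hki : Integrable k := b.integrable_normed
  have hk0 : ∀ t, 0 ≤ k t := b.nonneg_normed
  have hkout : ∀ t, t ∉ Metric.ball (0 : E3) r → k t = 0 := fun t ht => by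
    have : t ∉ Function.support k := by rw [hk, b.support_normed_eq]; exact ht
    simpa using this
  have hint : ∀ x : E3, Integrable fun t => k t * g (x - t) := fun x =>
    hki.mul_bdd (c := 1) (hgm.comp (measurable_const.sub measurable_id)).aestronglyMeasurable
      (Eventually.of_forall fun t => h1 _)
  have hest : ∀ (G : E3 → ℝ) (C : ℝ), (∀ t ∈ Metric.ball (0 : E3) r, |G t| ≤ C) →
      |∫ t, k t * G t| ≤ C := fun G C hG => by
    rw [← Real.norm_eq_abs]
    have : ∫ t, k t * C = C := by rw [integral_mul_const, b.integral_normed, one_mul]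
    rw [← this]
    refine norm_integral_le_of_norm_le (hki.mul_const C) (Eventually.of_forall fun t => ?_)
    by_cases ht : t ∈ Metric.ball (0 : E3) r
    · rw [norm_mul, Real.norm_eq_abs, abs_of_nonneg (hk0 t)]
      exact mul_le_mul_of_nonneg_left (hG t ht) (hk0 t)
    · simp [hkout t ht]
  have hsm : ContDiff ℝ ∞ fun x : E3 => ∫ t, k t * g (x - t) := by
    have hloc : LocallyIntegrable g := (locallyIntegrable_const (1 : ℝ)).mono hgm.aestronglyMeasurable
      (Eventually.of_forall fun y => by simpa using h1 (dirS y))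
    exact b.hasCompactSupport_normed.contDiff_convolution_left (ContinuousLinearMap.lsmul ℝ ℝ)
      b.contDiff_normed hloc
  have hnorm : ∀ (x : S2), ∀ t ∈ Metric.ball (0 : E3) r, 1 / 2 < ‖(x : E3) - t‖ := fun x t ht => by
    rw [mem_ball_zero_iff] at ht
    have := norm_sub_norm_le (x : E3) t
    rw [norm_eq_of_mem_sphere] at this
    linarith
  refine ⟨SmoothFun.ofRestrict _ fun x => hsm.contDiffAt, fun x => hest _ _ fun t _ => h1 _,
    fun x y => ?_, fun x => ?_⟩
  · change |(∫ t, k t * g (x - t)) - ∫ t, k t * g (y - t)| ≤ _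
    rw [← integral_sub (hint x) (hint y)]
    simp only [← mul_sub]
    refine hest _ _ fun t ht => (hlip _ _).trans ?_
    have h2 := norm_dirS_sub_le (hnorm x t ht).le (y - t)
    rw [sub_sub_sub_cancel_right] at h2
    nlinarith
  · change |(∫ t, k t * g (x - t)) - φ x| ≤ _
    have h2 : φ x = ∫ t, k t * φ x := by rw [integral_mul_const, b.integral_normed, one_mul]
    rw [h2, ← integral_sub (hint x) (hki.mul_const _)]
    simp only [← mul_sub]
    refine hest _ _ fun t ht => (hlip _ _).trans ?_
    have h3 := norm_dirS_sub_le (hnorm x t ht).le x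
    rw [dirS_coe, sub_sub_cancel_left, norm_neg] at h3
    rw [mem_ball_zero_iff] at ht
    nlinarith

end Lipschitz

/-! ### Stability -/

section Stability

open Set Filter Topology

variable {μ : Measure S2} [IsFiniteMeasure μ]

lemma integral_smul_coord {m : Measure S2} {g : S2 → ℝ} (hg : Integrable g m) {N : S2 → S2}
    (hN : Measurable N) (i : Fin 3) :
    (∫ x, g x • (N x : E3) ∂m) i = ∫ x, (N x : E3) i * g x ∂m := by
  have hi : Integrable (fun x => g x • (N x : E3)) m := by
    refine hg.norm.mono' (hg.aestronglyMeasurable.smul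
      (measurable_subtype_coe.comp hN).aestronglyMeasurable) (Eventually.of_forall fun x => ?_)
    simp [norm_smul]
  have h := (EuclideanSpace.proj (𝕜 := ℝ) i).integral_comp_comm hi
  refine h.symm.trans (integral_congr_ae (Eventually.of_forall fun x => ?_))
  change g x * (N x : E3) i = _
  rw [mul_comm]

lemma coe_mobS_comp_hfoldS {p : S2} {s : ℝ} (hs0 : 0 ≤ s) (hs : s < 1) {w : E3} (hw : ‖w‖ < 1)
    (ha : ‖-(s • (p : E3))‖ < 1) (hb : ‖s • (p : E3)‖ < 1) (x : S2) :
    mobS w hw (mobS (-(s • (p : E3))) ha (hfoldS p (mobS (s • (p : E3)) hb x)))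
      = mobS w hw (fold p s x) := by
  congr 1
  ext1
  rw [coe_fold p hs0 hs]
  rfl

lemma integral_mul_energyDensity_comp_mobS {N : S2 → S2} (hN : ContMDiff (𝓡 2) (𝓡 2) ∞ N) {b : E3}
    (hb : ‖b‖ < 1) {θ : S2 → ℝ} (hθ : Continuous θ) :
    ∫ x, θ (mobS b hb x) * energyDensity (N ∘ mobS b hb) x ∂roundVolume
      = ∫ y, θ y * energyDensity N y ∂roundVolume := by
  have hm : Measurable fun y => θ y * energyDensity N y :=
    (hθ.mul (continuous_energyDensity hN)).measurable
  rw [← integral_comp_mobS hb hm]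
  refine integral_congr_ae (Eventually.of_forall fun x => ?_)
  simp only
  rw [energyDensity_comp_mobS hN hb]
  ring

lemma dirichlet_self_le {φ : SmoothFun} {G : ℝ} (hφ : ∀ x, ‖sphGrad φ x‖ ≤ G) :
    dirichlet φ φ ≤ 4 * Real.pi * G ^ 2 := by
  calc dirichlet φ φ ≤ ∫ _, G ^ 2 ∂roundVolume := by
        refine integral_mono (integrable_of_continuous _
          (continuous_inner_sphGrad φ.contMDiff_one φ.contMDiff_one)) (integrable_const _) fun x => ?_
        simp only [real_inner_self_eq_norm_sq]
        exact pow_le_pow_left₀ (norm_nonneg _) (hφ x) 2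
    _ = 4 * Real.pi * G ^ 2 := by
        rw [integral_const, roundVolume_real_univ, smul_eq_mul]

/-- X is the weighted energy, Y its value for the bubble configuration and Z twice the integral
against μ. From 4A ≤ D follow √A ≤ √D/2 and, as D ≤ 16π, √A ≤ 4; hence A ≤ 2√D, and all errors are
multiples of √D. -/
lemma abs_le_of_estimates {m D A X Y Z G L T : ℝ} (hL : 0 ≤ L) (hA : 0 ≤ A)
    (hD : D = 16 * Real.pi - 2 * m) (hm : 0 ≤ m) (hA4 : 0 ≤ D - 4 * A)
    (hT : T ≤ 112 * Real.pi + 12 * Real.pi * G ^ 2) (hX : (X - Z) ^ 2 ≤ (D - 4 * A) * T)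
    (hXY : |X - Y| ≤ 4 * A + 8 * Real.pi * (L * (16 * √A))) :
    |Y - Z| ≤ (√(112 * Real.pi + 12 * Real.pi * G ^ 2) + 8 + 64 * Real.pi * L) * √D := by
  have hπ := Real.pi_pos
  have hD0 : 0 ≤ D := by linarith
  have h1 : |X - Z| ≤ √(112 * Real.pi + 12 * Real.pi * G ^ 2) * √D := by
    rw [← Real.sqrt_mul (by positivity)]
    refine Real.abs_le_sqrt (hX.trans ?_)
    calc (D - 4 * A) * T ≤ (D - 4 * A) * (112 * Real.pi + 12 * Real.pi * G ^ 2) :=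
          mul_le_mul_of_nonneg_left hT hA4
      _ ≤ D * (112 * Real.pi + 12 * Real.pi * G ^ 2) :=
          mul_le_mul_of_nonneg_right (by linarith) (by positivity)
      _ = _ := mul_comm _ _
  have h2 : √A ≤ √D / 2 := by
    rw [Real.sqrt_le_left (by positivity), div_pow, Real.sq_sqrt hD0]
    linarith
  have h3 : √A ≤ 4 := by
    rw [Real.sqrt_le_left (by norm_num)]
    linarith [Real.pi_lt_four]
  have h4 : A ≤ 2 * √D := by
    have h5 := Real.mul_self_sqrt hA
    nlinarith [Real.sqrt_nonneg A]
  have h6 : 8 * Real.pi * (L * (16 * √A)) ≤ 64 * Real.pi * L * √D := by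
    have := mul_le_mul_of_nonneg_left h2 (by positivity : 0 ≤ 128 * Real.pi * L)
    linarith
  have h7 : |Y - Z| ≤ |X - Z| + |X - Y| := by
    rw [abs_sub_comm X Y, add_comm]; exact abs_sub_le _ _ _
  linarith

/-- Stability against smooth test functions. -/
theorem exists_mobS_estimate (hμ : 4 * Real.pi < μ.real univ) (hadm : Admissible μ)
    (hev : 2 ≤ eigenvalue 2 μ) :
    0 ≤ 16 * Real.pi - 2 * μ.real univ ∧ ∃ (w : E3) (hw : ‖w‖ < 1) (q : S2), ∀ (φ : SmoothFun) (G L : ℝ),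
      (∀ x, |φ x| ≤ 1) → (∀ x, ‖sphGrad φ x‖ ≤ G) → 0 ≤ L →
      (∀ x y : S2, |φ x - φ y| ≤ L * ‖(x : E3) - y‖) →
      |(2 * ∫ z, φ z ∂roundVolume + 8 * Real.pi * φ q) - 2 * ∫ x, φ (mobS w hw x) ∂μ|
        ≤ (√(112 * Real.pi + 12 * Real.pi * G ^ 2) + 8 + 64 * Real.pi * L)
          * √(16 * Real.pi - 2 * μ.real univ) := by
  have hπ := Real.pi_pos
  have : NullSingletonClass μ := ⟨hadm.measure_singleton⟩
  have hμ0 : μ ≠ 0 := by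
    rintro rfl
    simp at hμ
    linarith
  obtain ⟨ψ, α, β, hform⟩ := exists_augmented_form hμ0 hev
  obtain ⟨h, hh, hgreen⟩ := exists_green ψ
  -- The weight is 2ψ so that the zero of the field says precisely that `excess` of each coordinate
  -- with ψ vanishes.
  have hψi : Integrable (fun x => 2 * ψ x) μ :=
    integrable_of_continuous μ (continuous_const.mul ψ.contMDiff.continuous)
  obtain ⟨p, s, w, hs0, hs1, hw, hb1, hb2⟩ := exists_balanced_fold hμ0 hh hψi
  have hwm : Measurable (mobS w hw) := (contMDiff_mobS hw).continuous.measurable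
  set N₀ : S2 → S2 := fun x => mobS w hw (fold p s x) with hN₀
  have hN₀m : Measurable N₀ := hwm.comp (measurable_fold p s)
  have h1 : ∀ i, ∫ x, (N₀ x : E3) i ∂μ = 0 := fun i => by
    have h3 := integral_smul_coord (integrable_const (1 : ℝ) (μ := μ)) hN₀m i
    simp only [one_smul, mul_one] at h3
    rw [← h3, show ∫ x, (N₀ x : E3) ∂μ = 0 from hb1]
    rfl
  have h2 : ∀ i, ∫ x, (N₀ x : E3) i * h x ∂roundVolume = 2 * ∫ x, (N₀ x : E3) i * ψ x ∂μ := fun i => by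
    rw [← integral_smul_coord hh hN₀m i, show ∫ x, h x • (N₀ x : E3) ∂roundVolume
      = ∫ x, (2 * ψ x) • (N₀ x : E3) ∂μ from hb2, integral_smul_coord hψi hN₀m i, ← integral_const_mul]
    refine integral_congr_ae (Eventually.of_forall fun x => ?_)
    simp only
    ring
  rcases hs1.eq_or_lt with rfl | hs1
  -- Without a fold the balanced map is conformal with energy 8π, and nonnegativity would give μ(S²)
  -- ≤ 4π.
  · exfalso
    have h3 := (augmented_limit hform hh hgreen (N := fun _ => mobS w hw) (N₀ := N₀)
      (fun _ => contMDiff_mobS hw) (fun x => by simp [hN₀, fold_one]) h1 h2 oneFun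
      tendsto_const_nhds tendsto_const_nhds tendsto_const_nhds).1
    rw [integral_energyDensity_mobS] at h3
    linarith
  have hb : ‖s • (p : E3)‖ < 1 := norm_smul_lt_one p hs0 hs1
  have ha : ‖-(s • (p : E3))‖ < 1 := by rwa [norm_neg]
  set M : S2 → S2 := mobS w hw ∘ mobS (-(s • (p : E3))) ha with hM
  have hMs : ContMDiff (𝓡 2) (𝓡 2) ∞ M := contMDiff_mobS_comp hw ha
  let ε : ℕ → ℝ := fun n => 1 / ((n : ℝ) + 1)
  have hε0 : ∀ n, 0 < ε n := fun n => by positivity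
  have hε : Tendsto ε atTop (𝓝 0) := tendsto_one_div_add_atTop_nhds_zero_nat
  have hMfs : ∀ n, ContMDiff (𝓡 2) (𝓡 2) ∞ (M ∘ smoothFold p (ε n)) := fun n =>
    hMs.comp (contMDiff_smoothFold p (hε0 n))
  -- The smoothing is done in the frame where the folding circle is a great circle, then transported
  -- back by the Möbius maps.
  let N : ℕ → S2 → S2 := fun n => (M ∘ smoothFold p (ε n)) ∘ mobS (s • (p : E3)) hb
  have hNs : ∀ n, ContMDiff (𝓡 2) (𝓡 2) ∞ (N n) := fun n => (hMfs n).comp (contMDiff_mobS hb)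
  have hNlim : ∀ x, Tendsto (fun n => N n x) atTop (𝓝 (N₀ x)) := fun x => by
    have h3 := (hMs.continuous.tendsto _).comp (tendsto_smoothFold p (mobS (s • (p : E3)) hb x) hε)
    rwa [show M (hfoldS p (mobS (s • (p : E3)) hb x)) = N₀ x from
      coe_mobS_comp_hfoldS hs0 hs1 hw ha hb x] at h3
  have hlim : ∀ θ : S2 → ℝ, Continuous θ → Tendsto
      (fun n => ∫ x, θ (mobS (s • (p : E3)) hb x) * energyDensity (N n) x ∂roundVolume) atTop
      (𝓝 (∫ y, θ y * energyDensity M (hfoldS p y) ∂roundVolume)) := fun θ hθ => by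
    refine (tendsto_integral_mul_energyDensity hMs p hε0 hε hθ).congr fun n => ?_
    exact (integral_mul_energyDensity_comp_mobS (hMfs n) hb hθ).symm
  obtain ⟨a', β', hcap⟩ := exists_halfspace_mobS_comp hw ha (p : E3)
  set A := roundVolume.real {z : S2 | ⟪a', (z : E3)⟫_ℝ ≤ β'} with hA
  have hA0 : 0 ≤ A := measureReal_nonneg
  obtain ⟨hE, hest⟩ := abs_integral_sub_le (continuous_energyDensity hMs) (energyDensity_nonneg M)
    hMs.continuous (fun g hg => integral_comp_mul_energyDensity hw ha hg) (p := p) hcap hA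
  have hlimE : Tendsto (fun n => ∫ x, energyDensity (N n) x ∂roundVolume) atTop
      (𝓝 (16 * Real.pi - 4 * A)) := by
    have h3 := hlim (fun _ => 1) continuous_const
    simp only [one_mul, hE] at h3
    exact h3
  have hmain := fun φ : SmoothFun => augmented_limit hform hh hgreen hNs hNlim h1 h2
    (φ.compMap (mobS w hw) (contMDiff_mobS hw)) hlimE
    (Λ := ∫ y, φ (M y) * energyDensity M (hfoldS p y) ∂roundVolume)
    (K := ∫ y, φ (M y) ^ 2 * energyDensity M (hfoldS p y) ∂roundVolume)
  have hMb : ∀ x, M (mobS (s • (p : E3)) hb x) = mobS w hw x := fun x => by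
    change mobS w hw (mobS (-(s • (p : E3))) ha (mobS (s • (p : E3)) hb x)) = _
    congr 1
    exact Subtype.ext (mob_neg_mob hb (by simp))
  have hφM := fun φ : SmoothFun => φ.contMDiff.continuous.comp hMs.continuous
  have hmain' := fun φ : SmoothFun => hmain φ
    ((hlim (fun y => φ (M y)) (hφM φ)).congr fun n => by simp only [hMb]; rfl)
    ((hlim (fun y => φ (M y) ^ 2) ((hφM φ).pow 2)).congr fun n => by simp only [hMb]; rfl)
  have hD := (hmain' oneFun).1
  -- `hD` reads 4A ≤ 16π − 2μ(S²), so the deficit is nonnegative and μ(S²) ≤ 8π. The bubble is at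
  -- the image of the pole of the folded hemisphere.
  refine ⟨by linarith, w, hw, M (-p), fun φ G L hφ1 hφG hL hφL => ?_⟩
  obtain ⟨hK, hΛ⟩ := hest φ φ.contMDiff.continuous hφ1
  have hdir : dirichlet (φ.compMap (mobS w hw) (contMDiff_mobS hw))
      (φ.compMap (mobS w hw) (contMDiff_mobS hw)) ≤ 4 * Real.pi * G ^ 2 :=
    (dirichlet_comp_mobS hw φ φ).trans_le (dirichlet_self_le hφG)
  have hsq : ∫ x, (φ.compMap (mobS w hw) (contMDiff_mobS hw)) x ^ 2 ∂μ ≤ 8 * Real.pi := by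
    have h3 : ∫ x, (φ.compMap (mobS w hw) (contMDiff_mobS hw)) x ^ 2 ∂μ ≤ ∫ _, (1 : ℝ) ∂μ := by
      refine integral_mono (integrable_of_continuous μ
        ((φ.compMap (mobS w hw) (contMDiff_mobS hw)).contMDiff.continuous.pow 2))
        (integrable_const _) fun x => ?_
      exact (sq_le_one_iff_abs_le_one _).2 (hφ1 _)
    rw [integral_const, smul_eq_mul, mul_one] at h3
    linarith
  have hX := (hmain' φ).2
  rw [sub_right_comm] at hX
  exact abs_le_of_estimates hL hA0 rfl measureReal_nonneg (by linarith) (by linarith) hX (hΛ L hL hφL)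

/-- Stability against continuously differentiable test functions. -/
theorem exists_mobS_dual_estimate (hμ : 4 * Real.pi < μ.real univ) (hadm : Admissible μ)
    (hev : 2 ≤ eigenvalue 2 μ) :
    0 ≤ 16 * Real.pi - 2 * μ.real univ ∧ ∃ (w : E3) (hw : ‖w‖ < 1) (q : S2), ∀ φ : S2 → ℝ,
      ContMDiff (𝓡 2) 𝓘(ℝ, ℝ) 1 φ → c1Norm φ ≤ 1 →
      |(∫ z, φ z ∂roundVolume + 4 * Real.pi * φ q) - ∫ x, φ (mobS w hw x) ∂μ|
        ≤ 3000 * √(16 * Real.pi - 2 * μ.real univ) := by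
  have hπ := Real.pi_pos
  have hπ4 := Real.pi_lt_four
  obtain ⟨hD, w, hw, q, hest⟩ := exists_mobS_estimate hμ hadm hev
  refine ⟨hD, w, hw, q, fun φ hφ hc => ?_⟩
  have hcont : Continuous φ := hφ.continuous
  have h1 : ∀ x, |φ x| ≤ 1 := fun x => by
    have : ‖φ x‖ₑ ≤ 1 := (le_iSup (fun x => ‖φ x‖ₑ) x).trans (le_self_add.trans hc)
    rwa [← ofReal_norm, ENNReal.ofReal_le_one] at this
  have h2 : ∀ x, ‖sphGrad φ x‖ ≤ 1 := fun x => by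
    have : ‖sphGrad φ x‖ₑ ≤ 1 := (le_iSup (fun x => ‖sphGrad φ x‖ₑ) x).trans (le_add_self.trans hc)
    rwa [← ofReal_norm, ENNReal.ofReal_le_one] at this
  have hlip := lipschitz_of_norm_sphGrad_le hφ h1 h2
  set S := √(16 * Real.pi - 2 * μ.real univ)
  have hS0 : 0 ≤ S := Real.sqrt_nonneg _
  set m := μ.real univ
  have hm0 : 0 ≤ m := measureReal_nonneg
  refine le_of_forall_pos_le_add fun ε hε => ?_
  -- Replacing φ by f costs η times the total mass 8π + m: 4π from dv, 4π from the bubble and m from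
  -- μ.
  obtain ⟨f, hf1, hfL, hfφ⟩ := exists_smooth_lipschitz_approx hcont h1 (L := 4) (by norm_num) hlip
    (η := ε / (8 * Real.pi + m)) (by positivity)
  set η := ε / (8 * Real.pi + m) with hη
  have hηε : (8 * Real.pi + m) * η = ε := mul_div_cancel₀ _ (by positivity)
  -- C¹-norm at most 1 gives Lipschitz constant 4, mollification multiplies it by 4, and the
  -- gradient is at most 4 times the resulting 16.
  have h3 := hest f 64 16 hf1 (fun x => by
    have := norm_sphGrad_le_of_lipschitz f.contMDiff_one (L := 4 * 4) (by norm_num) hfL x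
    linarith) (by norm_num) (fun x y => by have := hfL x y; linarith)
  -- 6000 is twice 3000, because the smooth estimate concerns twice the measures.
  have h4 : √(112 * Real.pi + 12 * Real.pi * 64 ^ 2) + 8 + 64 * Real.pi * 16 ≤ 6000 := by
    have : √(112 * Real.pi + 12 * Real.pi * 64 ^ 2) ≤ 500 := by
      rw [Real.sqrt_le_left (by norm_num)]
      linarith
    linarith
  have h5 := mul_le_mul_of_nonneg_right h4 hS0
  have hclose : ∀ (ν : Measure S2) [IsFiniteMeasure ν] (T : S2 → S2), Continuous T →
      |∫ x, f (T x) ∂ν - ∫ x, φ (T x) ∂ν| ≤ ν.real univ * η := fun ν _ T hT => by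
    have i1 : Integrable (fun x => f (T x)) ν :=
      integrable_of_continuous ν (f.contMDiff.continuous.comp hT)
    have i2 : Integrable (fun x => φ (T x)) ν := integrable_of_continuous ν (hcont.comp hT)
    rw [← integral_sub i1 i2, mul_comm, ← Real.norm_eq_abs]
    exact norm_integral_le_of_norm_le_const (Eventually.of_forall fun x => hfφ (T x))
  have h6 := hclose roundVolume id continuous_id
  have h7 := hclose μ (mobS w hw) (contMDiff_mobS hw).continuous
  rw [roundVolume_real_univ] at h6
  simp only [id] at h6
  have h8 : |4 * Real.pi * f q - 4 * Real.pi * φ q| ≤ 4 * Real.pi * η := by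
    rw [← mul_sub, abs_mul, abs_of_pos (by positivity : 0 < 4 * Real.pi)]
    exact mul_le_mul_of_nonneg_left (hfφ q) (by positivity)
  have h9 : 8 * Real.pi * f q = 2 * (4 * Real.pi * f q) := by ring
  rw [abs_le] at h3 h6 h7 h8 ⊢
  constructor <;> linarith [h3.1, h3.2, h6.1, h6.2, h7.1, h7.2, h8.1, h8.2]

lemma integral_bubbleMeasure {φ : S2 → ℝ} (hφ : Continuous φ) (q : S2) :
    ∫ x, φ x ∂bubbleMeasure q = ∫ x, φ x ∂roundVolume + 4 * Real.pi * φ q := by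
  have := Measure.smul_finite (Measure.dirac q) (c := ENNReal.ofReal (4 * Real.pi)) ENNReal.ofReal_ne_top
  rw [bubbleMeasure, integral_add_measure (integrable_of_continuous _ hφ)
    (integrable_of_continuous _ hφ), integral_smul_measure, integral_dirac,
    ENNReal.toReal_ofReal (by positivity), smul_eq_mul]

lemma c1DualNorm_le {ν₁ ν₂ : Measure S2} [IsFiniteMeasure ν₁] [IsFiniteMeasure ν₂] {C : ℝ} (hC : 0 ≤ C)
    (h : ∀ φ : S2 → ℝ, ContMDiff (𝓡 2) 𝓘(ℝ, ℝ) 1 φ → c1Norm φ ≤ 1 →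
      |∫ x, φ x ∂ν₁ - ∫ x, φ x ∂ν₂| ≤ C) : c1DualNorm ν₁ ν₂ ≤ C := by
  refine ENNReal.toReal_le_of_le_ofReal hC (iSup_le fun φ => iSup_le fun hφ => iSup_le fun hc => ?_)
  rw [← ofReal_norm]
  exact ENNReal.ofReal_le_ofReal (h φ hφ hc)

lemma c1DualNorm_le_add (ν₁ ν₂ : Measure S2) [IsFiniteMeasure ν₁] [IsFiniteMeasure ν₂] :
    c1DualNorm ν₁ ν₂ ≤ ν₁.real univ + ν₂.real univ := by
  have hle : ∀ (ν : Measure S2) [IsFiniteMeasure ν] (φ : S2 → ℝ), c1Norm φ ≤ 1 →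
      |∫ x, φ x ∂ν| ≤ ν.real univ := fun ν _ φ hc => by
    have h := enorm_integral_le_of_c1Norm ν hc
    rw [← ofReal_norm, ENNReal.ofReal_le_iff_le_toReal (measure_ne_top ν univ)] at h
    exact h
  exact c1DualNorm_le (by positivity) fun φ _ hc =>
    (abs_sub _ _).trans (add_le_add (hle ν₁ φ hc) (hle ν₂ φ hc))

lemma bubbleMeasure_real_univ (q : S2) : (bubbleMeasure q).real univ = 8 * Real.pi := by
  have h := integral_bubbleMeasure (φ := fun _ => 1) continuous_const q
  simp only [integral_const, smul_eq_mul, mul_one, roundVolume_real_univ] at h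
  linarith

end Stability

end SphereStability

end

/-! ### The stability theorem -/

theorem theorem1p6 :
    ∃ c : ℝ, 0 < c ∧
      ∀ (μ : MeasureTheory.Measure S2) [MeasureTheory.IsFiniteMeasure μ],
        Admissible μ → eigenvalue 2 μ = 2 →
          ∃ Φ : S2 ≃ₘ^∞⟮𝓡 2, 𝓡 2⟯ S2, IsConformalAutomorphism Φ ∧ ∃ p : S2,
            16 * Real.pi - (normalizedEigenvalue 2 μ).toReal ≥
              c * c1DualNorm (bubbleMeasure p) (μ.map Φ) ^ 2 := by
  have hπ := Real.pi_pos
  have hπ4 := Real.pi_lt_four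
  -- The constant is 1/3000².
  refine ⟨1 / 9000000, by norm_num, fun μ _ hadm hev => ?_⟩
  have hnorm : (normalizedEigenvalue 2 μ).toReal = 2 * μ.real Set.univ := by
    rw [normalizedEigenvalue, hev, ENNReal.toReal_mul]
    rfl
  rw [hnorm]
  have hmeas : ∀ {w : E3} (hw : ‖w‖ < 1), Measurable (mobS w hw) := fun hw =>
    (contMDiff_mobS hw).continuous.measurable
  -- For small mass the deficit is at least 8π while the dual norm is at most 8π + 4π, so the
  -- identity and any point will do.
  rcases le_or_gt (μ.real Set.univ) (4 * Real.pi) with hμ | hμ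
  · have h0 : ‖(0 : E3)‖ < 1 := by simp
    refine ⟨mobS 0 h0, isConformalAutomorphism_mobS h0, hemisphereParam 0, ?_⟩
    have h1 := c1DualNorm_le_add (bubbleMeasure (hemisphereParam 0)) (μ.map (mobS 0 h0))
    rw [bubbleMeasure_real_univ, map_measureReal_apply (hmeas h0) MeasurableSet.univ,
      Set.preimage_univ] at h1
    have h2 : 0 ≤ c1DualNorm (bubbleMeasure (hemisphereParam 0)) (μ.map (mobS 0 h0)) :=
      ENNReal.toReal_nonneg
    nlinarith
  · obtain ⟨hD, w, hw, q, hest⟩ := exists_mobS_dual_estimate hμ hadm hev.ge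
    refine ⟨mobS w hw, isConformalAutomorphism_mobS hw, q, ?_⟩
    have h1 : c1DualNorm (bubbleMeasure q) (μ.map (mobS w hw))
        ≤ 3000 * √(16 * Real.pi - 2 * μ.real Set.univ) := by
      refine c1DualNorm_le (by positivity) fun φ hφ hc => ?_
      rw [integral_bubbleMeasure hφ.continuous,
        integral_map (hmeas hw).aemeasurable hφ.continuous.aestronglyMeasurable]
      exact hest φ hφ hc
    have h0 : 0 ≤ c1DualNorm (bubbleMeasure q) (μ.map (mobS w hw)) := ENNReal.toReal_nonneg
    have h2 := pow_le_pow_left₀ h0 h1 2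
    rw [mul_pow, Real.sq_sqrt hD] at h2
    linarith
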